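/- Let $r_0>0$, let $\omega=\{x\in\mathbb{R}^2:|x|<r_0\}$, and let $A$ be a $C^1$ real vector potential on $\overline\omega$ whose magnetic field is radial, $\partial_1A_2-\partial_2A_1=B(|x|)$ in $\omega$. Let $H_\omega(A)=(i\nabla+A)^2$ be the magnetic Dirichlet Laplacian on $\omega$, i.e. the self-adjoint operator in $L^2(\omega)$ associated with the closed quadratic form $\|(i\nabla+A)u\|^2_{L^2(\omega)}$, $u\in H^1_0(\omega)$. Put $$\alpha:=\int_0^{r_0}sB(s)\,ds ,$$ and assume that $\alpha<\tfrac12$ and that $$0\le\int_0^r sB(s)\,ds\le\alpha\qquad\text{for all } r\in[0,r_0]$$ (the latter holds in particular whenever $B\ge0$). Let $$S=-\Delta_D^\omega+\frac1{x^2+y^2}\left(\int_0^{\sqrt{x^2+y^2}}sB(s)\,ds\right)^2$$ be the Schrödinger operator on $\omega$ with Dirichlet boundary condition. For an operator $T$ with eigenvalues $\lambda_k$, repeated according to multiplicity, write $\mathrm{tr}(\Lambda-T)_+^\sigma=\sum_{k:\,\lambda_k<\Lambda}(\Lambda-\lambda_k)^\sigma$; for $\sigma=0$ this is the number of eigenvalues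 below $\Lambda$. Then for all $\Lambda,\sigma\ge0$ the trace $\mathrm{tr}(\Lambda-S)_+^\sigma$ is finite and $$\mathrm{tr}(\Lambda-H_\omega(A))_+^\sigma\le\left(\frac1{\sqrt{1-2\alpha}}+\sup_{n\in\mathbb{N}}\left\{\frac n{\sqrt{1-2\alpha}}\right\}\right)\mathrm{tr}(\Lambda-S)_+^\sigma ,$$ where $\{t\}$ denotes the fractional part of $t$. Moreover, the spectra of $H_\omega(A)$ and $S$ are non-empty and bounded below, and $\inf\sigma(H_\omega(A))\ge\inf\sigma(S)$. -/

import Mathlib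

open MeasureTheory Set
open scoped ENNReal ContDiff InnerProductSpace

noncomputable section

namespace MagDisc

/-- The Euclidean plane. -/
abbrev Plane : Type := EuclideanSpace ℝ (Fin 2)

/-- The complex Hilbert space `L²(Ω)`. -/
abbrev L2 (Ω : Set Plane) : Type := Lp ℂ 2 (volume.restrict Ω)

/-- The `j`-th standard basis vector of the plane. -/
def basisVec (j : Fin 2) : Plane := EuclideanSpace.single j 1

/-- The (scalar) magnetic field `∂₁A₂ - ∂₂A₁` of a planar vector potential. -/
def curl (A : Plane → Plane) (x : Plane) : ℝ :=
  fderiv ℝ A x (basisVec 0) 1 - fderiv ℝ A x (basisVec 1) 0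

/-- `∫₀^r s B(s) ds`. -/
def radialFlux (B : ℝ → ℝ) (r : ℝ) : ℝ := ∫ s in (0 : ℝ)..r, s * B s

/-- `φ ∈ C_c^∞(Ω)`. -/
def IsTestFunction (Ω : Set Plane) (φ : Plane → ℂ) : Prop :=
  ContDiff ℝ ∞ φ ∧ HasCompactSupport φ ∧ tsupport φ ⊆ Ω

/-- The graph `{(φ, ∇φ) : φ ∈ C_c^∞(Ω)}` of the gradient on test functions, in
`L²(Ω) × L²(Ω)²`. -/
def testGradientGraph (Ω : Set Plane) : Submodule ℂ (L2 Ω × (Fin 2 → L2 Ω)) where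
  carrier := {p | ∃ φ : Plane → ℂ, IsTestFunction Ω φ ∧
    (p.1 : Plane → ℂ) =ᵐ[volume.restrict Ω] φ ∧
    ∀ j, (p.2 j : Plane → ℂ) =ᵐ[volume.restrict Ω] fun x => fderiv ℝ φ x (basisVec j)}
  zero_mem' := by
    refine ⟨0, ⟨contDiff_const, HasCompactSupport.zero, by simp [tsupport]⟩,
      Lp.coeFn_zero _ _ _, fun j => ?_⟩
    filter_upwards [Lp.coeFn_zero ℂ 2 (volume.restrict Ω)] with x hx
    simp only [Prod.snd_zero, Pi.zero_apply, hx]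
    simp
  add_mem' := by
    rintro p q ⟨φ, ⟨h1, h2, h3⟩, hu, hg⟩ ⟨ψ, ⟨k1, k2, k3⟩, hv, hh⟩
    refine ⟨φ + ψ, ⟨h1.add k1, h2.add k2,
      (tsupport_add φ ψ).trans (union_subset h3 k3)⟩, ?_, fun j => ?_⟩
    · filter_upwards [Lp.coeFn_add p.1 q.1, hu, hv] with x e1 e2 e3
      simp only [Prod.fst_add, Pi.add_apply, e1, e2, e3]
    · filter_upwards [Lp.coeFn_add (p.2 j) (q.2 j), hg j, hh j] with x e1 e2 e3
      have d1 : DifferentiableAt ℝ φ x := (h1.differentiable (by simp)) x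
      have d2 : DifferentiableAt ℝ ψ x := (k1.differentiable (by simp)) x
      simp only [Prod.snd_add, Pi.add_apply, e1, e2, e3, fderiv_add d1 d2]
      rfl
  smul_mem' := by
    rintro c p ⟨φ, ⟨h1, h2, h3⟩, hu, hg⟩
    refine ⟨c • φ, ⟨h1.const_smul c, h2.smul_left (f := fun _ => c),
      (tsupport_smul_subset_right (fun _ => c) φ).trans h3⟩, ?_, fun j => ?_⟩
    · filter_upwards [Lp.coeFn_smul c p.1, hu] with x e1 e2
      simp [e1, e2]
    · filter_upwards [Lp.coeFn_smul c (p.2 j), hg j] with x e1 e2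
      have d1 : DifferentiableAt ℝ φ x := (h1.differentiable (by simp)) x
      simp [e1, e2, fderiv_const_smul d1 c]

/-- `{(u, ∇u) : u ∈ H¹₀(Ω)}`. As `H¹₀(Ω)` is the closure of `C_c^∞(Ω)` in the norm
`(‖u‖² + ‖∇u‖²)^{1/2}`, this is the closure of the graph of the gradient on `C_c^∞(Ω)`. -/
def sobolevGraph (Ω : Set Plane) : Submodule ℂ (L2 Ω × (Fin 2 → L2 Ω)) :=
  (testGradientGraph Ω).topologicalClosure

/-- `{(u, (i∇ + A)u) : u ∈ H¹₀(Ω), (i∇ + A)u ∈ L²(Ω)²}`. If `A` is bounded on `Ω`, then every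
`u ∈ H¹₀(Ω)` occurs here. -/
def magneticGraph (Ω : Set Plane) (A : Plane → Plane) :
    Submodule ℂ (L2 Ω × (Fin 2 → L2 Ω)) where
  carrier := {p | ∃ g : Fin 2 → L2 Ω, (p.1, g) ∈ sobolevGraph Ω ∧
    ∀ j, (p.2 j : Plane → ℂ) =ᵐ[volume.restrict Ω]
      fun x => Complex.I * g j x + (A x j : ℂ) * p.1 x}
  zero_mem' := by
    refine ⟨0, (sobolevGraph Ω).zero_mem, fun j => ?_⟩
    filter_upwards [Lp.coeFn_zero ℂ 2 (volume.restrict Ω)] with x hx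
    simp only [Prod.snd_zero, Prod.fst_zero, Pi.zero_apply, hx]
    simp
  add_mem' := by
    rintro p q ⟨g, hg, hp⟩ ⟨h, hh, hq⟩
    refine ⟨g + h, (sobolevGraph Ω).add_mem hg hh, fun j => ?_⟩
    filter_upwards [Lp.coeFn_add (p.2 j) (q.2 j), Lp.coeFn_add (g j) (h j),
      Lp.coeFn_add p.1 q.1, hp j, hq j] with x e1 e2 e3 e4 e5
    simp only [Prod.snd_add, Prod.fst_add, Pi.add_apply, e1, e2, e3, e4, e5]
    ring
  smul_mem' := by
    rintro c p ⟨g, hg, hp⟩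
    refine ⟨c • g, (sobolevGraph Ω).smul_mem c hg, fun j => ?_⟩
    filter_upwards [Lp.coeFn_smul c (p.2 j), Lp.coeFn_smul c (g j),
      Lp.coeFn_smul c p.1, hp j] with x e1 e2 e3 e4
    simp only [Prod.smul_snd, Prod.smul_fst, Pi.smul_apply, smul_eq_mul, e1, e2, e3, e4]
    ring

/-- The graph of the operator `(i∇ + A)² + V` on `Ω` with Dirichlet boundary condition, for `A`
and `V` bounded on `Ω`: the operator associated with the closed quadratic form
`‖(i∇ + A)u‖² + ∫_Ω V |u|²`, `u ∈ H¹₀(Ω)`. A pair `(u, f)` belongs to it if `u ∈ H¹₀(Ω)` and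
`⟨(i∇ + A)v, (i∇ + A)u⟩ + ⟨v, V u⟩ = ⟨v, f⟩` for all `v ∈ H¹₀(Ω)`. -/
def dirichletOperator (Ω : Set Plane) (A : Plane → Plane) (V : Plane → ℝ) :
    Submodule ℂ (L2 Ω × L2 Ω) where
  carrier := {p | ∃ (w : Fin 2 → L2 Ω) (z : L2 Ω), (p.1, w) ∈ magneticGraph Ω A ∧
    ((z : Plane → ℂ) =ᵐ[volume.restrict Ω] fun x => (V x : ℂ) * p.1 x) ∧
    ∀ q ∈ magneticGraph Ω A, (∑ j, ⟪q.2 j, w j⟫_ℂ) + ⟪q.1, z⟫_ℂ = ⟪q.1, p.2⟫_ℂ}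
  zero_mem' := by
    refine ⟨0, 0, (magneticGraph Ω A).zero_mem, ?_, fun q _ => by simp⟩
    filter_upwards [Lp.coeFn_zero ℂ 2 (volume.restrict Ω)] with x hx
    simp only [Prod.fst_zero, Pi.zero_apply, hx, mul_zero]
  add_mem' := by
    rintro p p' ⟨w, z, h1, h2, h3⟩ ⟨w', z', k1, k2, k3⟩
    refine ⟨w + w', z + z', (magneticGraph Ω A).add_mem h1 k1, ?_, fun q hq => ?_⟩
    · filter_upwards [Lp.coeFn_add z z', Lp.coeFn_add p.1 p'.1, h2, k2] with x e1 e2 e3 e4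
      simp only [Prod.fst_add, Pi.add_apply, e1, e2, e3, e4]
      ring
    · simp only [Pi.add_apply, Prod.snd_add, inner_add_right, Finset.sum_add_distrib,
        ← h3 q hq, ← k3 q hq]
      ring
  smul_mem' := by
    rintro c p ⟨w, z, h1, h2, h3⟩
    refine ⟨c • w, c • z, (magneticGraph Ω A).smul_mem c h1, ?_, fun q hq => ?_⟩
    · filter_upwards [Lp.coeFn_smul c z, Lp.coeFn_smul c p.1, h2] with x e1 e2 e3
      simp only [Prod.smul_fst, Pi.smul_apply, smul_eq_mul, e1, e2, e3]
      ring
    · simp only [Pi.smul_apply, Prod.smul_snd, inner_smul_right, ← Finset.mul_sum,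
        ← h3 q hq]
      ring

/-- The magnetic Dirichlet Laplacian `H_Ω(A) = (i∇ + A)²` on `Ω`. -/
def magneticLaplacian (Ω : Set Plane) (A : Plane → Plane) : Submodule ℂ (L2 Ω × L2 Ω) :=
  dirichletOperator Ω A 0

/-- The Dirichlet Schrödinger operator `-Δ + V` on `Ω`. -/
def schrodingerOperator (Ω : Set Plane) (V : Plane → ℝ) : Submodule ℂ (L2 Ω × L2 Ω) :=
  dirichletOperator Ω 0 V

/-- The eigenspace `ker (T - μ)` of the operator with graph `T`. -/
def eigenspace {Ω : Set Plane} (T : Submodule ℂ (L2 Ω × L2 Ω)) (μ : ℝ) :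
    Submodule ℂ (L2 Ω) :=
  T.comap (LinearMap.prod LinearMap.id ((μ : ℂ) • LinearMap.id))

/-- The multiplicity `dim ker (T - μ)` (zero if `μ` is not an eigenvalue). -/
def multiplicity {Ω : Set Plane} (T : Submodule ℂ (L2 Ω × L2 Ω)) (μ : ℝ) : ℕ∞ :=
  Cardinal.toENat (Module.rank ℂ (eigenspace T μ))

/-- `tr (Λ - T)₊^σ = ∑ₖ (Λ - λₖ)₊^σ` for a self-adjoint operator `T` with purely discrete
spectrum, where the eigenvalues `λₖ` are repeated according to their multiplicities. For `σ = 0`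
this is the number of eigenvalues smaller than `Λ`. -/
def rieszTrace {Ω : Set Plane} (T : Submodule ℂ (L2 Ω × L2 Ω)) (Λ σ : ℝ) : ℝ≥0∞ :=
  ∑' μ : Iio Λ, ((multiplicity T μ : ℕ∞) : ℝ≥0∞) * ENNReal.ofReal ((Λ - μ) ^ σ)

/-- The resolvent set of the operator with graph `T`: all `z` for which `T - z` has an everywhere
defined bounded inverse `R`. -/
def resolventSet {Ω : Set Plane} (T : Submodule ℂ (L2 Ω × L2 Ω)) : Set ℂ :=
  {z | ∃ R : L2 Ω →L[ℂ] L2 Ω, ∀ u f : L2 Ω, (u, f + z • u) ∈ T ↔ R f = u}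

/-- The (real) spectrum of the operator with graph `T`. -/
def realSpectrum {Ω : Set Plane} (T : Submodule ℂ (L2 Ω × L2 Ω)) : Set ℝ :=
  {x | (x : ℂ) ∉ resolventSet T}

/-- The potential `|x|⁻² (∫₀^{|x|} s B(s) ds)²`. -/
def radialPotential (B : ℝ → ℝ) (x : Plane) : ℝ :=
  1 / (x 0 ^ 2 + x 1 ^ 2) * radialFlux B (Real.sqrt (x 0 ^ 2 + x 1 ^ 2)) ^ 2

/-- `(1 - 2α)^{-1/2} + sup_n {n (1 - 2α)^{-1/2}}`, where `{·}` is the fractional part. -/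
def discConstant (α : ℝ) : ℝ :=
  1 / Real.sqrt (1 - 2 * α) + ⨆ n : ℕ, Int.fract ((n : ℝ) / Real.sqrt (1 - 2 * α))

end MagDisc

end

/-! Write Φ(r) = ∫₀^r s B(s) ds and c = √(1 - 2α). A gauge transformation replaces A on the disc by
the rotationally symmetric potential Φ(|x|) |x|⁻² x^⊥ (`formCount_le_of_gauge`). Both operators then
commute with rotations. On functions of angular momentum m, the centrifugal term is (m - Φ)²/r² for
the magnetic operator H and (m² + Φ²)/r² for S.

For an integer m ≥ 0 one has m ≤ m², so (m - Φ)² - Φ² = m² - 2mΦ ≥ (1 - 2α) m² ≥ ⌊c m⌋². For m < 0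
the same difference is at least m² (`sq_add_sq_le_of_flux`). Multiplication by the phase e^{i(k-m)θ}
is unitary and carries mode m into mode k. It does not raise the energy as long as k² + Φ² ≤ (m -
Φ)². By the variational principle, mode m of H has at most as many eigenvalues below Λ as mode k of
S, where k = ⌊c m⌋ for m ≥ 0 and k = |m| for m < 0 (`formCount_angularMode_le`). The phase is
singular at the origin. It nevertheless preserves H¹₀ on a mode m ≠ 0, because there u/|x| is
controlled by the gradient (`exists_phase_mem_sobolevGraph`).

It remains to sum over m. The counts of the modes of S decrease in |k|, so summation by parts
reduces the claim to bounding the number of m ≥ 0 with c m < K, which is K/c rounded up. The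
rounding costs at most sup {n/c}, because Dirichlet approximation realises 1 - {K/c} as a limit of
fractional parts {n/c} (`add_one_le_mul_add_iSup_fract`). Riesz means are integrals of counting
functions (`tsum_mul_rpow_le`), and the bottoms of the spectra are compared by asking where the
counts vanish.

The operators are handled through their forms. If J embeds the form domain, with norm squared equal
to the form plus ‖u‖², into L², then (T + 1)⁻¹ = J J†. A Rellich estimate makes J compact, so the
spectrum consists of eigenvalues, and Glazman's lemma is available. -/

noncomputable section

namespace MagDisc

open Filter Topology ContinuousLinearMap

/-! ### Dimension counts with values in the extended natural numbers. -/

section Abstract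

universe u v

/-- The dimension of a vector space as an extended natural number. -/
def edim (V : Type u) [AddCommGroup V] [Module ℂ V] : ℕ∞ := Cardinal.toENat (Module.rank ℂ V)

lemma edim_le_of_injective {V W : Type u} [AddCommGroup V] [Module ℂ V] [AddCommGroup W]
    [Module ℂ W] (f : V →ₗ[ℂ] W) (hf : Function.Injective f) : edim V ≤ edim W :=
  Cardinal.toENat.monotone' (LinearMap.rank_le_of_injective f hf)

lemma edim_eq_finrank (V : Type u) [AddCommGroup V] [Module ℂ V] [FiniteDimensional ℂ V] :
    edim V = Module.finrank ℂ V := by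
  rw [edim, ← Module.finrank_eq_rank, Cardinal.toENat_nat]

lemma edim_eq_zero_iff {V : Type u} [AddCommGroup V] [Module ℂ V] :
    edim V = 0 ↔ Subsingleton V := by
  rw [edim, Cardinal.toENat_eq_zero, rank_zero_iff]

lemma finiteDimensional_of_edim_ne_top {V : Type u} [AddCommGroup V] [Module ℂ V]
    (h : edim V ≠ ⊤) : FiniteDimensional ℂ V := by
  rw [edim, Ne, Cardinal.toENat_eq_top, not_le] at h
  exact Module.rank_lt_aleph0_iff.1 h

variable {E F : Type u} [AddCommGroup E] [Module ℂ E] [AddCommGroup F] [Module ℂ F]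

/-- The hypothesis says that the `V i` are independent and that `g` is injective on their sum. The
induction passes from `F` to its quotient by the image of `V a`, and rank-nullity adds the
dimensions without any finiteness assumption. -/
lemma sum_edim_le {ι : Type*} (s : Finset ι) (V : ι → Submodule ℂ E) (g : E →ₗ[ℂ] F)
    (h : ∀ f : ι → E, (∀ i ∈ s, f i ∈ V i) → g (∑ i ∈ s, f i) = 0 → ∀ i ∈ s, f i = 0) :
    ∑ i ∈ s, edim (V i) ≤ edim F := by
  classical
  induction s using Finset.induction_on generalizing F with
  | empty => simp
  | insert a s ha ih =>
    rw [Finset.sum_insert ha]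
    let Q := F ⧸ (V a).map g
    have h1 : ∑ i ∈ s, edim (V i) ≤ edim Q := by
      refine ih (((V a).map g).mkQ ∘ₗ g) fun f hf h0 i hi => ?_
      obtain ⟨y, hy, hgy⟩ := (Submodule.Quotient.mk_eq_zero _).1 h0
      -- If the sum of the `f i` becomes zero in the quotient, its image under `g` equals that of
      -- some `y` in `V a`. Putting `-y` in slot `a` turns this into a relation to which the
      -- hypothesis applies.
      have := h (fun j => if j = a then -y else f j) ?_ ?_ i (Finset.mem_insert_of_mem hi)
      · have hia : i ≠ a := fun hh => ha (hh ▸ hi)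
        simpa [hia] using this
      · intro j hj
        by_cases hja : j = a
        · subst hja; simpa using hy
        · simpa [hja] using hf j ((Finset.mem_insert.1 hj).resolve_left hja)
      · rw [Finset.sum_insert ha]
        have : ∑ x ∈ s, (if x = a then -y else f x) = ∑ x ∈ s, f x :=
          Finset.sum_congr rfl fun x hx => by
            have : x ≠ a := fun hh => ha (hh ▸ hx)
            simp [this]
        rw [this]
        simp [hgy]
    have h2 : edim (V a) ≤ edim ((V a).map g) := by
      refine edim_le_of_injective
        ((g.restrict (p := V a) (q := (V a).map g) fun x hx => Submodule.mem_map_of_mem hx)) ?_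
      rw [injective_iff_map_eq_zero]
      rintro ⟨x, hx⟩ hx0
      have hgx : g x = 0 := congrArg Subtype.val hx0
      have := h (fun j => if j = a then x else 0) ?_ ?_ a (Finset.mem_insert_self _ _)
      · simpa using this
      · intro j _
        by_cases hja : j = a
        · subst hja; simpa using hx
        · simp [hja]
      · rw [Finset.sum_insert ha, Finset.sum_eq_zero]
        · simpa using hgx
        · intro x hx
          have : x ≠ a := fun hh => ha (hh ▸ hx)
          simp [this]
    calc edim (V a) + ∑ i ∈ s, edim (V i) ≤ edim ((V a).map g) + edim Q := add_le_add h2 h1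
      _ = edim F := by
        rw [edim, edim, edim, ← map_add, add_comm, Submodule.rank_quotient_add_rank]

lemma edim_mono {V W : Submodule ℂ E} (h : V ≤ W) : edim V ≤ edim W :=
  edim_le_of_injective (Submodule.inclusion h) (Submodule.inclusion_injective h)

lemma edim_biSup_le {ι : Type*} (s : Finset ι) (V : ι → Submodule ℂ E) :
    edim (⨆ i ∈ s, V i : Submodule ℂ E) ≤ ∑ i ∈ s, edim (V i) := by
  classical
  induction s using Finset.induction_on with
  | empty =>
    have : edim (⨆ i ∈ (∅ : Finset ι), V i : Submodule ℂ E) = 0 := by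
      rw [edim_eq_zero_iff]; simp; infer_instance
    rw [this]; simp
  | insert a s ha ih =>
    rw [Finset.sum_insert ha, Finset.iSup_insert]
    refine le_trans ?_ (add_le_add le_rfl ih)
    rw [edim, edim, edim, ← map_add]
    exact Cardinal.toENat.monotone' (Submodule.rank_add_le_rank_add_rank _ _)

end Abstract

/-! ### Spectral theory of a self-adjoint operator given by the embedding of its form domain. -/

section Abstract

universe u v

variable {E : Type u} [NormedAddCommGroup E] [InnerProductSpace ℂ E] [CompleteSpace E]
  {D : Type v} [NormedAddCommGroup D] [InnerProductSpace ℂ D] [CompleteSpace D]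

/-- The eigenspace at `μ` of the self-adjoint operator `T` with `(T + 1)⁻¹ = J J†`. -/
def formEigenspace (J : D →L[ℂ] E) (μ : ℝ) : Submodule ℂ E where
  carrier := {x | x = ((1 + μ : ℝ) : ℂ) • J (J.adjoint x)}
  zero_mem' := by simp
  add_mem' := by
    intro x y hx hy
    simp only [mem_ofPred_eq, map_add, smul_add] at *
    rw [← hx, ← hy]
  smul_mem' := by
    intro c x hx
    simp only [mem_ofPred_eq, map_smul] at *
    rw [smul_comm, ← hx]

lemma mem_formEigenspace {J : D →L[ℂ] E} {μ : ℝ} {x : E} :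
    x ∈ formEigenspace J μ ↔ x = ((1 + μ : ℝ) : ℂ) • J (J.adjoint x) := Iff.rfl

/-- The number of eigenvalues below `Λ`, with multiplicity, of the restriction to `M` of the
self-adjoint operator `T` with `(T + 1)⁻¹ = J J†`. -/
def formCount (J : D →L[ℂ] E) (M : Submodule ℂ E) (Λ : ℝ) : ℝ≥0∞ :=
  ∑' μ : Iio Λ, ((edim (formEigenspace J μ ⊓ M : Submodule ℂ E) : ℕ∞) : ℝ≥0∞)

/-- The form `‖u‖²` dominates any multiple of `‖J u‖²` off a finite-dimensional space. -/
def DiscreteForm (J : D →L[ℂ] E) : Prop :=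
  ∀ Λ : ℝ, ∃ F : Submodule ℂ E, FiniteDimensional ℂ F ∧
    ∀ u, J u ∈ Fᗮ → Λ * ‖J u‖ ^ 2 ≤ ‖u‖ ^ 2

/-- `J` is a norm limit of finite-rank maps. If `w` is orthogonal to J†F then `J w` is orthogonal to
`F`, so the level Λ = (n + 1)² gives ‖J w‖ ≤ ‖w‖/(n + 1) there, and composing `J` with the
projection onto J†F changes it by at most 1/(n + 1). -/
lemma DiscreteForm.isCompactOperator {J : D →L[ℂ] E} (h : DiscreteForm J) :
    IsCompactOperator J := by
  choose F hF hJ using h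
  let K : ℕ → Submodule ℂ D := fun n => (F (((n : ℝ) + 1) ^ 2)).map (J.adjoint : E →ₗ[ℂ] D)
  have hK : ∀ n, FiniteDimensional ℂ (K n) := fun n => inferInstance
  refine isCompactOperator_of_tendsto (l := atTop) (F := fun n => J ∘L (K n).starProjection) ?_
    (Eventually.of_forall fun n => ?_)
  · rw [tendsto_iff_norm_sub_tendsto_zero]
    refine squeeze_zero (fun _ => norm_nonneg _) (fun n => ?_)
      (tendsto_one_div_add_atTop_nhds_zero_nat (𝕜 := ℝ))
    refine ContinuousLinearMap.opNorm_le_bound _ (by positivity) fun u => ?_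
    set w := u - (K n).starProjection u with hw
    have hwK : w ∈ (K n)ᗮ := Submodule.sub_starProjection_mem_orthogonal u
    have h1 : J w ∈ (F (((n : ℝ) + 1) ^ 2))ᗮ := by
      rw [Submodule.mem_orthogonal] at hwK ⊢
      intro x hx
      rw [← ContinuousLinearMap.adjoint_inner_left]
      exact hwK _ (Submodule.mem_map_of_mem hx)
    have h2 := hJ _ w h1
    have h3 : ‖w‖ ≤ ‖u‖ := by
      have := Submodule.norm_sq_eq_add_norm_sq_starProjection u (K n)
      rw [Submodule.starProjection_orthogonal_val] at this
      exact le_of_sq_le_sq (by nlinarith [sq_nonneg ‖(K n).starProjection u‖]) (norm_nonneg _)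
    have h4 : (((n : ℝ) + 1) * ‖J w‖) ≤ ‖w‖ :=
      le_of_sq_le_sq (by rw [mul_pow]; exact h2) (norm_nonneg _)
    have h5 : (J ∘L (K n).starProjection - J) u = - J w := by simp [hw]
    rw [h5, norm_neg, one_div, inv_mul_eq_div, le_div_iff₀ (by positivity)]
    linarith
  · have : IsCompactOperator ((K n).orthogonalProjectionOnto) :=
      isCompactOperator_of_locallyCompactSpace_dom _
    exact this.clm_comp (J ∘L (K n).subtypeL)

lemma inner_adjoint_self (J : D →L[ℂ] E) (x y : E) :
    ⟪J (J.adjoint x), y⟫_ℂ = ⟪x, J (J.adjoint y)⟫_ℂ := by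
  rw [← adjoint_inner_right, adjoint_inner_left]

lemma inner_self_eq_ofReal {H : Type*} [NormedAddCommGroup H] [InnerProductSpace ℂ H] (x : H) :
    ⟪x, x⟫_ℂ = ((‖x‖ ^ 2 : ℝ) : ℂ) := by
  rw [inner_self_eq_norm_sq_to_K]
  push_cast; rfl

lemma norm_sq_eq_of_mem_formEigenspace {J : D →L[ℂ] E} {μ : ℝ} {x : E}
    (hx : x ∈ formEigenspace J μ) : ‖x‖ ^ 2 = (1 + μ) * ‖J.adjoint x‖ ^ 2 := by
  have h : (⟪x, x⟫_ℂ) = ((1 + μ : ℝ) : ℂ) * ⟪J.adjoint x, J.adjoint x⟫_ℂ := by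
    conv_lhs => rw [mem_formEigenspace.1 hx]
    rw [inner_smul_left, Complex.conj_ofReal, ← adjoint_inner_right, ← mem_formEigenspace.1 hx]
  rw [inner_self_eq_ofReal, inner_self_eq_ofReal] at h
  exact_mod_cast h

lemma neg_one_lt_of_mem_formEigenspace {J : D →L[ℂ] E} {μ : ℝ} {x : E}
    (hx : x ∈ formEigenspace J μ) (h0 : x ≠ 0) : 0 < 1 + μ := by
  have h1 := norm_sq_eq_of_mem_formEigenspace hx
  have h2 : 0 < ‖x‖ ^ 2 := by positivity
  by_contra h
  nlinarith [sq_nonneg ‖J.adjoint x‖]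

lemma inner_eq_zero_of_mem_formEigenspace {J : D →L[ℂ] E} {μ ν : ℝ} {x y : E}
    (hx : x ∈ formEigenspace J μ) (hy : y ∈ formEigenspace J ν) (h : μ ≠ ν) : ⟪x, y⟫_ℂ = 0 := by
  by_cases hx0 : x = 0
  · simp [hx0]
  by_cases hy0 : y = 0
  · simp [hy0]
  have h1 : (⟪x, y⟫_ℂ) = ((1 + μ : ℝ) : ℂ) * ⟪J (J.adjoint x), y⟫_ℂ := by
    conv_lhs => rw [mem_formEigenspace.1 hx]
    rw [inner_smul_left, Complex.conj_ofReal]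
  have h2 : (⟪x, y⟫_ℂ) = ((1 + ν : ℝ) : ℂ) * ⟪J (J.adjoint x), y⟫_ℂ := by
    conv_lhs => rw [mem_formEigenspace.1 hy]
    rw [inner_smul_right, inner_adjoint_self]
  have h3 : (((μ - ν : ℝ)) : ℂ) * ⟪J (J.adjoint x), y⟫_ℂ = 0 := by
    push_cast at *
    linear_combination h2 - h1
  rcases mul_eq_zero.1 h3 with h4 | h4
  · exact absurd (sub_eq_zero.1 (by exact_mod_cast h4)) h
  · rw [h1, h4, mul_zero]

/-- Two expressions for ‖x‖ are compared: ‖x‖² = (1 + μ)‖J†x‖², while contractivity of `J` gives ‖x‖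
≤ (1 + μ)‖J†x‖. Hence 1 + μ ≤ (1 + μ)² with 1 + μ > 0. -/
lemma nonneg_of_mem_formEigenspace {J : D →L[ℂ] E} (hJ : ∀ u, ‖J u‖ ≤ ‖u‖) {μ : ℝ} {x : E}
    (hx : x ∈ formEigenspace J μ) (h0 : x ≠ 0) : 0 ≤ μ := by
  have h1 := norm_sq_eq_of_mem_formEigenspace hx
  have h2 := neg_one_lt_of_mem_formEigenspace hx h0
  have h3 : ‖x‖ = (1 + μ) * ‖J (J.adjoint x)‖ := by
    conv_lhs => rw [mem_formEigenspace.1 hx]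
    rw [norm_smul, Complex.norm_real, Real.norm_of_nonneg h2.le]
  have h4 := hJ (J.adjoint x)
  have h5 : 0 < ‖x‖ := norm_pos_iff.2 h0
  have h6 : 0 < ‖J.adjoint x‖ := by
    by_contra h
    have : ‖J.adjoint x‖ = 0 := le_antisymm (not_lt.1 h) (norm_nonneg _)
    rw [this] at h1; nlinarith
  by_contra hμ
  push Not at hμ
  have h7 : ‖x‖ ≤ (1 + μ) * ‖J.adjoint x‖ := h3 ▸ mul_le_mul_of_nonneg_left h4 h2.le
  have h8 : ‖x‖ ^ 2 ≤ ((1 + μ) * ‖J.adjoint x‖) ^ 2 := by gcongr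
  have h9 : (1 + μ) ^ 2 < 1 + μ := by nlinarith
  nlinarith [mul_lt_mul_of_pos_right h9 (pow_pos h6 2)]

/-- The form is bounded below by `Λ + 1` on the complement of the eigenspaces below `Λ`. -/
lemma le_norm_sq_of_forall_inner_eq_zero {J : D →L[ℂ] E} (hJ : IsCompactOperator J) {Λ : ℝ}
    {u : D} (hu : ∀ μ < Λ, ∀ x ∈ formEigenspace J μ, ⟪x, J u⟫_ℂ = 0) :
    (Λ + 1) * ‖J u‖ ^ 2 ≤ ‖u‖ ^ 2 := by
  rcases le_or_gt (Λ + 1) 0 with hΛ | hΛ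
  · exact (mul_nonpos_of_nonpos_of_nonneg hΛ (sq_nonneg _)).trans (sq_nonneg _)
  -- The argument runs in the form domain with J†J. An eigenvalue ν > 0 of J†J corresponds to the
  -- eigenvalue ν⁻¹ - 1 of the operator, so `G` below is spanned by the eigenvectors belonging to
  -- eigenvalues less than Λ.
  let R : D →L[ℂ] D := J.adjoint ∘L J
  have hRc : IsCompactOperator R := hJ.clm_comp J.adjoint
  have hRs : (R : D →ₗ[ℂ] D).IsSymmetric := fun x y => by
    change ⟪J.adjoint (J x), y⟫_ℂ = ⟪x, J.adjoint (J y)⟫_ℂ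
    rw [adjoint_inner_left, adjoint_inner_right]
  let G : Submodule ℂ D := ⨆ ν : {ν : ℝ // (Λ + 1)⁻¹ < ν}, Module.End.eigenspace
    (R : D →ₗ[ℂ] D) ((ν : ℝ) : ℂ)
  have hGinv : ∀ v ∈ Gᗮ, R v ∈ Gᗮ := by
    intro v hv
    rw [Submodule.mem_orthogonal] at hv ⊢
    intro w hw
    refine Submodule.iSup_induction _ (motive := fun w => ⟪w, R v⟫_ℂ = 0) hw ?_ (by simp) ?_
    · intro ν x hx
      have h1 : (R : D →ₗ[ℂ] D) x = ((ν : ℝ) : ℂ) • x := Module.End.mem_eigenspace_iff.1 hx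
      have h2 : ⟪x, R v⟫_ℂ = ⟪R x, v⟫_ℂ := (hRs x v).symm
      rw [h2]
      change ⟪(R : D →ₗ[ℂ] D) x, v⟫_ℂ = 0
      rw [h1, inner_smul_left, hv x (Submodule.mem_iSup_of_mem ν hx), mul_zero]
    · intro x y hx hy
      rw [inner_add_left, hx, hy, add_zero]
  let S : Gᗮ →L[ℂ] Gᗮ := R.restrict hGinv
  have hSc : IsCompactOperator S := hRc.restrict' hGinv
  have hSs : (S : Gᗮ →ₗ[ℂ] Gᗮ).IsSymmetric := hRs.restrict_invariant hGinv
  have hev : ∀ ν : ℂ, Module.End.HasEigenvalue (S : Gᗮ →ₗ[ℂ] Gᗮ) ν → ‖ν‖ ≤ (Λ + 1)⁻¹ := by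
    intro ν hν
    obtain ⟨x, hx, hx0⟩ := hν.exists_hasEigenvector
    have hx1 : R x = ν • (x : D) := congrArg Subtype.val (Module.End.mem_eigenspace_iff.1 hx)
    have hreal : ((ν.re : ℝ) : ℂ) = ν :=
      Complex.conj_eq_iff_re.1 (hSs.conj_eigenvalue_eq_self hν)
    have hx0' : (x : D) ≠ 0 := fun h => hx0 (Subtype.ext h)
    have hnn : 0 ≤ ν.re := by
      have h1 : ⟪(x : D), R x⟫_ℂ = ((‖J x‖ ^ 2 : ℝ) : ℂ) := by
        change ⟪(x : D), J.adjoint (J x)⟫_ℂ = _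
        rw [adjoint_inner_right, inner_self_eq_ofReal]
      rw [hx1, inner_smul_right, inner_self_eq_ofReal, ← hreal] at h1
      have h2 : ν.re * ‖(x : D)‖ ^ 2 = ‖J x‖ ^ 2 := by exact_mod_cast h1
      have h3 : 0 < ‖(x : D)‖ ^ 2 := by positivity
      by_contra h
      nlinarith [sq_nonneg ‖J x‖]
    rw [← hreal, Complex.norm_real, Real.norm_of_nonneg hnn]
    by_contra hlt
    push Not at hlt
    have hxG : (x : D) ∈ G := Submodule.mem_iSup_of_mem (⟨ν.re, hlt⟩ : {ν : ℝ // (Λ + 1)⁻¹ < ν})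
      (Module.End.mem_eigenspace_iff.2 (by
        change R x = ((ν.re : ℝ) : ℂ) • (x : D)
        rw [hreal]; exact hx1))
    exact hx0' (inner_self_eq_zero.1 ((Submodule.mem_orthogonal _ _).1 x.2 _ hxG))
  -- For a self-adjoint operator the norm is the spectral radius, and by compactness the nonzero
  -- spectrum of the restriction consists of eigenvalues. None of them exceeds (Λ + 1)⁻¹, as its
  -- eigenvector would lie both in `G` and in its orthogonal complement.
  have hnorm : ‖S‖ ≤ (Λ + 1)⁻¹ := by
    have h1 := S.spectralRadius_eq_nnnorm hSs.isSelfAdjoint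
    have h2 : spectralRadius ℂ S ≤ ENNReal.ofReal (Λ + 1)⁻¹ := by
      refine iSup₂_le fun ν hν => ?_
      refine ENNReal.coe_le_coe.2 ((Real.le_toNNReal_iff_coe_le (by positivity)).2 ?_)
      rw [coe_nnnorm]
      by_cases h0 : ν = 0
      · simp [h0]; positivity
      · exact hev ν ((hSc.hasEigenvalue_iff_mem_spectrum h0).2 hν)
    rw [h1] at h2
    exact (Real.le_toNNReal_iff_coe_le (by positivity)).1 (ENNReal.coe_le_coe.1 h2)
  have huG : u ∈ Gᗮ := by
    rw [Submodule.mem_orthogonal]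
    intro w hw
    refine Submodule.iSup_induction _ (motive := fun w => ⟪w, u⟫_ℂ = 0) hw ?_ (by simp) ?_
    · intro ν x hx
      have hν0 : 0 < (ν : ℝ) := (inv_pos.2 hΛ).trans ν.2
      have h1 : J.adjoint (J x) = ((ν : ℝ) : ℂ) • x := Module.End.mem_eigenspace_iff.1 hx
      have h2 : J x ∈ formEigenspace J ((ν : ℝ)⁻¹ - 1) := by
        rw [mem_formEigenspace, h1, map_smul, smul_smul, add_sub_cancel, ← Complex.ofReal_mul,
          inv_mul_cancel₀ hν0.ne', Complex.ofReal_one, one_smul]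
      have h3 := hu _ (by
        have : (ν : ℝ)⁻¹ < Λ + 1 := inv_lt_of_inv_lt₀ hΛ ν.2
        linarith) _ h2
      rw [← adjoint_inner_left, h1, inner_smul_left] at h3
      rcases mul_eq_zero.1 h3 with h4 | h4
      · rw [Complex.conj_ofReal] at h4
        exact absurd (by exact_mod_cast h4) hν0.ne'
      · exact h4
    · intro x y hx hy
      rw [inner_add_left, hx, hy, add_zero]
  -- Cauchy-Schwarz for ‖J u‖² = ⟨u, J†J u⟩.
  have h1 : ‖J u‖ ^ 2 ≤ ‖S ⟨u, huG⟩‖ * ‖u‖ := by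
    have h2 : ⟪u, R u⟫_ℂ = ((‖J u‖ ^ 2 : ℝ) : ℂ) := by
      change ⟪u, J.adjoint (J u)⟫_ℂ = _
      rw [adjoint_inner_right, inner_self_eq_ofReal]
    have h3 := norm_inner_le_norm (𝕜 := ℂ) u (R u)
    rw [h2, Complex.norm_real, Real.norm_of_nonneg (sq_nonneg _), mul_comm] at h3
    exact h3
  have h2 : ‖S ⟨u, huG⟩‖ ≤ (Λ + 1)⁻¹ * ‖u‖ :=
    (S.le_opNorm _).trans (mul_le_mul_of_nonneg_right hnorm (norm_nonneg _))
  have h3 : ‖J u‖ ^ 2 ≤ (Λ + 1)⁻¹ * ‖u‖ ^ 2 := h1.trans (by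
    nlinarith [mul_le_mul_of_nonneg_right h2 (norm_nonneg u)])
  rw [inv_mul_eq_div, le_div_iff₀ hΛ] at h3
  linarith

end Abstract

/-! ### Variational comparison of eigenvalue counts, and reducing subspaces. -/

section Abstract

universe u v

lemma toENNReal_sum {ι : Type*} (s : Finset ι) (f : ι → ℕ∞) :
    ((∑ i ∈ s, f i : ℕ∞) : ℝ≥0∞) = ∑ i ∈ s, (f i : ℝ≥0∞) := by
  classical
  induction s using Finset.induction_on with
  | empty => simp
  | insert a s ha ih => rw [Finset.sum_insert ha, Finset.sum_insert ha, ENat.toENNReal_add, ih]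

variable {E : Type u} [NormedAddCommGroup E] [InnerProductSpace ℂ E] [CompleteSpace E]
  {D : Type v} [NormedAddCommGroup D] [InnerProductSpace ℂ D] [CompleteSpace D]
  {D' : Type*} [NormedAddCommGroup D'] [InnerProductSpace ℂ D'] [CompleteSpace D']

lemma norm_sum_sq_of_inner_eq_zero {H ι : Type*} [NormedAddCommGroup H] [InnerProductSpace ℂ H]
    (s : Finset ι) (f : ι → H) (h : ∀ i ∈ s, ∀ j ∈ s, i ≠ j → ⟪f i, f j⟫_ℂ = 0) :
    ‖∑ i ∈ s, f i‖ ^ 2 = ∑ i ∈ s, ‖f i‖ ^ 2 := by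
  have h1 : ⟪∑ i ∈ s, f i, ∑ i ∈ s, f i⟫_ℂ = ∑ i ∈ s, ⟪f i, f i⟫_ℂ := by
    rw [sum_inner]
    refine Finset.sum_congr rfl fun i hi => ?_
    rw [inner_sum]
    exact Finset.sum_eq_single_of_mem i hi fun j hj hji => h i hi j hj hji.symm
  simp_rw [inner_self_eq_ofReal] at h1
  exact_mod_cast h1

/-- Glazman's lemma: a linear map whose kernel carries the lower bound `Λ + 1` of the form
bounds the number of eigenvalues below `Λ`. -/
lemma formCount_le_edim {J : D →L[ℂ] E} {M : Submodule ℂ E} {Λ : ℝ} {F : Type u}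
    [AddCommGroup F] [Module ℂ F] (g : E →ₗ[ℂ] F)
    (h : ∀ u, J u ∈ M → g (J u) = 0 → (Λ + 1) * ‖J u‖ ^ 2 ≤ ‖u‖ ^ 2) :
    formCount J M Λ ≤ edim F := by
  rw [formCount, ENNReal.tsum_eq_iSup_sum]
  refine iSup_le fun s => ?_
  rw [← toENNReal_sum]
  refine ENat.toENNReal_le.2 (sum_edim_le s _ g fun f hf h0 => ?_)
  have horth : ∀ i ∈ s, ∀ j ∈ s, i ≠ j → ⟪f i, f j⟫_ℂ = 0 := fun i hi j hj hij =>
    inner_eq_zero_of_mem_formEigenspace (hf i hi).1 (hf j hj).1 fun h => hij (Subtype.ext h)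
  -- The preimages of the eigenvectors in the form domain: J e_i = f_i. They are again orthogonal,
  -- with form norm ‖e_i‖² = (1 + μ_i)‖f_i‖².
  let e : Iio Λ → D := fun i => ((1 + (i : ℝ) : ℝ) : ℂ) • J.adjoint (f i)
  have hJe : ∀ i ∈ s, J (e i) = f i := fun i hi => by
    simp only [e, map_smul]
    exact (mem_formEigenspace.1 (hf i hi).1).symm
  have hJs : J (∑ i ∈ s, e i) = ∑ i ∈ s, f i := by
    rw [map_sum]
    exact Finset.sum_congr rfl hJe
  have heo : ∀ i ∈ s, ∀ j ∈ s, i ≠ j → ⟪e i, e j⟫_ℂ = 0 := fun i hi j hj hij => by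
    simp only [e]
    rw [inner_smul_left, adjoint_inner_left]
    change _ * ⟪f i, J (e j)⟫_ℂ = 0
    rw [hJe j hj, horth i hi j hj hij, mul_zero]
  have hen : ∀ i ∈ s, ‖e i‖ ^ 2 = (1 + (i : ℝ)) * ‖f i‖ ^ 2 := fun i hi => by
    have h1 : ⟪e i, e i⟫_ℂ = ((1 + (i : ℝ) : ℝ) : ℂ) * ⟪f i, f i⟫_ℂ := by
      conv_lhs => simp only [e]
      rw [inner_smul_left, adjoint_inner_left, Complex.conj_ofReal]
      change _ * ⟪f i, J (e i)⟫_ℂ = _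
      rw [hJe i hi]
    rw [inner_self_eq_ofReal, inner_self_eq_ofReal] at h1
    exact_mod_cast h1
  have key := h (∑ i ∈ s, e i) (hJs ▸ M.sum_mem fun i hi => (hf i hi).2) (hJs ▸ h0)
  rw [hJs, norm_sum_sq_of_inner_eq_zero s f horth, norm_sum_sq_of_inner_eq_zero s e heo,
    Finset.sum_congr rfl hen, Finset.mul_sum] at key
  have hle : ∀ i ∈ s, (1 + (i : ℝ)) * ‖f i‖ ^ 2 ≤ (Λ + 1) * ‖f i‖ ^ 2 := fun i _ =>
    mul_le_mul_of_nonneg_right (by linarith [i.2.out]) (sq_nonneg _)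
  -- On the span the form is at most Λ + 1 times the squared norm, and on the kernel of `g` it is at
  -- least that. Equality therefore holds term by term, and the strict inequality μ_i < Λ forces
  -- each f_i to vanish.
  have heq := (Finset.sum_eq_sum_iff_of_le hle).1 (le_antisymm (Finset.sum_le_sum hle) key)
  intro i hi
  have h1 := heq i hi
  have h2 : (i : ℝ) < Λ := i.2.out
  have h3 : ‖f i‖ ^ 2 = 0 := by nlinarith
  exact norm_eq_zero.1 (pow_eq_zero_iff two_ne_zero |>.1 h3)

lemma DiscreteForm.formCount_lt_top {J : D →L[ℂ] E} (hJ : DiscreteForm J) (M : Submodule ℂ E)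
    (Λ : ℝ) : formCount J M Λ < ⊤ := by
  obtain ⟨F, hF, h⟩ := hJ (Λ + 1)
  refine lt_of_le_of_lt (formCount_le_edim (J := J) (M := M) (Λ := Λ) (F := F)
    (F.orthogonalProjectionOnto : E →ₗ[ℂ] F) fun u _ h0 => h u ?_) ?_
  · exact Submodule.orthogonalProjectionOnto_eq_zero_iff.1 h0
  · rw [edim_eq_finrank]
    exact_mod_cast ENat.toENNReal_lt_top.2 (ENat.natCast_lt_top _)

/-- The span of the eigenvectors below `Λ` has dimension at most their number. -/
lemma DiscreteForm.exists_finiteDimensional {J : D →L[ℂ] E} (hJ : DiscreteForm J)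
    (M : Submodule ℂ E) (Λ : ℝ) : ∃ F : Submodule ℂ E, FiniteDimensional ℂ F ∧
      ((edim F : ℕ∞) : ℝ≥0∞) ≤ formCount J M Λ ∧ ∀ μ < Λ, formEigenspace J μ ⊓ M ≤ F := by
  have htop := (hJ.formCount_lt_top M Λ).ne
  -- A nonzero dimension is at least one, so a finite total leaves only finitely many nonzero
  -- eigenspaces.
  have hfin := ENNReal.finite_const_le_of_tsum_ne_top htop one_ne_zero
  let F : Submodule ℂ E := ⨆ μ ∈ hfin.toFinset, formEigenspace J (μ : Iio Λ) ⊓ M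
  have hF : ((edim F : ℕ∞) : ℝ≥0∞) ≤ formCount J M Λ := by
    refine (ENat.toENNReal_le.2 (edim_biSup_le _ _)).trans ?_
    rw [toENNReal_sum]
    exact ENNReal.sum_le_tsum _
  refine ⟨F, finiteDimensional_of_edim_ne_top fun h => ?_, hF, fun μ hμ => ?_⟩
  · rw [h] at hF
    exact htop (top_le_iff.1 hF)
  · by_cases h : (⟨μ, hμ⟩ : Iio Λ) ∈ hfin.toFinset
    · exact le_biSup (fun μ : Iio Λ => formEigenspace J (μ : ℝ) ⊓ M) h
    · rw [Set.Finite.mem_toFinset, mem_ofPred_eq, not_le] at h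
      have h1 : edim (formEigenspace J μ ⊓ M : Submodule ℂ E) = 0 := by
        by_contra h0
        have : (1 : ℕ∞) ≤ edim (formEigenspace J μ ⊓ M : Submodule ℂ E) :=
          Order.one_le_iff_pos.2 (pos_iff_ne_zero.2 h0)
        exact absurd (by simpa using ENat.toENNReal_le.2 this) (not_le.2 h)
      rw [edim_eq_zero_iff, Submodule.subsingleton_iff_eq_bot] at h1
      rw [h1]
      exact bot_le

/-- The subspace `M` reduces the operator `R`. -/
def Reduces (M : Submodule ℂ E) [M.HasOrthogonalProjection] (R : E →L[ℂ] E) : Prop :=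
  ∀ x, R (M.starProjection x) = M.starProjection (R x)

/-- Because J J† is symmetric, invariance of `M` entails invariance of its orthogonal complement. -/
lemma reduces_of_mapsTo {M : Submodule ℂ E} [M.HasOrthogonalProjection] {J : D →L[ℂ] E}
    (h : ∀ x ∈ M, J (J.adjoint x) ∈ M) : Reduces M (J ∘L J.adjoint) := by
  intro x
  refine (Submodule.eq_starProjection_of_mem_orthogonal (h _ (M.starProjection_apply_mem x)) ?_).symm
  change J (J.adjoint x) - J (J.adjoint (M.starProjection x)) ∈ Mᗮ
  rw [← map_sub, ← map_sub, Submodule.mem_orthogonal]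
  intro y hy
  rw [← inner_adjoint_self]
  exact (Submodule.mem_orthogonal _ _).1 (Submodule.sub_starProjection_mem_orthogonal x) _ (h y hy)

lemma Reduces.starProjection_mem {M : Submodule ℂ E} [M.HasOrthogonalProjection]
    {J : D →L[ℂ] E} (h : Reduces M (J ∘L J.adjoint)) {μ : ℝ} {x : E}
    (hx : x ∈ formEigenspace J μ) : M.starProjection x ∈ formEigenspace J μ := by
  have h1 := h x
  simp only [coe_comp, Function.comp_apply] at h1
  rw [mem_formEigenspace, h1, ← map_smul, ← mem_formEigenspace.1 hx]

/-- Comparison of eigenvalue counts through a map of the form domains. -/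
lemma formCount_le_formCount {J : D →L[ℂ] E} {J' : D' →L[ℂ] E} (hJ' : DiscreteForm J')
    {M M' : Submodule ℂ E} [M'.HasOrthogonalProjection]
    (hM' : Reduces M' (J' ∘L J'.adjoint)) (U : E →L[ℂ] E) (hU : ∀ x, ‖U x‖ = ‖x‖)
    (h : ∀ u, J u ∈ M → ∃ v, J' v = U (J u) ∧ U (J u) ∈ M' ∧ ‖v‖ ≤ ‖u‖) (Λ : ℝ) :
    formCount J M Λ ≤ formCount J' M' Λ := by
  -- `F` contains the eigenvectors of the second form in `M'` below Λ. Glazman's lemma is applied to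
  -- the first form with the test map `U` followed by the projection onto `F`.
  obtain ⟨F, hF, hdim, hmem⟩ := hJ'.exists_finiteDimensional M' Λ
  refine le_trans (formCount_le_edim (F := F)
    ((F.orthogonalProjectionOnto : E →ₗ[ℂ] F) ∘ₗ (U : E →ₗ[ℂ] E)) fun u hu h0 => ?_) hdim
  obtain ⟨v, hv, hvM, hvu⟩ := h u hu
  have h0' : U (J u) ∈ Fᗮ := Submodule.orthogonalProjectionOnto_eq_zero_iff.1 h0
  have h1 := le_norm_sq_of_forall_inner_eq_zero hJ'.isCompactOperator (Λ := Λ) (u := v) ?_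
  · rw [hv, hU] at h1
    exact h1.trans (by gcongr)
  -- The eigenvector `x` need not lie in `M'`. As `U (J u)` does, only the projection of `x` to `M'`
  -- matters, and by reduction that projection is an eigenvector in `M'`, hence in `F`.
  · intro μ hμ x hx
    rw [hv, ← Submodule.starProjection_eq_self_iff.2 hvM,
      ← Submodule.inner_starProjection_left_eq_right]
    exact (Submodule.mem_orthogonal _ _).1 h0' _
      (hmem μ hμ ⟨hM'.starProjection_mem hx, Submodule.starProjection_apply_mem _ _⟩)

/-- Orthogonal subspaces contribute independently to the eigenvalue count. -/
lemma tsum_formCount_le {ι : Type*} {J : D →L[ℂ] E} (M : ι → Submodule ℂ E)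
    (hM : ∀ i j, i ≠ j → ∀ x ∈ M i, ∀ y ∈ M j, ⟪x, y⟫_ℂ = 0) (Λ : ℝ) :
    ∑' i, formCount J (M i) Λ ≤ formCount J ⊤ Λ := by
  unfold formCount
  rw [ENNReal.tsum_comm]
  refine ENNReal.tsum_le_tsum fun μ => ?_
  rw [ENNReal.tsum_eq_iSup_sum, inf_top_eq]
  refine iSup_le fun s => ?_
  rw [← toENNReal_sum]
  refine ENat.toENNReal_le.2 ?_
  set V := formEigenspace J (μ : ℝ)
  have hsub : ∀ i, edim (V ⊓ M i : Submodule ℂ E) ≤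
      edim ((V ⊓ M i).comap V.subtype : Submodule ℂ V) := fun i =>
    edim_le_of_injective
      ((Submodule.inclusion (inf_le_left : V ⊓ M i ≤ V)).codRestrict _ fun x => ⟨x.2.1, x.2.2⟩) fun x y hxy => by
          have := congrArg (fun z => ((z : V) : E)) (congrArg Subtype.val hxy)
          exact Subtype.ext this
  refine (Finset.sum_le_sum fun i _ => hsub i).trans
    (sum_edim_le s _ LinearMap.id fun f hf h0 i hi => ?_)
  have h1 : ⟪f i, ∑ j ∈ s, f j⟫_ℂ = ⟪f i, f i⟫_ℂ := by
    rw [inner_sum]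
    exact Finset.sum_eq_single_of_mem i hi fun j hj hji =>
      hM i j hji.symm _ (hf i hi).2 _ (hf j hj).2
  rw [LinearMap.id_apply] at h0
  rw [h0, inner_zero_right] at h1
  exact inner_self_eq_zero.1 h1.symm

/-- A total orthogonal family of reducing subspaces exhausts the eigenvalue count. -/
lemma formCount_top_le_tsum {ι : Type*} {J : D →L[ℂ] E} (M : ι → Submodule ℂ E)
    [∀ i, (M i).HasOrthogonalProjection]
    (hM : ∀ i j, i ≠ j → ∀ x ∈ M i, ∀ y ∈ M j, ⟪x, y⟫_ℂ = 0)
    (htot : ∀ x, (∀ i, ∀ y ∈ M i, ⟪y, x⟫_ℂ = 0) → x = 0)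
    (hred : ∀ i, Reduces (M i) (J ∘L J.adjoint)) (Λ : ℝ) :
    formCount J ⊤ Λ ≤ ∑' i, formCount J (M i) Λ := by
  unfold formCount
  rw [ENNReal.tsum_comm]
  refine ENNReal.tsum_le_tsum fun μ => ?_
  rw [inf_top_eq]
  set V := formEigenspace J (μ : ℝ)
  by_cases htop : ∑' i, ((edim (V ⊓ M i : Submodule ℂ E) : ℕ∞) : ℝ≥0∞) = ⊤
  · rw [htop]; exact le_top
  have hfin := ENNReal.finite_const_le_of_tsum_ne_top htop one_ne_zero
  -- Each projection of an eigenvector to some `M i` is again an eigenvector, so only finitely many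
  -- are nonzero. Their sum recovers `x`, because the difference is orthogonal to every `M i`.
  have hV : V ≤ ⨆ i ∈ hfin.toFinset, V ⊓ M i := by
    intro x hx
    have h1 : x = ∑ i ∈ hfin.toFinset, (M i).starProjection x := by
      rw [← sub_eq_zero]
      refine htot _ fun i y hy => ?_
      rw [inner_sub_right, inner_sum]
      have h2 : ⟪y, x⟫_ℂ = ⟪y, (M i).starProjection x⟫_ℂ := by
        rw [← Submodule.inner_starProjection_left_eq_right,
          Submodule.starProjection_eq_self_iff.2 hy]
      by_cases hi : i ∈ hfin.toFinset
      · rw [Finset.sum_eq_single_of_mem i hi fun j _ hji => hM i j hji.symm _ hy _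
          ((M j).starProjection_apply_mem x), h2, sub_self]
      · have h3 : edim (V ⊓ M i : Submodule ℂ E) = 0 := by
          rw [Set.Finite.mem_toFinset, mem_ofPred_eq, not_le] at hi
          by_contra h0
          have : (1 : ℕ∞) ≤ edim (V ⊓ M i : Submodule ℂ E) :=
            Order.one_le_iff_pos.2 (pos_iff_ne_zero.2 h0)
          exact absurd (by simpa using ENat.toENNReal_le.2 this) (not_le.2 hi)
        rw [edim_eq_zero_iff, Submodule.subsingleton_iff_eq_bot] at h3
        have h4 : (M i).starProjection x ∈ V ⊓ M i :=
          ⟨(hred i).starProjection_mem hx, Submodule.starProjection_apply_mem _ _⟩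
        rw [h3, Submodule.mem_bot] at h4
        rw [h2, h4, inner_zero_right, Finset.sum_eq_zero, sub_zero]
        intro j hj
        have : i ≠ j := fun h => hi (h ▸ hj)
        exact hM i j this _ hy _ ((M j).starProjection_apply_mem x)
    rw [h1]
    exact Submodule.sum_mem _ fun i hi =>
      (le_biSup (fun i => V ⊓ M i) hi) ⟨(hred i).starProjection_mem hx, Submodule.starProjection_apply_mem _ _⟩
  refine (ENat.toENNReal_le.2 ((edim_mono hV).trans (edim_biSup_le _ _))).trans ?_
  rw [toENNReal_sum]
  exact ENNReal.sum_le_tsum _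

/-- A form with nonzero embedding and discrete spectrum has an eigenvalue. -/
lemma DiscreteForm.exists_eigenvector {J : D →L[ℂ] E} (hJ : DiscreteForm J) (h0 : J ≠ 0) :
    ∃ μ : ℝ, ∃ x ∈ formEigenspace J μ, x ≠ 0 := by
  by_contra! h
  refine h0 (ContinuousLinearMap.ext fun u => ?_)
  by_contra hu
  have hpos : 0 < ‖J u‖ ^ 2 := pow_pos (norm_pos_iff.2 hu) 2
  -- Without eigenvectors the lower bound holds at every level. This choice of Λ makes it read ‖u‖²
  -- + ‖J u‖² ≤ ‖u‖².
  have h1 := le_norm_sq_of_forall_inner_eq_zero hJ.isCompactOperator (Λ := ‖u‖ ^ 2 / ‖J u‖ ^ 2)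
    (u := u) fun μ _ x hx => by rw [h μ x hx, inner_zero_left]
  rw [add_mul, div_mul_cancel₀ _ hpos.ne'] at h1
  linarith

/-- Outside its eigenvalues an operator with compact resolvent has bounded inverses. -/
lemma exists_resolvent {J : D →L[ℂ] E} (hJ : IsCompactOperator J) {x : ℝ}
    (hx : formEigenspace J x = ⊥) :
    ∃ R : E →L[ℂ] E, ∀ u f : E, u = J (J.adjoint ((f + (x : ℂ) • u) + u)) ↔ R f = u := by
  set R₀ : E →L[ℂ] E := J ∘L J.adjoint with hR₀
  have hR₀c : IsCompactOperator R₀ := hJ.comp_clm J.adjoint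
  have hadd : ∀ u f : E, J (J.adjoint ((f + (x : ℂ) • u) + u)) =
      R₀ f + ((1 + x : ℝ) : ℂ) • R₀ u := fun u f => by
    have : f + (x : ℂ) • u + u = f + ((1 + x : ℝ) : ℂ) • u := by
      push_cast; module
    rw [this, map_add, map_add, map_smul, map_smul]
    rfl
  -- At x = -1 the resolvent is J J† itself.
  by_cases h0 : 1 + x = 0
  · refine ⟨R₀, fun u f => ?_⟩
    rw [hadd, h0, Complex.ofReal_zero, zero_smul, add_zero]
    exact eq_comm
  have h0' : ((1 + x : ℝ) : ℂ) ≠ 0 := Complex.ofReal_ne_zero.2 h0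
  -- The equation u = R₀ f + (1 + x) R₀ u is equivalent to (w - R₀) u = w R₀ f. By compactness, w
  -- could lie in the spectrum of R₀ only as an eigenvalue, and that would make `x` an eigenvalue of
  -- the operator.
  set w : ℂ := ((1 + x : ℝ) : ℂ)⁻¹ with hw
  have hw0 : w ≠ 0 := inv_ne_zero h0'
  have hns : w ∉ spectrum ℂ R₀ := fun hs => by
    obtain ⟨y, hy, hy0⟩ := ((hR₀c.hasEigenvalue_iff_mem_spectrum hw0).2 hs).exists_hasEigenvector
    have h1 : J (J.adjoint y) = w • y := Module.End.mem_eigenspace_iff.1 hy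
    have h2 : y ∈ formEigenspace J x := by
      rw [mem_formEigenspace, h1, smul_smul, hw, mul_inv_cancel₀ h0', one_smul]
    rw [hx] at h2
    exact hy0 h2
  obtain ⟨S, hS⟩ := spectrum.notMem_iff.1 hns
  refine ⟨w • ((S⁻¹ : (E →L[ℂ] E)ˣ) : E →L[ℂ] E) ∘L R₀, fun u f => ?_⟩
  have hSa : ∀ y, (S : E →L[ℂ] E) y = w • y - R₀ y := fun y => by
    rw [hS, _root_.sub_apply, Algebra.algebraMap_eq_smul_one]
    rfl
  have hl : ∀ y, ((S⁻¹ : (E →L[ℂ] E)ˣ) : E →L[ℂ] E) ((S : E →L[ℂ] E) y) = y := fun y => by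
    change (((S⁻¹ : (E →L[ℂ] E)ˣ) : E →L[ℂ] E) * (S : E →L[ℂ] E)) y = y
    rw [Units.inv_mul]; rfl
  have hr : ∀ y, (S : E →L[ℂ] E) (((S⁻¹ : (E →L[ℂ] E)ˣ) : E →L[ℂ] E) y) = y := fun y => by
    change ((S : E →L[ℂ] E) * ((S⁻¹ : (E →L[ℂ] E)ˣ) : E →L[ℂ] E)) y = y
    rw [Units.mul_inv]; rfl
  rw [hadd]
  change _ ↔ w • ((S⁻¹ : (E →L[ℂ] E)ˣ) : E →L[ℂ] E) (R₀ f) = u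
  constructor
  · intro h
    have h1 : w • R₀ f = (S : E →L[ℂ] E) u := by
      rw [hSa]
      conv_rhs => rw [h]
      rw [smul_add, smul_smul, hw, inv_mul_cancel₀ h0', one_smul, ← h]
      abel
    rw [← map_smul, h1, hl]
  · intro h
    have h1 : (S : E →L[ℂ] E) u = w • R₀ f := by
      rw [← h, map_smul, hr]
    rw [hSa] at h1
    have h2 : ((1 + x : ℝ) : ℂ) • (w • u - R₀ u) = R₀ f := by
      rw [h1, smul_smul, hw, mul_inv_cancel₀ h0', one_smul]
    rw [← h2, smul_sub, smul_smul, hw, mul_inv_cancel₀ h0', one_smul]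
    abel

end Abstract

/-! ### Rounding of angular momenta and the constant of the theorem. -/

/-- Rounding up multiples of `x` costs at most the supremum of the fractional parts. -/
lemma add_one_le_mul_add_iSup_fract {x : ℝ} {K M : ℕ} (h : (M : ℝ) < K * x) :
    (M : ℝ) + 1 ≤ K * x + ⨆ n : ℕ, Int.fract ((n : ℝ) * x) := by
  have hbdd : BddAbove (range fun n : ℕ => Int.fract ((n : ℝ) * x)) :=
    ⟨1, by rintro _ ⟨n, rfl⟩; exact (Int.fract_lt_one _).le⟩
  have hs0 : 0 ≤ ⨆ n : ℕ, Int.fract ((n : ℝ) * x) :=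
    (Int.fract_nonneg _).trans (le_ciSup hbdd 0)
  rcases le_or_gt ((M : ℝ) + 1) (K * x) with h1 | h1
  · linarith
  have hK : 0 < K := by
    rcases Nat.eq_zero_or_pos K with h0 | h0
    · subst h0
      have : (0 : ℝ) ≤ M := Nat.cast_nonneg M
      simp at h; linarith
    · exact h0
  have hKR : (0 : ℝ) < K := Nat.cast_pos.2 hK
  -- The gap from K x up to the next integer; it lies strictly between 0 and 1.
  set d : ℝ := M + 1 - K * x with hd
  suffices d ≤ ⨆ n : ℕ, Int.fract ((n : ℝ) * x) by linarith
  refine le_of_forall_pos_sub_le fun ε hε => ?_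
  set η : ℝ := min ε (min d (1 - d)) with hη
  have hη0 : 0 < η := lt_min hε (lt_min (by linarith) (by linarith))
  obtain ⟨N, hN⟩ := exists_nat_gt (K / η)
  have hN0 : 0 < N := by
    have : (0 : ℝ) < N := lt_trans (by positivity) hN
    exact_mod_cast this
  -- Dirichlet's theorem gives q ≥ 1 with q x within 1/(N + 1) of an integer. Modulo 1, K(q - 1)x is
  -- then -K x up to the small error K δ, so its fractional part is d + K δ, which is within ε of d.
  obtain ⟨q, hq, -, hqr⟩ := Real.exists_nat_abs_mul_sub_round_le x hN0
  set δ : ℝ := q * x - round (q * x) with hδ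
  have hKδ : |K * δ| < η := by
    rw [abs_mul, abs_of_pos hKR]
    have h2 : K * |δ| ≤ K * (1 / (N + 1)) := by gcongr
    have h3 : K * (1 / ((N : ℝ) + 1)) < η := by
      rw [mul_one_div, div_lt_iff₀ (by positivity)]
      rw [div_lt_iff₀ hη0] at hN
      nlinarith
    linarith
  have hlow := (abs_lt.1 hKδ).1
  have hup := (abs_lt.1 hKδ).2
  have e1 : η ≤ ε := min_le_left _ _
  have e2 : η ≤ d := (min_le_right _ _).trans (min_le_left _ _)
  have e3 : η ≤ 1 - d := (min_le_right _ _).trans (min_le_right _ _)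
  have hfr : Int.fract (((K * (q - 1) : ℕ) : ℝ) * x) = d + K * δ := by
    rw [Int.fract_eq_iff]
    refine ⟨by linarith, by linarith, K * round (q * x) - (M + 1), ?_⟩
    rw [Nat.cast_mul, Nat.cast_sub hq, hd, hδ]
    push_cast
    ring
  have := le_ciSup hbdd (K * (q - 1))
  simp only [hfr] at this
  linarith

/-- The real number `1 / c + sup_n {n / c}`. -/
def roundingConstant (c : ℝ) : ℝ := 1 / c + ⨆ n : ℕ, Int.fract ((n : ℝ) / c)

/-- For the largest such `M` the left side counts the integers m ≥ 0 with c m < K. The supremum,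
which enters only once in the preceding bound, may be multiplied by K because K ≥ 1. -/
lemma add_one_le_roundingConstant_mul {c : ℝ} (hc : 0 < c) {M K : ℕ} (h : c * M < K) :
    (M : ℝ) + 1 ≤ roundingConstant c * K := by
  have h1 : (M : ℝ) < K * (1 / c) := by
    rw [mul_one_div, lt_div_iff₀ hc, mul_comm]; exact h
  have h2 := add_one_le_mul_add_iSup_fract h1
  have hK : (1 : ℝ) ≤ K := by
    have : (0 : ℝ) < K := lt_of_le_of_lt (by positivity) h
    exact_mod_cast this
  have hbdd : BddAbove (range fun n : ℕ => Int.fract ((n : ℝ) / c)) :=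
    ⟨1, by rintro _ ⟨n, rfl⟩; exact (Int.fract_lt_one _).le⟩
  have hs0 : 0 ≤ ⨆ n : ℕ, Int.fract ((n : ℝ) / c) :=
    (Int.fract_nonneg _).trans (le_ciSup hbdd 0)
  simp only [mul_one_div] at h2
  rw [roundingConstant, add_mul, one_div_mul_eq_div]
  nlinarith

lemma one_le_roundingConstant {c : ℝ} (hc : 0 < c) : 1 ≤ roundingConstant c := by
  have := add_one_le_roundingConstant_mul hc (M := 0) (K := 1) (by simp)
  simpa using this

/-- Summation by parts, carried out as an induction on `M`. Momenta beyond their allowance of C per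
level are charged to earlier, larger values of `n`. -/
lemma sum_comp_floor_le {c : ℝ} (hc : 0 < c) (hc1 : c ≤ 1) {n : ℕ → ℝ} (hn : Antitone n)
    (hn0 : ∀ k, 0 ≤ n k) (M : ℕ) : ∑ m ∈ Finset.range M, n ⌊c * m⌋₊ ≤
      roundingConstant c * ∑ k ∈ Finset.range (⌊c * M⌋₊ + 1), n k := by
  have hlt : ∀ M : ℕ, c * M < (⌊c * (M : ℝ)⌋₊ + 1 : ℕ) := fun M => by
    push_cast; exact Nat.lt_floor_add_one _
  have hkey : ∀ M : ℕ, (M : ℝ) + 1 ≤ roundingConstant c * (⌊c * (M : ℝ)⌋₊ + 1 : ℕ) := fun M =>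
    add_one_le_roundingConstant_mul hc (hlt M)
  -- Every completed level is paid with weight C, and the current level carries the balance M -
  -- C⌊cM⌋. As c ≤ 1, the level rises by at most one per step. When it rises, the new balance is
  -- nonpositive, so replacing `n` by its smaller next value is harmless.
  have main : ∀ M : ℕ, ∑ m ∈ Finset.range M, n ⌊c * m⌋₊ ≤
      roundingConstant c * ∑ k ∈ Finset.range ⌊c * M⌋₊, n k +
        (M - roundingConstant c * ⌊c * (M : ℝ)⌋₊) * n ⌊c * M⌋₊ := by
    intro M
    induction M with
    | zero => simp
    | succ M ih =>
      rw [Finset.sum_range_succ]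
      have h1 : ⌊c * (M : ℝ)⌋₊ ≤ ⌊c * ((M + 1 : ℕ) : ℝ)⌋₊ :=
        Nat.floor_mono (by push_cast; nlinarith)
      have h2 : ⌊c * ((M + 1 : ℕ) : ℝ)⌋₊ ≤ ⌊c * (M : ℝ)⌋₊ + 1 := by
        refine Nat.lt_add_one_iff.1 ((Nat.floor_lt (by positivity)).2 ?_)
        have := hlt M
        push_cast at this ⊢
        nlinarith
      have h3 := hkey M
      rcases (Nat.le_iff_lt_or_eq.1 h1) with h | h
      · have h4 : ⌊c * ((M + 1 : ℕ) : ℝ)⌋₊ = ⌊c * (M : ℝ)⌋₊ + 1 := by omega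
        rw [h4, Finset.sum_range_succ]
        push_cast at h3 ⊢
        have h5 : n (⌊c * (M : ℝ)⌋₊ + 1) ≤ n ⌊c * (M : ℝ)⌋₊ := hn (Nat.le_succ _)
        nlinarith [mul_nonneg (sub_nonneg.2 h3) (sub_nonneg.2 h5)]
      · rw [← h]
        push_cast
        linarith
  have h1 := main M
  have h2 := hkey M
  rw [Finset.sum_range_succ, mul_add]
  push_cast at h2
  nlinarith [mul_nonneg (sub_nonneg.2 h2) (hn0 ⌊c * M⌋₊), hn0 ⌊c * M⌋₊]

lemma tsum_comp_floor_le {c : ℝ} (hc : 0 < c) (hc1 : c ≤ 1) {n : ℕ → ℝ≥0∞} (hn : Antitone n)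
    (hfin : ∀ k, n k ≠ ⊤) : ∑' m : ℕ, n ⌊c * m⌋₊ ≤
      ENNReal.ofReal (roundingConstant c) * ∑' k, n k := by
  rw [ENNReal.tsum_eq_iSup_nat]
  refine iSup_le fun M => ?_
  have hC : 0 ≤ roundingConstant c := zero_le_one.trans (one_le_roundingConstant hc)
  have h := sum_comp_floor_le hc hc1 (n := fun k => (n k).toReal)
    (fun i j hij => ENNReal.toReal_mono (hfin _) (hn hij)) (fun _ => ENNReal.toReal_nonneg) M
  have h' := ENNReal.ofReal_le_ofReal h
  rw [ENNReal.ofReal_mul hC, ENNReal.ofReal_sum_of_nonneg fun _ _ => ENNReal.toReal_nonneg,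
    ENNReal.ofReal_sum_of_nonneg fun _ _ => ENNReal.toReal_nonneg] at h'
  simp_rw [ENNReal.ofReal_toReal (hfin _)] at h'
  exact h'.trans (mul_le_mul_right (ENNReal.sum_le_tsum _) _)

/-- The counting bound for angular momenta: positive momenta `m` are lowered to `⌊c m⌋`. -/
lemma tsum_int_le {c : ℝ} (hc : 0 < c) (hc1 : c ≤ 1) {n : ℕ → ℝ≥0∞} (hn : Antitone n)
    (hfin : ∀ k, n k ≠ ⊤) :
    ∑' m : ℤ, n (if 0 ≤ m then ⌊c * (m.toNat : ℝ)⌋₊ else m.natAbs) ≤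
      ENNReal.ofReal (roundingConstant c) * ∑' k : ℤ, n k.natAbs := by
  have hC : 1 ≤ ENNReal.ofReal (roundingConstant c) := by
    rw [← ENNReal.ofReal_one]; exact ENNReal.ofReal_le_ofReal (one_le_roundingConstant hc)
  -- Negative momenta are not lowered, so on that half the two sums agree termwise and C ≥ 1
  -- suffices.
  rw [tsum_of_nat_of_neg_add_one ENNReal.summable ENNReal.summable,
    tsum_of_nat_of_neg_add_one (f := fun k : ℤ => n k.natAbs) ENNReal.summable ENNReal.summable,
    mul_add]
  refine add_le_add ?_ ?_
  · simpa using tsum_comp_floor_le hc hc1 hn hfin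
  · refine le_trans (le_of_eq (tsum_congr fun m => ?_)) (le_mul_of_one_le_left' hC)
    rw [if_neg (by omega)]

/-! ### From counting functions to Riesz means. -/

/-- Riesz means of two weights on the line compare if all their counting functions do. -/
lemma tsum_mul_rpow_le {a b : ℝ → ℝ≥0∞} {C : ℝ≥0∞} (hC : C ≠ ⊤) {Λ σ : ℝ} (hσ : 0 ≤ σ)
    (ha : {μ | μ < Λ ∧ a μ ≠ 0}.Finite) (hb : {μ | μ < Λ ∧ b μ ≠ 0}.Finite)
    (h : ∀ Λ' ≤ Λ, ∑' μ : Iio Λ', a μ ≤ C * ∑' μ : Iio Λ', b μ) :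
    ∑' μ : Iio Λ, a μ * ENNReal.ofReal ((Λ - μ) ^ σ) ≤
      C * ∑' μ : Iio Λ, b μ * ENNReal.ofReal ((Λ - μ) ^ σ) := by
  rcases hσ.eq_or_lt with h0 | hσ
  · subst h0
    simpa using h Λ le_rfl
  -- Layer cake: (Λ - μ)^σ is the length of the set of t > 0 with t^{1/σ} < Λ - μ. The Riesz mean is
  -- therefore the integral over t of the counting function at Λ - t^{1/σ}. This needs σ > 0, the
  -- case σ = 0 being the counting function itself.
  have key : ∀ f : ℝ → ℝ≥0∞, {μ | μ < Λ ∧ f μ ≠ 0}.Finite →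
      ∑' μ : Iio Λ, f μ * ENNReal.ofReal ((Λ - μ) ^ σ) =
        ∫⁻ t in Ioi (0 : ℝ), ∑' μ : Iio (Λ - t ^ σ⁻¹), f μ := by
    intro f hf
    have hs : ∀ (g : ℝ → ℝ≥0∞) (Λ' : ℝ), Λ' ≤ Λ → (∀ μ, f μ = 0 → g μ = 0) →
        ∑' μ : Iio Λ', g μ = ∑ μ ∈ hf.toFinset, (Iio Λ').indicator g μ := by
      intro g Λ' hΛ' hg
      rw [tsum_subtype]
      refine tsum_eq_sum fun μ hμ => ?_
      by_cases h1 : μ < Λ'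
      · rw [indicator_of_mem (show μ ∈ Iio Λ' from h1)]
        refine hg μ ?_
        by_contra h2
        exact hμ (hf.mem_toFinset.2 ⟨h1.trans_le hΛ', h2⟩)
      · exact indicator_of_notMem (show μ ∉ Iio Λ' from h1) _
    rw [hs (fun μ => f μ * ENNReal.ofReal ((Λ - μ) ^ σ)) Λ le_rfl fun μ h0 => by simp [h0]]
    have h1 : ∫⁻ t in Ioi (0 : ℝ), ∑' μ : Iio (Λ - t ^ σ⁻¹), f μ =
        ∫⁻ t in Ioi (0 : ℝ), ∑ μ ∈ hf.toFinset,
          (Ioo 0 ((Λ - μ) ^ σ)).indicator (fun _ => f μ) t := by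
      refine setLIntegral_congr_fun measurableSet_Ioi fun t ht => ?_
      have ht0 : (0 : ℝ) < t := ht
      rw [hs f _ (by linarith [Real.rpow_nonneg ht0.le σ⁻¹]) fun _ h => h]
      refine Finset.sum_congr rfl fun μ hμ => ?_
      have hμΛ : μ < Λ := (hf.mem_toFinset.1 hμ).1
      have : μ ∈ Iio (Λ - t ^ σ⁻¹) ↔ t ∈ Ioo 0 ((Λ - μ) ^ σ) := by
        rw [mem_Iio, mem_Ioo, and_iff_right ht0, lt_sub_comm,
          Real.rpow_inv_lt_iff_of_pos ht0.le (by linarith) hσ]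
      by_cases hh : μ ∈ Iio (Λ - t ^ σ⁻¹)
      · rw [indicator_of_mem hh, indicator_of_mem (this.1 hh)]
      · rw [indicator_of_notMem hh, indicator_of_notMem fun h' => hh (this.2 h')]
    rw [h1, lintegral_finsetSum' _ fun μ _ =>
      (measurable_const.indicator measurableSet_Ioo).aemeasurable]
    refine Finset.sum_congr rfl fun μ hμ => ?_
    have hμΛ : μ < Λ := (hf.mem_toFinset.1 hμ).1
    rw [indicator_of_mem (show μ ∈ Iio Λ from hμΛ), lintegral_indicator measurableSet_Ioo,
      setLIntegral_const, Measure.restrict_apply measurableSet_Ioo,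
      inter_eq_left.2 Ioo_subset_Ioi_self, Real.volume_Ioo, sub_zero]
  rw [key a ha, key b hb, ← lintegral_const_mul' _ _ hC]
  refine setLIntegral_mono_ae' measurableSet_Ioi (ae_of_all _ fun t ht => ?_)
  exact h _ (by linarith [Real.rpow_nonneg (le_of_lt (show (0 : ℝ) < t from ht)) σ⁻¹])

/-! ### Operators given by graphs: multiplicities, Riesz traces and spectra. -/

section Graph

variable {Ω : Set Plane} {D : Type*} [NormedAddCommGroup D] [InnerProductSpace ℂ D]
  [CompleteSpace D]

/-- `T` is the graph of the operator with `(T + 1)⁻¹ = J J†`. -/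
def IsFormGraph (J : D →L[ℂ] L2 Ω) (T : Submodule ℂ (L2 Ω × L2 Ω)) : Prop :=
  ∀ x f, (x, f) ∈ T ↔ x = J (J.adjoint (f + x))

variable {J : D →L[ℂ] L2 Ω} {T : Submodule ℂ (L2 Ω × L2 Ω)}

lemma IsFormGraph.eigenspace_eq (hT : IsFormGraph J T) (μ : ℝ) :
    eigenspace T μ = formEigenspace J μ := by
  ext x
  have h : (μ : ℂ) • x + x = ((1 + μ : ℝ) : ℂ) • x := by push_cast; module
  change (x, (μ : ℂ) • x) ∈ T ↔ _
  rw [hT, mem_formEigenspace, h, map_smul, map_smul]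

lemma IsFormGraph.multiplicity_eq (hT : IsFormGraph J T) (μ : ℝ) :
    multiplicity T μ = edim (formEigenspace J μ) := by
  rw [multiplicity, hT.eigenspace_eq, edim]

lemma IsFormGraph.tsum_multiplicity (hT : IsFormGraph J T) (Λ : ℝ) :
    ∑' μ : Iio Λ, ((multiplicity T μ : ℕ∞) : ℝ≥0∞) = formCount J ⊤ Λ := by
  refine tsum_congr fun μ => ?_
  rw [hT.multiplicity_eq, inf_top_eq]

lemma IsFormGraph.finite_multiplicity_ne_zero (hT : IsFormGraph J T) (hJ : DiscreteForm J)
    (Λ : ℝ) : {μ | μ < Λ ∧ ((multiplicity T μ : ℕ∞) : ℝ≥0∞) ≠ 0}.Finite := by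
  have h1 := hT.tsum_multiplicity Λ ▸ (hJ.formCount_lt_top ⊤ Λ).ne
  refine ((ENNReal.finite_const_le_of_tsum_ne_top h1 one_ne_zero).image Subtype.val).subset ?_
  rintro μ ⟨hμ, h0⟩
  refine ⟨⟨μ, hμ⟩, ?_, rfl⟩
  have : (1 : ℕ∞) ≤ multiplicity T μ :=
    Order.one_le_iff_pos.2 (pos_iff_ne_zero.2 fun h => h0 (by rw [h]; simp))
  simpa using ENat.toENNReal_le.2 this

lemma IsFormGraph.multiplicity_eq_zero (hT : IsFormGraph J T) (hJ : ∀ u, ‖J u‖ ≤ ‖u‖) {μ : ℝ}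
    (hμ : μ < 0) : multiplicity T μ = 0 := by
  rw [hT.multiplicity_eq, edim_eq_zero_iff, Submodule.subsingleton_iff_eq_bot, eq_bot_iff]
  intro x hx
  by_contra h0
  exact absurd (nonneg_of_mem_formEigenspace hJ hx h0) (not_le.2 hμ)

lemma IsFormGraph.rieszTrace_lt_top (hT : IsFormGraph J T) (hJd : DiscreteForm J)
    (hJ : ∀ u, ‖J u‖ ≤ ‖u‖) (Λ : ℝ) {σ : ℝ} (hσ : 0 ≤ σ) : rieszTrace T Λ σ < ⊤ := by
  -- All eigenvalues are nonnegative, so every weight that occurs is at most Λ^σ.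
  have h1 : rieszTrace T Λ σ ≤ formCount J ⊤ Λ * ENNReal.ofReal (Λ ^ σ) := by
    rw [← hT.tsum_multiplicity, ← ENNReal.tsum_mul_right]
    refine ENNReal.tsum_le_tsum fun μ => ?_
    rcases lt_or_ge (μ : ℝ) 0 with h | h
    · rw [hT.multiplicity_eq_zero hJ h]
      simp
    · gcongr
      · linarith [μ.2.out]
      · linarith
  exact h1.trans_lt (ENNReal.mul_lt_top (hJd.formCount_lt_top _ _) ENNReal.ofReal_lt_top)

/-- Off the eigenvalues a bounded inverse exists by compactness. Conversely, an eigenvector solves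
the resolvent equation with f = 0, which a linear inverse answers by zero. -/
lemma IsFormGraph.mem_realSpectrum_iff (hT : IsFormGraph J T) (hJ : DiscreteForm J) {x : ℝ} :
    x ∈ realSpectrum T ↔ formEigenspace J x ≠ ⊥ := by
  constructor
  · intro hx h
    obtain ⟨R, hR⟩ := exists_resolvent hJ.isCompactOperator h
    exact hx ⟨R, fun u f => (hT _ _).trans (hR u f)⟩
  · rintro h ⟨R, hR⟩
    refine h (eq_bot_iff.2 fun u hu => ?_)
    rw [← hT.eigenspace_eq] at hu
    have h1 := (hR u 0).1 (by rw [zero_add]; exact hu)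
    rw [map_zero] at h1
    exact h1.symm

lemma IsFormGraph.isGLB_realSpectrum (hT : IsFormGraph J T) (hJd : DiscreteForm J)
    (hJ : ∀ u, ‖J u‖ ≤ ‖u‖) (h0 : J ≠ 0) : IsGLB (realSpectrum T) (sInf (realSpectrum T)) := by
  refine isGLB_csInf ?_ ⟨0, fun x hx => ?_⟩
  · obtain ⟨μ, x, hx, hx0⟩ := hJd.exists_eigenvector h0
    exact ⟨μ, (hT.mem_realSpectrum_iff hJd).2 ((Submodule.ne_bot_iff _).2 ⟨x, hx, hx0⟩)⟩
  · obtain ⟨y, hy, hy0⟩ := (Submodule.ne_bot_iff _).1 ((hT.mem_realSpectrum_iff hJd).1 hx)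
    exact nonneg_of_mem_formEigenspace hJ hy hy0

lemma IsFormGraph.formCount_ne_zero_iff (hT : IsFormGraph J T) (hJ : DiscreteForm J) {Λ : ℝ} :
    formCount J ⊤ Λ ≠ 0 ↔ ∃ x ∈ realSpectrum T, x < Λ := by
  rw [formCount, Ne, ENNReal.tsum_eq_zero, not_forall]
  simp only [inf_top_eq, ENat.toENNReal_eq_zero, edim_eq_zero_iff,
    Submodule.subsingleton_iff_eq_bot, hT.mem_realSpectrum_iff hJ]
  constructor
  · rintro ⟨⟨μ, hμ⟩, h⟩
    exact ⟨μ, h, hμ⟩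
  · rintro ⟨μ, h, hμ⟩
    exact ⟨⟨μ, hμ⟩, h⟩

/-- A comparison of eigenvalue counts implies the comparison of Riesz means and of the bottoms
of the spectra. -/
theorem rieszTrace_le_of_formCount_le {D' : Type*} [NormedAddCommGroup D']
    [InnerProductSpace ℂ D'] [CompleteSpace D'] {J' : D' →L[ℂ] L2 Ω}
    {T' : Submodule ℂ (L2 Ω × L2 Ω)} (hT : IsFormGraph J T) (hT' : IsFormGraph J' T')
    (hJd : DiscreteForm J) (hJd' : DiscreteForm J') (hJ : ∀ u, ‖J u‖ ≤ ‖u‖)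
    (hJ' : ∀ u, ‖J' u‖ ≤ ‖u‖) (h0 : J ≠ 0) (h0' : J' ≠ 0) {C : ℝ}
    (h : ∀ Λ, formCount J' ⊤ Λ ≤ ENNReal.ofReal C * formCount J ⊤ Λ) :
    (∀ Λ σ : ℝ, 0 ≤ Λ → 0 ≤ σ → rieszTrace T Λ σ < ⊤ ∧
      rieszTrace T' Λ σ ≤ ENNReal.ofReal C * rieszTrace T Λ σ) ∧
    IsGLB (realSpectrum T) (sInf (realSpectrum T)) ∧
    IsGLB (realSpectrum T') (sInf (realSpectrum T')) ∧
    sInf (realSpectrum T) ≤ sInf (realSpectrum T') := by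
  have hG := hT.isGLB_realSpectrum hJd hJ h0
  have hG' := hT'.isGLB_realSpectrum hJd' hJ' h0'
  refine ⟨fun Λ σ _ hσ => ⟨hT.rieszTrace_lt_top hJd hJ Λ hσ, ?_⟩, hG, hG', ?_⟩
  · refine tsum_mul_rpow_le (a := fun μ => ((multiplicity T' μ : ℕ∞) : ℝ≥0∞))
      (b := fun μ => ((multiplicity T μ : ℕ∞) : ℝ≥0∞)) ENNReal.ofReal_ne_top hσ
      (hT'.finite_multiplicity_ne_zero hJd' Λ) (hT.finite_multiplicity_ne_zero hJd Λ)
      fun Λ' _ => ?_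
    rw [hT.tsum_multiplicity, hT'.tsum_multiplicity]
    exact h Λ'
  -- A spectral point x of the second operator makes its count below x + ε nonzero. The count of the
  -- first operator is then nonzero too, which produces a spectral point of the first below x + ε.
  · refine hG'.2 fun x hx => le_of_forall_pos_lt_add fun ε hε => ?_
    have h1 : formCount J' ⊤ (x + ε) ≠ 0 :=
      (hT'.formCount_ne_zero_iff hJd').2 ⟨x, hx, by linarith⟩
    have h2 : formCount J ⊤ (x + ε) ≠ 0 := fun h2 => h1 (by
      have := h (x + ε)
      rw [h2, mul_zero] at this
      exact le_antisymm this (zero_le))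
    obtain ⟨y, hy, hyx⟩ := (hT.formCount_ne_zero_iff hJd).1 h2
    exact (hG.1 hy).trans_lt hyx

end Graph

/-! ### The form domains of (i∇ + A)² + v² as closed subspaces of a Hilbert space. -/

section FormSpace

variable {Ω : Set Plane}

/-- Multiplication by an essentially bounded function. -/
def mulL2 {f : Plane → ℂ} (hf : MemLp f ∞ (volume.restrict Ω)) : L2 Ω →L[ℂ] L2 Ω :=
  (ContinuousLinearMap.mul ℂ ℂ).holderL (volume.restrict Ω) ∞ 2 2 hf.toLp

lemma coeFn_mulL2 {f : Plane → ℂ} (hf : MemLp f ∞ (volume.restrict Ω)) (u : L2 Ω) :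
    mulL2 hf u =ᵐ[volume.restrict Ω] fun x => f x * u x := by
  filter_upwards [(ContinuousLinearMap.mul ℂ ℂ).coeFn_holder (r := 2) hf.toLp u,
    hf.coeFn_toLp] with x h1 h2
  rw [← h2]
  exact h1

lemma eq_mulL2_iff {f : Plane → ℂ} (hf : MemLp f ∞ (volume.restrict Ω)) (u v : L2 Ω) :
    v = mulL2 hf u ↔ v =ᵐ[volume.restrict Ω] fun x => f x * u x :=
  ⟨fun h => h ▸ coeFn_mulL2 hf u, fun h => Lp.ext (h.trans (coeFn_mulL2 hf u).symm)⟩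

/-- The components of a vector field are essentially bounded on `Ω`. -/
def BoundedField (Ω : Set Plane) (A : Plane → Plane) : Prop :=
  ∀ j, MemLp (fun x => (A x j : ℂ)) ∞ (volume.restrict Ω)

lemma boundedField_zero : BoundedField Ω 0 := fun j => by
  simp

/-- The gradient recovered from the magnetic gradient. -/
def unmagnetic {A : Plane → Plane} (hA : BoundedField Ω A) :
    (L2 Ω × (Fin 2 → L2 Ω)) →L[ℂ] (L2 Ω × (Fin 2 → L2 Ω)) :=
  (ContinuousLinearMap.fst ℂ _ _).prod (ContinuousLinearMap.pi fun j =>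
    (-Complex.I) • ((ContinuousLinearMap.proj (R := ℂ) (φ := fun _ : Fin 2 => L2 Ω) j) ∘L
      (ContinuousLinearMap.snd ℂ (L2 Ω) (Fin 2 → L2 Ω)) -
      (mulL2 (hA j)) ∘L (ContinuousLinearMap.fst ℂ (L2 Ω) (Fin 2 → L2 Ω))))

lemma mem_magneticGraph_iff {A : Plane → Plane} (hA : BoundedField Ω A)
    {u : L2 Ω} {w : Fin 2 → L2 Ω} : (u, w) ∈ magneticGraph Ω A ↔
      ∃ g : Fin 2 → L2 Ω, (u, g) ∈ sobolevGraph Ω ∧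
        ∀ j, w j = Complex.I • g j + mulL2 (hA j) u := by
  refine exists_congr fun g => and_congr_right fun _ => forall_congr' fun j => ?_
  have h1 : (⇑(Complex.I • g j + mulL2 (hA j) u : L2 Ω)) =ᵐ[volume.restrict Ω]
      fun x => Complex.I * g j x + (A x j : ℂ) * u x := by
    filter_upwards [Lp.coeFn_add (Complex.I • g j) (mulL2 (hA j) u), Lp.coeFn_smul Complex.I (g j),
      coeFn_mulL2 (hA j) u] with x e1 e2 e3
    rw [e1, Pi.add_apply, e2, e3, Pi.smul_apply, smul_eq_mul]
  exact ⟨fun h => Lp.ext (h.trans h1.symm), fun h => by simp only [h]; exact h1⟩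

/-- This transfers closedness: g = -i(w - A u) depends continuously on (u, w) when A is bounded, so
the magnetic graph inherits closedness from the Sobolev graph. -/
lemma magneticGraph_eq_comap {A : Plane → Plane} (hA : BoundedField Ω A) :
    magneticGraph Ω A = (sobolevGraph Ω).comap
      (unmagnetic hA : (L2 Ω × (Fin 2 → L2 Ω)) →ₗ[ℂ] (L2 Ω × (Fin 2 → L2 Ω))) := by
  ext ⟨u, w⟩
  rw [mem_magneticGraph_iff hA, Submodule.mem_comap]
  have hI : (-Complex.I) * Complex.I = 1 := by simp
  have hI' : Complex.I * (-Complex.I) = 1 := by simp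
  constructor
  · rintro ⟨g, hg, h⟩
    have : unmagnetic hA (u, w) = (u, g) := by
      refine Prod.ext rfl (funext fun j => ?_)
      change (-Complex.I) • (w j - mulL2 (hA j) u) = g j
      rw [h j, add_sub_cancel_right, smul_smul, hI, one_smul]
    exact this ▸ hg
  · intro h
    refine ⟨_, h, fun j => ?_⟩
    change w j = Complex.I • ((-Complex.I) • (w j - mulL2 (hA j) u)) + mulL2 (hA j) u
    rw [smul_smul, hI', one_smul, sub_add_cancel]

lemma isClosed_magneticGraph {A : Plane → Plane} (hA : BoundedField Ω A) :
    IsClosed (magneticGraph Ω A : Set (L2 Ω × (Fin 2 → L2 Ω))) := by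
  rw [magneticGraph_eq_comap hA]
  exact (Submodule.isClosed_topologicalClosure _).preimage (unmagnetic hA).continuous

/-- The ambient Hilbert space for the quadruples `(u, (i∇ + A)u, √V u)`. -/
abbrev FormAmbient (Ω : Set Plane) : Type := PiLp 2 fun _ : Fin 4 => L2 Ω

/-- Forgetting the last component. -/
def forgetPotential (Ω : Set Plane) : FormAmbient Ω →L[ℂ] (L2 Ω × (Fin 2 → L2 Ω)) :=
  (PiLp.proj 2 (fun _ : Fin 4 => L2 Ω) 0).prod
    (ContinuousLinearMap.pi fun j => PiLp.proj 2 (fun _ : Fin 4 => L2 Ω) (![1, 2] j))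

/-- The form domain `{(u, (i∇ + A)u, v u) : u ∈ H¹₀(Ω)}` of `(i∇ + A)² + v²`. -/
def formSpace {A : Plane → Plane} {v : Plane → ℂ} (_ : BoundedField Ω A)
    (hv : MemLp v ∞ (volume.restrict Ω)) : Submodule ℂ (FormAmbient Ω) :=
  (magneticGraph Ω A).comap (forgetPotential Ω : FormAmbient Ω →ₗ[ℂ] (L2 Ω × (Fin 2 → L2 Ω))) ⊓
    LinearMap.ker ((PiLp.proj 2 (fun _ : Fin 4 => L2 Ω) 3 - mulL2 hv ∘L
      PiLp.proj 2 (fun _ : Fin 4 => L2 Ω) 0 : FormAmbient Ω →L[ℂ] L2 Ω) :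
        FormAmbient Ω →ₗ[ℂ] L2 Ω)

variable {A : Plane → Plane} {v : Plane → ℂ} (hA : BoundedField Ω A)
  (hv : MemLp v ∞ (volume.restrict Ω))

lemma mem_formSpace_iff {q : FormAmbient Ω} : q ∈ formSpace hA hv ↔
    (q 0, fun j => q (![1, 2] j)) ∈ magneticGraph Ω A ∧ q 3 = mulL2 hv (q 0) := by
  rw [formSpace, Submodule.mem_inf, LinearMap.mem_ker]
  refine and_congr Iff.rfl ?_
  change q 3 - mulL2 hv (q 0) = 0 ↔ _
  exact sub_eq_zero

lemma isClosed_formSpace : IsClosed (formSpace hA hv : Set (FormAmbient Ω)) := by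
  refine IsClosed.inter ?_ ?_
  · exact (isClosed_magneticGraph hA).preimage (forgetPotential Ω).continuous
  · exact ContinuousLinearMap.isClosed_ker _

instance : CompleteSpace (formSpace hA hv) :=
  (isClosed_formSpace hA hv).completeSpace_coe

/-- The embedding of the form domain. -/
def formEmbedding : formSpace hA hv →L[ℂ] L2 Ω :=
  PiLp.proj 2 (fun _ : Fin 4 => L2 Ω) 0 ∘L (formSpace hA hv).subtypeL

lemma formEmbedding_apply (q : formSpace hA hv) : formEmbedding hA hv q = (q : FormAmbient Ω) 0 :=
  rfl

lemma norm_sq_formAmbient (q : FormAmbient Ω) :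
    ‖q‖ ^ 2 = ‖q 0‖ ^ 2 + (∑ j, ‖q (![1, 2] j)‖ ^ 2) + ‖q 3‖ ^ 2 := by
  rw [PiLp.norm_sq_eq_of_L2, Fin.sum_univ_four, Fin.sum_univ_two]
  simp only [Matrix.cons_val_zero, Matrix.cons_val_one]
  ring

lemma inner_formAmbient (q q' : FormAmbient Ω) : ⟪q, q'⟫_ℂ =
    ⟪q 0, q' 0⟫_ℂ + (∑ j, ⟪q (![1, 2] j), q' (![1, 2] j)⟫_ℂ) + ⟪q 3, q' 3⟫_ℂ := by
  rw [PiLp.inner_apply, Fin.sum_univ_four, Fin.sum_univ_two]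
  simp only [Matrix.cons_val_zero, Matrix.cons_val_one]
  ring

lemma norm_formEmbedding_le (q : formSpace hA hv) : ‖formEmbedding hA hv q‖ ≤ ‖q‖ := by
  refine le_of_sq_le_sq ?_ (norm_nonneg _)
  have h := norm_sq_formAmbient (q : FormAmbient Ω)
  rw [formEmbedding_apply, Submodule.norm_coe] at *
  rw [h]
  have := Finset.sum_nonneg fun j (_ : j ∈ Finset.univ) => sq_nonneg ‖(q : FormAmbient Ω) (![1, 2] j)‖
  nlinarith [sq_nonneg ‖(q : FormAmbient Ω) 3‖]

/-- The element of the form domain with given magnetic gradient. -/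
def formElement {u : L2 Ω} {w : Fin 2 → L2 Ω} (h : (u, w) ∈ magneticGraph Ω A) :
    formSpace hA hv :=
  ⟨WithLp.toLp 2 ![u, w 0, w 1, mulL2 hv u], (mem_formSpace_iff hA hv).2 ⟨by
    have : (fun j : Fin 2 => ![u, w 0, w 1, mulL2 hv u] (![1, 2] j)) = w := by
      funext j
      fin_cases j <;> rfl
    exact this.symm ▸ h, rfl⟩⟩

lemma formEmbedding_formElement {u : L2 Ω} {w : Fin 2 → L2 Ω} (h : (u, w) ∈ magneticGraph Ω A) :
    formEmbedding hA hv (formElement hA hv h) = u := rfl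

lemma norm_sq_formElement {u : L2 Ω} {w : Fin 2 → L2 Ω} (h : (u, w) ∈ magneticGraph Ω A) :
    ‖formElement hA hv h‖ ^ 2 = ‖u‖ ^ 2 + (∑ j, ‖w j‖ ^ 2) + ‖mulL2 hv u‖ ^ 2 := by
  rw [← Submodule.norm_coe, norm_sq_formAmbient, Fin.sum_univ_two, Fin.sum_univ_two]
  rfl

lemma inner_formElement {u : L2 Ω} {w : Fin 2 → L2 Ω} (h : (u, w) ∈ magneticGraph Ω A)
    (q : formSpace hA hv) : ⟪formElement hA hv h, q⟫_ℂ = ⟪u, (q : FormAmbient Ω) 0⟫_ℂ +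
      (∑ j, ⟪w j, (q : FormAmbient Ω) (![1, 2] j)⟫_ℂ) +
        ⟪mulL2 hv u, mulL2 hv ((q : FormAmbient Ω) 0)⟫_ℂ := by
  rw [Submodule.coe_inner, inner_formAmbient, Fin.sum_univ_two, Fin.sum_univ_two,
    ((mem_formSpace_iff hA hv).1 q.2).2]
  rfl

lemma eq_formElement (q : formSpace hA hv) :
    q = formElement hA hv ((mem_formSpace_iff hA hv).1 q.2).1 := by
  refine Subtype.ext (PiLp.ext fun i => ?_)
  fin_cases i
  · rfl
  · rfl
  · rfl
  · exact ((mem_formSpace_iff hA hv).1 q.2).2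

/-- The graph of `(i∇ + A)² + V` in terms of the embedding of its form domain. -/
lemma isFormGraph_dirichletOperator {V : Plane → ℝ} (hV : ∀ x ∈ Ω, v x = (Real.sqrt (V x) : ℂ))
    (hΩ : MeasurableSet Ω) (hV0 : ∀ x ∈ Ω, 0 ≤ V x) :
    IsFormGraph (formEmbedding hA hv) (dirichletOperator Ω A V) := by
  have hmul : ∀ x y : L2 Ω, ∀ z : L2 Ω,
      (z : Plane → ℂ) =ᵐ[volume.restrict Ω] (fun s => (V s : ℂ) * x s) →
      ⟪mulL2 hv y, mulL2 hv x⟫_ℂ = ⟪y, z⟫_ℂ := by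
    intro x y z hz
    rw [L2.inner_def, L2.inner_def]
    refine integral_congr_ae ?_
    filter_upwards [coeFn_mulL2 hv x, coeFn_mulL2 hv y, hz, ae_restrict_mem hΩ] with s h1 h2 h3 h4
    have h5 : (Real.sqrt (V s) : ℂ) * Real.sqrt (V s) = V s := by
      rw [← Complex.ofReal_mul, Real.mul_self_sqrt (hV0 s h4)]
    rw [h1, h2, h3, hV s h4]
    simp only [RCLike.inner_apply, map_mul, Complex.conj_ofReal]
    rw [← h5]
    ring
  intro x f
  constructor
  · rintro ⟨w, z, hw, hz, h⟩
    -- The weak equation says that the form element of `x` represents the functional of f + x on the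
    -- form domain. The summand `x` accounts for the term ‖u‖² contained in the form norm.
    have h1 : formElement hA hv hw = (formEmbedding hA hv).adjoint (f + x) := by
      refine ext_inner_left ℂ fun q => ?_
      have h2 := h _ ((mem_formSpace_iff hA hv).1 q.2).1
      have h3 := hmul x ((q : FormAmbient Ω) 0) z hz
      rw [adjoint_inner_right, formEmbedding_apply, inner_add_right, ← h2, ← h3]
      conv_lhs => rw [eq_formElement hA hv q]
      rw [inner_formElement]
      change ⟪_, x⟫_ℂ + (∑ j, ⟪_, ![x, w 0, w 1, mulL2 hv x] (![1, 2] j)⟫_ℂ) +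
        ⟪_, mulL2 hv x⟫_ℂ = _
      have : ∀ j : Fin 2, ![x, w 0, w 1, mulL2 hv x] (![1, 2] j) = w j := by
        intro j; fin_cases j <;> rfl
      simp only [this]
      ring
    rw [← h1]
    rfl
  · intro h
    set q := (formEmbedding hA hv).adjoint (f + x) with hq
    have hx : x = (q : FormAmbient Ω) 0 := h
    obtain ⟨hq1, hq2⟩ := (mem_formSpace_iff hA hv).1 q.2
    -- The last component of `q` is √V x, so one more multiplication by √V gives V x.
    have hz : ⇑(mulL2 hv ((q : FormAmbient Ω) 3)) =ᵐ[volume.restrict Ω]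
        fun s => (V s : ℂ) * x s := by
      rw [hq2]
      filter_upwards [coeFn_mulL2 hv (mulL2 hv ((q : FormAmbient Ω) 0)),
        coeFn_mulL2 hv ((q : FormAmbient Ω) 0), ae_restrict_mem hΩ] with s h1 h2 h4
      have h5 : (Real.sqrt (V s) : ℂ) * Real.sqrt (V s) = V s := by
        rw [← Complex.ofReal_mul, Real.mul_self_sqrt (hV0 s h4)]
      rw [h1, h2, hV s h4, ← mul_assoc, h5, hx]
    refine ⟨fun j => (q : FormAmbient Ω) (![1, 2] j), mulL2 hv ((q : FormAmbient Ω) 3), ?_, hz, ?_⟩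
    · rw [hx]; exact hq1
    · rintro ⟨y, w⟩ hyw
      have h1 : ⟪formElement hA hv hyw, q⟫_ℂ = ⟪y, f + x⟫_ℂ := by
        rw [hq, adjoint_inner_right, formEmbedding_formElement]
      rw [inner_formElement, inner_add_right, ← hx, hmul x y _ hz] at h1
      linear_combination h1

/-- A compactness estimate on the form domain from one on the Sobolev space. -/
lemma discreteForm_formEmbedding
    (hR : ∀ ε > 0, ∃ F : Submodule ℂ (L2 Ω), FiniteDimensional ℂ F ∧
      ∀ u : L2 Ω, ∀ g : Fin 2 → L2 Ω, (u, g) ∈ sobolevGraph Ω → u ∈ Fᗮ →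
        ‖u‖ ^ 2 ≤ ε * ∑ j, ‖g j‖ ^ 2) : DiscreteForm (formEmbedding hA hv) := by
  intro Λ
  -- From i g_j = w_j - A_j u one gets ‖g_j‖² ≤ 2‖w_j‖² + 2‖A_j‖²‖u‖², hence Σ‖g_j‖² ≤ C‖q‖². The
  -- Rellich parameter 1/(C(|Λ| + 1)) then yields (|Λ| + 1)‖u‖² ≤ ‖q‖².
  set C : ℝ := 2 + 2 * ∑ j, ‖mulL2 (hA j)‖ ^ 2 with hC
  have hC0 : 0 < C := by positivity
  obtain ⟨F, hF, h⟩ := hR (1 / (C * (|Λ| + 1))) (by positivity)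
  refine ⟨F, hF, fun q hq => ?_⟩
  obtain ⟨g, hg, hw⟩ := (mem_magneticGraph_iff hA).1 ((mem_formSpace_iff hA hv).1 q.2).1
  rw [formEmbedding_apply] at *
  have h1 := h _ _ hg hq
  have h2 : ∀ j, ‖g j‖ ^ 2 ≤ 2 * ‖(q : FormAmbient Ω) (![1, 2] j)‖ ^ 2 +
      2 * (‖mulL2 (hA j)‖ ^ 2 * ‖(q : FormAmbient Ω) 0‖ ^ 2) := by
    intro j
    have e1 : Complex.I • g j =
        (q : FormAmbient Ω) (![1, 2] j) - mulL2 (hA j) ((q : FormAmbient Ω) 0) := by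
      rw [hw j]; abel
    have e2 : ‖g j‖ = ‖Complex.I • g j‖ := by rw [norm_smul, Complex.norm_I, one_mul]
    have e3 : ‖g j‖ ≤ ‖(q : FormAmbient Ω) (![1, 2] j)‖ +
        ‖mulL2 (hA j)‖ * ‖(q : FormAmbient Ω) 0‖ := by
      rw [e2, e1]
      exact (norm_sub_le _ _).trans (add_le_add le_rfl (ContinuousLinearMap.le_opNorm _ _))
    rw [← mul_pow]
    nlinarith [norm_nonneg (g j), sq_nonneg (‖(q : FormAmbient Ω) (![1, 2] j)‖ -
      ‖mulL2 (hA j)‖ * ‖(q : FormAmbient Ω) 0‖)]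
  have h3 : ∑ j, ‖g j‖ ^ 2 ≤ C * ‖q‖ ^ 2 := by
    have e1 := Finset.sum_le_sum fun j (_ : j ∈ Finset.univ) => h2 j
    rw [Finset.sum_add_distrib, ← Finset.mul_sum, ← Finset.mul_sum, ← Finset.sum_mul] at e1
    have e2 := norm_sq_formAmbient (q : FormAmbient Ω)
    rw [Submodule.norm_coe] at e2
    have e3 : 0 ≤ ∑ j, ‖mulL2 (hA j)‖ ^ 2 := by positivity
    have e4 : 0 ≤ ∑ j, ‖(q : FormAmbient Ω) (![1, 2] j)‖ ^ 2 := by positivity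
    rw [e2, hC]
    nlinarith [sq_nonneg ‖(q : FormAmbient Ω) 3‖, sq_nonneg ‖(q : FormAmbient Ω) 0‖,
      mul_nonneg e3 e4, mul_nonneg e3 (sq_nonneg ‖(q : FormAmbient Ω) 3‖)]
  have h4 : ‖(q : FormAmbient Ω) 0‖ ^ 2 ≤ ‖q‖ ^ 2 / (|Λ| + 1) := by
    refine h1.trans ((mul_le_mul_of_nonneg_left h3 (by positivity)).trans (le_of_eq ?_))
    field_simp
  rw [le_div_iff₀ (by positivity)] at h4
  nlinarith [le_abs_self Λ, sq_nonneg ‖(q : FormAmbient Ω) 0‖,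
    mul_le_mul_of_nonneg_right (le_abs_self Λ) (sq_nonneg ‖(q : FormAmbient Ω) 0‖)]

lemma formEmbedding_ne_zero {u : L2 Ω} {g : Fin 2 → L2 Ω} (h : (u, g) ∈ sobolevGraph Ω)
    (hu : u ≠ 0) : formEmbedding hA hv ≠ 0 := by
  intro h0
  have h1 : (u, fun j => Complex.I • g j + mulL2 (hA j) u) ∈ magneticGraph Ω A :=
    (mem_magneticGraph_iff hA).2 ⟨g, h, fun _ => rfl⟩
  refine hu ?_
  rw [← formEmbedding_formElement hA hv h1, h0]
  rfl

end FormSpace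

/-! ### A quantitative Rellich theorem by averaging over a grid. -/

section Compactness

lemma enorm_sq_eq_lintegral {Ω : Set Plane} (u : L2 Ω) :
    ‖u‖ₑ ^ 2 = ∫⁻ x in Ω, ‖u x‖ₑ ^ 2 := by
  rw [Lp.enorm_def, eLpNorm_eq_lintegral_rpow_enorm_toReal two_ne_zero ENNReal.ofNat_ne_top]
  simp only [ENNReal.toReal_ofNat, ENNReal.rpow_ofNat, one_div]
  rw [← ENNReal.rpow_natCast, ← ENNReal.rpow_mul]
  norm_num

lemma lintegral_sq_le {α : Type*} [MeasurableSpace α] (μ : Measure α) {f : α → ℝ≥0∞}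
    (hf : AEMeasurable f μ) : (∫⁻ x, f x ∂μ) ^ 2 ≤ μ univ * ∫⁻ x, f x ^ 2 ∂μ := by
  have h := ENNReal.lintegral_mul_le_Lp_mul_Lq μ Real.HolderConjugate.two_two
    (aemeasurable_const (b := (1 : ℝ≥0∞))) hf
  simp only [Pi.mul_apply, one_mul, lintegral_const, ENNReal.rpow_ofNat] at h
  rw [one_pow, one_mul] at h
  calc (∫⁻ x, f x ∂μ) ^ 2 ≤ ((μ univ) ^ (1 / 2 : ℝ) * (∫⁻ x, f x ^ 2 ∂μ) ^ (1 / 2 : ℝ)) ^ 2 := by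
        gcongr
    _ = μ univ * ∫⁻ x, f x ^ 2 ∂μ := by
        rw [mul_pow]
        congr 1
        all_goals
          rw [← ENNReal.rpow_natCast, ← ENNReal.rpow_mul]
          norm_num

lemma enorm_fderiv_sq_le {φ : Plane → ℂ} (x h : Plane) :
    ‖fderiv ℝ φ x h‖ₑ ^ 2 ≤ ‖h‖ₑ ^ 2 * ∑ j, ‖fderiv ℝ φ x (basisVec j)‖ₑ ^ 2 := by
  have e1 : h = h 0 • basisVec 0 + h 1 • basisVec 1 := by
    ext i; fin_cases i <;> simp [basisVec]
  have e2 : ‖fderiv ℝ φ x h‖ ^ 2 ≤ ‖h‖ ^ 2 * ∑ j, ‖fderiv ℝ φ x (basisVec j)‖ ^ 2 := by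
    rw [EuclideanSpace.norm_sq_eq, Fin.sum_univ_two, Fin.sum_univ_two]
    conv_lhs => rw [e1]
    rw [map_add, map_smul, map_smul]
    have e3 := norm_add_le (h 0 • fderiv ℝ φ x (basisVec 0)) (h 1 • fderiv ℝ φ x (basisVec 1))
    rw [norm_smul, norm_smul] at e3
    set a := ‖fderiv ℝ φ x (basisVec 0)‖
    set b := ‖fderiv ℝ φ x (basisVec 1)‖
    have e4 := pow_le_pow_left₀ (norm_nonneg _) e3 2
    nlinarith [sq_nonneg (‖h 0‖ * b - ‖h 1‖ * a)]
  have e5 := ENNReal.ofReal_le_ofReal e2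
  rw [ENNReal.ofReal_mul (by positivity), ENNReal.ofReal_sum_of_nonneg fun _ _ => by positivity,
    ENNReal.ofReal_pow (norm_nonneg _), ENNReal.ofReal_pow (norm_nonneg _)] at e5
  simpa only [ENNReal.ofReal_pow (norm_nonneg _), ofReal_norm] using e5

/-- The difference is the integral of the derivative along the segment from x to x + h.
Cauchy-Schwarz in the segment parameter, Tonelli and translation invariance finish the estimate. -/
lemma lintegral_translate_sub_sq_le {φ : Plane → ℂ} (hφ : ContDiff ℝ 1 φ) (h : Plane) :
    ∫⁻ x, ‖φ (x + h) - φ x‖ₑ ^ 2 ≤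
      ‖h‖ₑ ^ 2 * ∫⁻ x, ∑ j, ‖fderiv ℝ φ x (basisVec j)‖ₑ ^ 2 := by
  have hc : Continuous (fderiv ℝ φ) := hφ.continuous_fderiv one_ne_zero
  have hG : Continuous fun x => ∑ j, ‖fderiv ℝ φ x (basisVec j)‖ₑ ^ 2 := by
    refine continuous_finsetSum _ fun j _ => ?_
    exact (ENNReal.continuous_pow 2).comp ((hc.clm_apply continuous_const).enorm)
  have hpt : ∀ x, ‖φ (x + h) - φ x‖ₑ ^ 2 ≤
      ∫⁻ t in Icc (0 : ℝ) 1, ‖h‖ₑ ^ 2 *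
        ∑ j, ‖fderiv ℝ φ (x + t • h) (basisVec j)‖ₑ ^ 2 := by
    intro x
    have hd : ∀ t : ℝ, HasDerivAt (fun t : ℝ => φ (x + t • h)) (fderiv ℝ φ (x + t • h) h) t := by
      intro t
      have h1 : HasFDerivAt φ (fderiv ℝ φ (x + t • h)) (x + t • h) :=
        (hφ.differentiable one_ne_zero _).hasFDerivAt
      have h2 : HasDerivAt (fun t : ℝ => x + t • h) h t := by
        simpa using ((hasDerivAt_id t).smul_const h).const_add x
      exact h1.comp_hasDerivAt t h2
    have hcont : Continuous fun t : ℝ => fderiv ℝ φ (x + t • h) h :=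
      (hc.comp (by fun_prop)).clm_apply continuous_const
    have h3 : φ (x + h) - φ x = ∫ t in (0 : ℝ)..1, fderiv ℝ φ (x + t • h) h := by
      rw [intervalIntegral.integral_eq_sub_of_hasDerivAt (fun t _ => hd t)
        (hcont.intervalIntegrable _ _)]
      simp
    rw [h3, intervalIntegral.integral_of_le zero_le_one, ← integral_Icc_eq_integral_Ioc]
    calc ‖∫ t in Icc (0 : ℝ) 1, fderiv ℝ φ (x + t • h) h‖ₑ ^ 2
        ≤ (∫⁻ t in Icc (0 : ℝ) 1, ‖fderiv ℝ φ (x + t • h) h‖ₑ) ^ 2 := by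
          gcongr; exact enorm_integral_le_lintegral_enorm _
      _ ≤ (volume.restrict (Icc (0 : ℝ) 1)) univ *
          ∫⁻ t in Icc (0 : ℝ) 1, ‖fderiv ℝ φ (x + t • h) h‖ₑ ^ 2 :=
          lintegral_sq_le _ hcont.enorm.measurable.aemeasurable
      _ ≤ _ := by
          rw [Measure.restrict_apply_univ, Real.volume_Icc, sub_zero, ENNReal.ofReal_one, one_mul]
          exact lintegral_mono fun t => enorm_fderiv_sq_le _ _
  calc ∫⁻ x, ‖φ (x + h) - φ x‖ₑ ^ 2
      ≤ ∫⁻ x, ∫⁻ t in Icc (0 : ℝ) 1, ‖h‖ₑ ^ 2 *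
        ∑ j, ‖fderiv ℝ φ (x + t • h) (basisVec j)‖ₑ ^ 2 := lintegral_mono hpt
    _ = ∫⁻ t in Icc (0 : ℝ) 1, ∫⁻ x, ‖h‖ₑ ^ 2 *
        ∑ j, ‖fderiv ℝ φ (x + t • h) (basisVec j)‖ₑ ^ 2 := by
        refine lintegral_lintegral_swap ?_
        refine Measurable.aemeasurable ?_
        refine Measurable.const_mul ?_ _
        exact (hG.comp (f := fun p : Plane × ℝ => p.1 + p.2 • h) (by fun_prop)).measurable
    _ = ∫⁻ t in Icc (0 : ℝ) 1, ‖h‖ₑ ^ 2 * ∫⁻ x, ∑ j, ‖fderiv ℝ φ x (basisVec j)‖ₑ ^ 2 := by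
        refine lintegral_congr fun t => ?_
        have hm : Continuous fun x => ∑ j, ‖fderiv ℝ φ (x + t • h) (basisVec j)‖ₑ ^ 2 :=
          hG.comp (f := fun x : Plane => x + t • h) (by fun_prop)
        rw [lintegral_const_mul _ hm.measurable,
          lintegral_add_right_eq_self (fun x => ∑ j, ‖fderiv ℝ φ x (basisVec j)‖ₑ ^ 2) (t • h)]
    _ = _ := by
        rw [lintegral_const, Measure.restrict_apply_univ, Real.volume_Icc, sub_zero,
          ENNReal.ofReal_one, mul_one]

/-- The grid cell of side `ε` with index `n`. -/
def gridCell (ε : ℝ) (n : Fin 2 → ℤ) : Set Plane := {x | ∀ j, ⌊x j / ε⌋ = n j}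

lemma gridCell_eq_preimage {ε : ℝ} (hε : 0 < ε) (n : Fin 2 → ℤ) :
    gridCell ε n = (MeasurableEquiv.toLp 2 (Fin 2 → ℝ)).symm ⁻¹'
      (univ.pi fun j => Ico (ε * n j) (ε * (n j + 1))) := by
  ext x
  simp only [gridCell, mem_ofPred_eq, mem_preimage, mem_univ_pi, mem_Ico]
  refine forall_congr' fun j => ?_
  rw [Int.floor_eq_iff, le_div_iff₀ hε, div_lt_iff₀ hε, mul_comm, mul_comm ((n j : ℝ) + 1)]
  rfl

lemma measurableSet_gridCell {ε : ℝ} (hε : 0 < ε) (n : Fin 2 → ℤ) :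
    MeasurableSet (gridCell ε n) := by
  rw [gridCell_eq_preimage hε]
  exact (MeasurableEquiv.measurable _) (MeasurableSet.univ_pi fun _ => measurableSet_Ico)

lemma volume_gridCell {ε : ℝ} (hε : 0 < ε) (n : Fin 2 → ℤ) :
    volume (gridCell ε n) = ENNReal.ofReal ε ^ 2 := by
  rw [gridCell_eq_preimage hε, (EuclideanSpace.volume_preserving_symm_measurableEquiv_toLp
    (Fin 2)).measure_preimage (MeasurableSet.univ_pi fun _ => measurableSet_Ico).nullMeasurableSet,
    volume_pi_pi]
  simp only [Real.volume_Ico]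
  rw [Fin.prod_univ_two, sq]
  congr 2 <;> ring

lemma pairwise_disjoint_gridCell (ε : ℝ) : Pairwise (Function.onFun Disjoint (gridCell ε)) := by
  intro n m hnm
  rw [Function.onFun, Set.disjoint_left]
  intro x hx hx'
  exact hnm (funext fun j => (hx j).symm.trans (hx' j))

lemma iUnion_gridCell (ε : ℝ) : ⋃ n, gridCell ε n = univ :=
  eq_univ_of_forall fun x => mem_iUnion.2 ⟨fun j => ⌊x j / ε⌋, fun _ => rfl⟩

lemma norm_sub_lt_of_mem_gridCell {ε : ℝ} (hε : 0 < ε) {n : Fin 2 → ℤ} {x y : Plane}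
    (hx : x ∈ gridCell ε n) (hy : y ∈ gridCell ε n) : ‖y - x‖ < 2 * ε := by
  have h : ∀ j, |y j - x j| < ε := fun j => by
    have h1 := Int.abs_sub_lt_one_of_floor_eq_floor ((hy j).trans (hx j).symm)
    rw [← sub_div, abs_div, abs_of_pos hε, div_lt_one hε] at h1
    exact h1
  have h0 := h 0
  have h1 := h 1
  refine lt_of_pow_lt_pow_left₀ 2 (by positivity) ?_
  rw [EuclideanSpace.norm_sq_eq, Fin.sum_univ_two]
  simp only [PiLp.sub_apply, Real.norm_eq_abs]
  nlinarith [abs_nonneg (y 0 - x 0), abs_nonneg (y 1 - x 1)]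

lemma enorm_add_sq_le (a b : ℂ) : ‖a + b‖ₑ ^ 2 ≤ 2 * ‖a‖ₑ ^ 2 + 2 * ‖b‖ₑ ^ 2 := by
  have h1 : ‖a + b‖ ^ 2 ≤ 2 * ‖a‖ ^ 2 + 2 * ‖b‖ ^ 2 := by
    have := pow_le_pow_left₀ (norm_nonneg _) (norm_add_le a b) 2
    nlinarith [sq_nonneg (‖a‖ - ‖b‖)]
  have h2 := ENNReal.ofReal_le_ofReal h1
  rw [ENNReal.ofReal_add (by positivity) (by positivity), ENNReal.ofReal_mul zero_le_two,
    ENNReal.ofReal_mul zero_le_two, ENNReal.ofReal_pow (norm_nonneg _),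
    ENNReal.ofReal_pow (norm_nonneg _), ENNReal.ofReal_pow (norm_nonneg _)] at h2
  simpa only [ofReal_norm, ENNReal.ofReal_ofNat] using h2

/-- Poincaré inequality on a cell, with the gradient replaced by differences. -/
lemma lintegral_cell_le {Q : Set Plane} (hQ : volume Q ≠ ⊤) (hQ0 : volume Q ≠ 0)
    {φ : Plane → ℂ} (hφ : Continuous φ) (hφi : Integrable φ) :
    ∫⁻ x in Q, ‖φ x‖ₑ ^ 2 ≤ 2 * ((volume Q)⁻¹ * ‖∫ y in Q, φ y‖ₑ ^ 2) +
      2 * ((volume Q)⁻¹ * ∫⁻ x in Q, ∫⁻ y in Q, ‖φ y - φ x‖ₑ ^ 2) := by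
  set m := (volume Q).toReal with hm
  have hm0 : 0 < m := ENNReal.toReal_pos hQ0 hQ
  have hmE : volume Q = ENNReal.ofReal m := (ENNReal.ofReal_toReal hQ).symm
  have hpt : ∀ x, ‖φ x‖ₑ ^ 2 ≤ 2 * ((volume Q)⁻¹ ^ 2 * ‖∫ y in Q, φ y‖ₑ ^ 2) +
      2 * ((volume Q)⁻¹ * ∫⁻ y in Q, ‖φ y - φ x‖ₑ ^ 2) := by
    intro x
    have hi : IntegrableOn (fun y => φ y - φ x) Q :=
      hφi.integrableOn.sub (integrableOn_const hQ)
    -- The value at `x` is the mean over the cell plus the mean deviation from it, scaled by the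
    -- volume of the cell.
    have e1 : (m : ℂ) * φ x = (∫ y in Q, φ y) + -∫ y in Q, (φ y - φ x) := by
      rw [integral_sub hφi.integrableOn (integrableOn_const hQ), setIntegral_const]
      change _ = (∫ y in Q, φ y) + -((∫ y in Q, φ y) - m • φ x)
      rw [Complex.real_smul]
      ring
    have e2 := enorm_add_sq_le (∫ y in Q, φ y) (-∫ y in Q, (φ y - φ x))
    have e3 : ‖-∫ y in Q, (φ y - φ x)‖ₑ ^ 2 ≤ volume Q * ∫⁻ y in Q, ‖φ y - φ x‖ₑ ^ 2 := by
      rw [enorm_neg]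
      calc ‖∫ y in Q, (φ y - φ x)‖ₑ ^ 2 ≤ (∫⁻ y in Q, ‖φ y - φ x‖ₑ) ^ 2 := by
            gcongr; exact enorm_integral_le_lintegral_enorm _
        _ ≤ _ := by
            have := lintegral_sq_le (volume.restrict Q)
              (f := fun y => ‖φ y - φ x‖ₑ) (by fun_prop)
            rwa [Measure.restrict_apply_univ] at this
    have e4 : ‖(m : ℂ)‖ₑ = volume Q := by
      rw [hmE, ← ofReal_norm, Complex.norm_real, Real.norm_of_nonneg hm0.le]
    rw [← e1, enorm_mul, e4, mul_pow] at e2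
    have e5 : (volume Q)⁻¹ ^ 2 * (volume Q ^ 2 * ‖φ x‖ₑ ^ 2) = ‖φ x‖ₑ ^ 2 := by
      rw [← mul_assoc, ← mul_pow, ENNReal.inv_mul_cancel hQ0 hQ, one_pow, one_mul]
    rw [← e5]
    calc (volume Q)⁻¹ ^ 2 * (volume Q ^ 2 * ‖φ x‖ₑ ^ 2)
        ≤ (volume Q)⁻¹ ^ 2 * (2 * ‖∫ y in Q, φ y‖ₑ ^ 2 +
          2 * (volume Q * ∫⁻ y in Q, ‖φ y - φ x‖ₑ ^ 2)) := by
          gcongr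
          exact e2.trans (by gcongr)
      _ = 2 * ((volume Q)⁻¹ ^ 2 * ‖∫ y in Q, φ y‖ₑ ^ 2) +
          2 * ((volume Q)⁻¹ * ((volume Q)⁻¹ * volume Q) * ∫⁻ y in Q, ‖φ y - φ x‖ₑ ^ 2) := by
          ring
      _ = _ := by rw [ENNReal.inv_mul_cancel hQ0 hQ, mul_one]
  calc ∫⁻ x in Q, ‖φ x‖ₑ ^ 2
      ≤ ∫⁻ x in Q, (2 * ((volume Q)⁻¹ ^ 2 * ‖∫ y in Q, φ y‖ₑ ^ 2) +
        2 * ((volume Q)⁻¹ * ∫⁻ y in Q, ‖φ y - φ x‖ₑ ^ 2)) := lintegral_mono hpt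
    _ = 2 * ((volume Q)⁻¹ * ((volume Q)⁻¹ * volume Q) * ‖∫ y in Q, φ y‖ₑ ^ 2) +
        2 * ((volume Q)⁻¹ * ∫⁻ x in Q, ∫⁻ y in Q, ‖φ y - φ x‖ₑ ^ 2) := by
        rw [lintegral_add_left measurable_const, setLIntegral_const,
          lintegral_const_mul' _ _ ENNReal.ofNat_ne_top,
          lintegral_const_mul' _ _ (ENNReal.inv_ne_top.2 hQ0)]
        ring
    _ = _ := by rw [ENNReal.inv_mul_cancel hQ0 hQ, mul_one]

/-- Two points of a cell are less than 2ε apart, so the double integrals over the cells are bounded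
by translation differences with |h| < 2ε. The constant is 2 · ε⁻² · (2ε)² · π(2ε)² = 32πε². -/
lemma lintegral_sq_le_grid {ε : ℝ} (hε : 0 < ε) {φ : Plane → ℂ} (hφ : ContDiff ℝ 1 φ)
    (hφc : HasCompactSupport φ) : ∫⁻ x, ‖φ x‖ₑ ^ 2 ≤
      ∑' n, 2 * ((ENNReal.ofReal ε ^ 2)⁻¹ * ‖∫ y in gridCell ε n, φ y‖ₑ ^ 2) +
        32 * ENNReal.ofReal Real.pi * ENNReal.ofReal ε ^ 2 *
          ∫⁻ x, ∑ j, ‖fderiv ℝ φ x (basisVec j)‖ₑ ^ 2 := by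
  have hsplit : ∀ f : Plane → ℝ≥0∞, ∑' n, ∫⁻ x in gridCell ε n, f x = ∫⁻ x, f x := fun f => by
    rw [← lintegral_iUnion (measurableSet_gridCell hε) (pairwise_disjoint_gridCell ε),
      iUnion_gridCell, Measure.restrict_univ]
  set K := ∫⁻ x, ∑ j, ‖fderiv ℝ φ x (basisVec j)‖ₑ ^ 2
  set G : Plane → ℝ≥0∞ := fun x => ∫⁻ h in Metric.ball (0 : Plane) (2 * ε), ‖φ (x + h) - φ x‖ₑ ^ 2
  have hcell : ∀ n, ∫⁻ x in gridCell ε n, ∫⁻ y in gridCell ε n, ‖φ y - φ x‖ₑ ^ 2 ≤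
      ∫⁻ x in gridCell ε n, G x := fun n => by
    refine setLIntegral_mono' (measurableSet_gridCell hε n) fun x hx => ?_
    calc ∫⁻ y in gridCell ε n, ‖φ y - φ x‖ₑ ^ 2
        ≤ ∫⁻ y in Metric.ball x (2 * ε), ‖φ y - φ x‖ₑ ^ 2 :=
          lintegral_mono_set fun y hy => by
            rw [mem_ball_iff_norm]; exact norm_sub_lt_of_mem_gridCell hε hx hy
      _ = G x := by
          simp only [G]
          rw [← lintegral_indicator Metric.isOpen_ball.measurableSet,
            ← lintegral_indicator Metric.isOpen_ball.measurableSet,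
            ← lintegral_add_left_eq_self _ x]
          refine lintegral_congr fun h => ?_
          by_cases hh : h ∈ Metric.ball (0 : Plane) (2 * ε)
          · have : x + h ∈ Metric.ball x (2 * ε) := by
              simpa [mem_ball_iff_norm] using hh
            rw [indicator_of_mem hh, indicator_of_mem this]
          · have : x + h ∉ Metric.ball x (2 * ε) := by
              simpa [mem_ball_iff_norm] using hh
            rw [indicator_of_notMem hh, indicator_of_notMem this]
  have hG : ∫⁻ x, G x ≤ ENNReal.ofReal (2 * ε) ^ 2 * K * (ENNReal.ofReal (2 * ε) ^ 2 * ENNReal.ofReal Real.pi) := by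
    calc ∫⁻ x, G x = ∫⁻ h in Metric.ball (0 : Plane) (2 * ε), ∫⁻ x, ‖φ (x + h) - φ x‖ₑ ^ 2 := by
          refine lintegral_lintegral_swap (Measurable.aemeasurable ?_)
          have hc : Continuous fun p : Plane × Plane => φ (p.1 + p.2) - φ p.1 := by
            have := hφ.continuous
            fun_prop
          exact (hc.enorm.measurable).pow_const 2
      _ ≤ ∫⁻ h in Metric.ball (0 : Plane) (2 * ε), ENNReal.ofReal (2 * ε) ^ 2 * K := by
          refine setLIntegral_mono' Metric.isOpen_ball.measurableSet fun h hh => ?_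
          refine (lintegral_translate_sub_sq_le hφ h).trans ?_
          gcongr
          rw [← ofReal_norm]
          exact ENNReal.ofReal_le_ofReal (mem_ball_zero_iff.1 hh).le
      _ = _ := by
          rw [setLIntegral_const, EuclideanSpace.volume_ball_fin_two]
  calc ∫⁻ x, ‖φ x‖ₑ ^ 2 = ∑' n, ∫⁻ x in gridCell ε n, ‖φ x‖ₑ ^ 2 := (hsplit _).symm
    _ ≤ ∑' n, (2 * ((ENNReal.ofReal ε ^ 2)⁻¹ * ‖∫ y in gridCell ε n, φ y‖ₑ ^ 2) +
        2 * ((ENNReal.ofReal ε ^ 2)⁻¹ * ∫⁻ x in gridCell ε n, G x)) := by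
        refine ENNReal.tsum_le_tsum fun n => ?_
        have hv := volume_gridCell hε n
        have h1 := lintegral_cell_le (Q := gridCell ε n)
          (by rw [hv]; exact ENNReal.pow_ne_top ENNReal.ofReal_ne_top)
          (by rw [hv]; exact pow_ne_zero _ (ENNReal.ofReal_pos.2 hε).ne') hφ.continuous
          (hφ.continuous.integrable_of_hasCompactSupport hφc)
        rw [hv] at h1
        exact h1.trans (add_le_add le_rfl
          (mul_le_mul_right (mul_le_mul_right (hcell n) _) _))
    _ = ∑' n, 2 * ((ENNReal.ofReal ε ^ 2)⁻¹ * ‖∫ y in gridCell ε n, φ y‖ₑ ^ 2) +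
        2 * ((ENNReal.ofReal ε ^ 2)⁻¹ * ∫⁻ x, G x) := by
        rw [ENNReal.tsum_add]
        congr 1
        rw [ENNReal.tsum_mul_left, ENNReal.tsum_mul_left, hsplit]
    _ ≤ _ := by
        refine add_le_add le_rfl ?_
        calc 2 * ((ENNReal.ofReal ε ^ 2)⁻¹ * ∫⁻ x, G x)
            ≤ 2 * ((ENNReal.ofReal ε ^ 2)⁻¹ * (ENNReal.ofReal (2 * ε) ^ 2 * K *
              (ENNReal.ofReal (2 * ε) ^ 2 * ENNReal.ofReal Real.pi))) := by gcongr
          _ = 32 * ENNReal.ofReal Real.pi * ((ENNReal.ofReal ε ^ 2)⁻¹ * ENNReal.ofReal ε ^ 2) *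
              ENNReal.ofReal ε ^ 2 * K := by
              rw [ENNReal.ofReal_mul zero_le_two, ENNReal.ofReal_ofNat]
              ring
          _ = _ := by
              rw [ENNReal.inv_mul_cancel (pow_ne_zero _ (ENNReal.ofReal_pos.2 hε).ne')
                (ENNReal.pow_ne_top ENNReal.ofReal_ne_top), mul_one]

lemma IsTestFunction.eq_zero_of_notMem {Ω : Set Plane} {φ : Plane → ℂ} (h : IsTestFunction Ω φ)
    {x : Plane} (hx : x ∉ Ω) : φ x = 0 :=
  image_eq_zero_of_notMem_tsupport fun h' => hx (h.2.2 h')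

lemma IsTestFunction.fderiv_eq_zero_of_notMem {Ω : Set Plane} {φ : Plane → ℂ}
    (h : IsTestFunction Ω φ) {x : Plane} (hx : x ∉ Ω) : fderiv ℝ φ x = 0 :=
  image_eq_zero_of_notMem_tsupport (f := fderiv ℝ φ)
    fun h' => hx (h.2.2 (tsupport_fderiv_subset ℝ h'))

/-- The indicator function of a grid cell in `L²(Ω)`. -/
def gridIndicator {Ω : Set Plane} (hΩ : volume Ω ≠ ⊤) {ε : ℝ} (hε : 0 < ε) (n : Fin 2 → ℤ) :
    L2 Ω :=
  indicatorConstLp 2 (measurableSet_gridCell hε n) (μ := volume.restrict Ω)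
    (ne_top_of_le_ne_top hΩ ((measure_mono (subset_univ _)).trans
      (by rw [Measure.restrict_apply_univ]))) (1 : ℂ)

lemma mem_testGradientGraph_iff {Ω : Set Plane} {p : L2 Ω × (Fin 2 → L2 Ω)} :
    p ∈ testGradientGraph Ω ↔ ∃ φ : Plane → ℂ, IsTestFunction Ω φ ∧
      (p.1 : Plane → ℂ) =ᵐ[volume.restrict Ω] φ ∧
      ∀ j, (p.2 j : Plane → ℂ) =ᵐ[volume.restrict Ω] fun x => fderiv ℝ φ x (basisVec j) := Iff.rfl

lemma mem_of_mem_sobolevGraph {Ω : Set Plane} {s : Set (L2 Ω × (Fin 2 → L2 Ω))}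
    (hs : IsClosed s) (h : ∀ p ∈ testGradientGraph Ω, p ∈ s) {p : L2 Ω × (Fin 2 → L2 Ω)}
    (hp : p ∈ sobolevGraph Ω) : p ∈ s :=
  closure_minimal (s := (testGradientGraph Ω : Set (L2 Ω × (Fin 2 → L2 Ω)))) h hs hp

/-- The cells meeting the ball of radius `r`. -/
def gridIndices (r ε : ℝ) : Finset (Fin 2 → ℤ) :=
  Fintype.piFinset fun _ => Finset.Icc ⌊-r / ε⌋ ⌊r / ε⌋

lemma gridCell_disjoint {r ε : ℝ} (hε : 0 < ε) {n : Fin 2 → ℤ} (hn : n ∉ gridIndices r ε)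
    {x : Plane} (hx : x ∈ gridCell ε n) : x ∉ Metric.ball 0 r := by
  intro hxΩ
  refine hn (Fintype.mem_piFinset.2 fun j => Finset.mem_Icc.2 ?_)
  have h1 : |x j| ≤ r := (PiLp.norm_apply_le x j).trans (mem_ball_zero_iff.1 hxΩ).le
  rw [abs_le] at h1
  rw [← hx j]
  exact ⟨Int.floor_mono (by gcongr; exact h1.1), Int.floor_mono (by gcongr; exact h1.2)⟩

/-- Only finitely many cells meet the ball, and the cell averages are inner products with their
indicators. The first term thus vanishes on a subspace of finite codimension. -/
lemma norm_sq_le_grid_of_isTestFunction {r ε : ℝ} (hε : 0 < ε) {Ω : Set Plane}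
    (hΩr : Ω ⊆ Metric.ball 0 r) (hΩ : volume Ω ≠ ⊤) {u : L2 Ω} {g : Fin 2 → L2 Ω} {φ : Plane → ℂ} (hφ : IsTestFunction Ω φ)
    (hu : (u : Plane → ℂ) =ᵐ[volume.restrict Ω] φ)
    (hg : ∀ j, (g j : Plane → ℂ) =ᵐ[volume.restrict Ω] fun x => fderiv ℝ φ x (basisVec j)) :
    ‖u‖ ^ 2 ≤ ∑ n ∈ gridIndices r ε, 2 * ((ε ^ 2)⁻¹ * ‖⟪gridIndicator hΩ hε n, u⟫_ℂ‖ ^ 2) +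
        32 * Real.pi * ε ^ 2 * ∑ j, ‖g j‖ ^ 2 := by
  have h1 := lintegral_sq_le_grid hε (hφ.1.of_le (by simp)) hφ.2.1
  have e1 : ‖u‖ₑ ^ 2 = ∫⁻ x, ‖φ x‖ₑ ^ 2 := by
    rw [enorm_sq_eq_lintegral,
      ← setLIntegral_eq_of_support_subset (s := Ω) (f := fun x => ‖φ x‖ₑ ^ 2)]
    · refine lintegral_congr_ae ?_
      filter_upwards [hu] with x hx
      rw [hx]
    · refine Function.support_subset_iff'.2 fun x hx => ?_
      rw [hφ.eq_zero_of_notMem hx]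
      simp
  have e2 : ∫⁻ x, ∑ j, ‖fderiv ℝ φ x (basisVec j)‖ₑ ^ 2 = ∑ j, ‖g j‖ₑ ^ 2 := by
    have hc : Continuous (fderiv ℝ φ) := hφ.1.continuous_fderiv (by simp)
    rw [lintegral_finsetSum _ fun j _ =>
      ((hc.clm_apply continuous_const).enorm.measurable).pow_const 2]
    refine Finset.sum_congr rfl fun j _ => ?_
    rw [enorm_sq_eq_lintegral, ← setLIntegral_eq_of_support_subset (s := Ω)
      (f := fun x => ‖fderiv ℝ φ x (basisVec j)‖ₑ ^ 2)]
    · refine lintegral_congr_ae ?_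
      filter_upwards [hg j] with x hx
      rw [hx]
    · refine Function.support_subset_iff'.2 fun x hx => ?_
      rw [hφ.fderiv_eq_zero_of_notMem hx]
      simp
  have e3 : ∀ n, ∫ y in gridCell ε n, φ y = ⟪gridIndicator hΩ hε n, u⟫_ℂ := by
    intro n
    rw [gridIndicator, L2.inner_indicatorConstLp_one,
      setIntegral_congr_ae₀ (g := φ) (measurableSet_gridCell hε n).nullMeasurableSet
        (hu.mono fun x hx _ => hx), Measure.restrict_restrict (measurableSet_gridCell hε n),
      setIntegral_eq_of_subset_of_forall_sdiff_eq_zero (measurableSet_gridCell hε n)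
        inter_subset_left]
    intro x hx
    exact hφ.eq_zero_of_notMem fun h => hx.2 ⟨hx.1, h⟩
  have e4 : ∀ n ∉ gridIndices r ε,
      2 * ((ENNReal.ofReal ε ^ 2)⁻¹ * ‖∫ y in gridCell ε n, φ y‖ₑ ^ 2) = 0 := fun n hn => by
    rw [setIntegral_eq_zero_of_forall_eq_zero fun x hx =>
      hφ.eq_zero_of_notMem fun h => gridCell_disjoint hε hn hx (hΩr h)]
    simp
  rw [← e1, e2, tsum_eq_sum e4] at h1
  simp_rw [e3] at h1
  have hr : ∀ {H : Type} [NormedAddCommGroup H] (y : H), ‖y‖ₑ ^ 2 = ENNReal.ofReal (‖y‖ ^ 2) :=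
    fun y => by rw [ENNReal.ofReal_pow (norm_nonneg _), ofReal_norm]
  rw [← ENNReal.ofReal_le_ofReal_iff (by positivity), ENNReal.ofReal_add (by positivity)
    (by positivity), ENNReal.ofReal_sum_of_nonneg fun _ _ => by positivity,
    ENNReal.ofReal_mul (by positivity), ENNReal.ofReal_mul (by positivity),
    ENNReal.ofReal_mul (by positivity), ENNReal.ofReal_sum_of_nonneg fun _ _ => by positivity]
  simp_rw [ENNReal.ofReal_mul zero_le_two,
    ENNReal.ofReal_mul (show (0 : ℝ) ≤ (ε ^ 2)⁻¹ by positivity), ← hr,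
    ENNReal.ofReal_inv_of_pos (pow_pos hε 2), ENNReal.ofReal_pow hε.le, ENNReal.ofReal_ofNat]
  exact h1

lemma norm_sq_le_grid {r ε : ℝ} (hε : 0 < ε) {Ω : Set Plane}
    (hΩr : Ω ⊆ Metric.ball 0 r) (hΩ : volume Ω ≠ ⊤) {u : L2 Ω} {g : Fin 2 → L2 Ω}
    (hug : (u, g) ∈ sobolevGraph Ω) :
    ‖u‖ ^ 2 ≤ ∑ n ∈ gridIndices r ε, 2 * ((ε ^ 2)⁻¹ * ‖⟪gridIndicator hΩ hε n, u⟫_ℂ‖ ^ 2) +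
        32 * Real.pi * ε ^ 2 * ∑ j, ‖g j‖ ^ 2 := by
  have hclosed : IsClosed {p : L2 Ω × (Fin 2 → L2 Ω) | ‖p.1‖ ^ 2 ≤
      ∑ n ∈ gridIndices r ε, 2 * ((ε ^ 2)⁻¹ * ‖⟪gridIndicator hΩ hε n, p.1⟫_ℂ‖ ^ 2) +
        32 * Real.pi * ε ^ 2 * ∑ j, ‖p.2 j‖ ^ 2} :=
    isClosed_le (by fun_prop) (by fun_prop)
  have key := mem_of_mem_sobolevGraph hclosed (fun p hp => ?_) hug
  · rwa [mem_ofPred_eq] at key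
  obtain ⟨φ, hφ, hu, hg⟩ := mem_testGradientGraph_iff.1 hp
  rw [mem_ofPred_eq]
  exact norm_sq_le_grid_of_isTestFunction hε hΩr hΩ hφ hu hg

/-- A quantitative form of Rellich's theorem. -/
theorem exists_norm_sq_le_of_mem_orthogonal {r : ℝ} {Ω : Set Plane}
    (hΩr : Ω ⊆ Metric.ball 0 r) : ∀ ε > 0, ∃ F : Submodule ℂ (L2 Ω), FiniteDimensional ℂ F ∧
      ∀ u : L2 Ω, ∀ g : Fin 2 → L2 Ω, (u, g) ∈ sobolevGraph Ω → u ∈ Fᗮ →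
        ‖u‖ ^ 2 ≤ ε * ∑ j, ‖g j‖ ^ 2 := by
  intro δ hδ
  have hΩ : volume Ω ≠ ⊤ := ne_top_of_le_ne_top measure_ball_lt_top.ne (measure_mono hΩr)
  -- The mesh width for which 32πε² = δ.
  set ε : ℝ := Real.sqrt (δ / (32 * Real.pi)) with hε'
  have hε : 0 < ε := Real.sqrt_pos.2 (by positivity)
  let F : Submodule ℂ (L2 Ω) := Submodule.span ℂ
    ((fun n => gridIndicator hΩ hε n) '' (gridIndices r ε : Set (Fin 2 → ℤ)))
  refine ⟨F, FiniteDimensional.span_of_finite ℂ ((Finset.finite_toSet _).image _), fun u g hug hu => ?_⟩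
  have h1 := norm_sq_le_grid hε hΩr hΩ hug
  rw [Finset.sum_eq_zero, zero_add] at h1
  · refine h1.trans (le_of_eq ?_)
    rw [hε', Real.sq_sqrt (by positivity)]
    field_simp
  · intro n hn
    rw [(Submodule.mem_orthogonal _ _).1 hu _ (Submodule.subset_span
      (mem_image_of_mem _ (Finset.mem_coe.2 hn)))]
    simp

end Compactness

/-! ### Multipliers on H¹₀ and integration by parts. -/

section Sobolev

variable {Ω : Set Plane}

lemma MemLp.of_continuous_hasCompactSupport {f : Plane → ℂ} (hf : Continuous f)
    (hfc : HasCompactSupport f) : MemLp f 2 (volume.restrict Ω) :=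
  (hf.memLp_of_hasCompactSupport hfc).restrict Ω

/-- A smooth approximation of a compactly supported `C¹` function. -/
lemma exists_isTestFunction_near (hΩ : IsOpen Ω) {φ : Plane → ℂ} (hφ : ContDiff ℝ 1 φ)
    (hφc : HasCompactSupport φ) (hφΩ : tsupport φ ⊆ Ω) {ε : ℝ} (hε : 0 < ε) :
    ∃ ψ, IsTestFunction Ω ψ ∧ (∀ x, ‖ψ x - φ x‖ ≤ ε) ∧
      ∀ x j, ‖fderiv ℝ ψ x (basisVec j) - fderiv ℝ φ x (basisVec j)‖ ≤ ε := by
  obtain ⟨δ₁, hδ₁, hsub⟩ := hφc.isCompact.exists_cthickening_subset_open hΩ hφΩ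
  have hDc : Continuous (fderiv ℝ φ) := hφ.continuous_fderiv one_ne_zero
  have hDs : HasCompactSupport (fderiv ℝ φ) := hφc.fderiv ℝ
  obtain ⟨δ₂, hδ₂, hu₂⟩ := Metric.uniformContinuous_iff.1
    (hφc.uniformContinuous_of_continuous hφ.continuous) ε hε
  obtain ⟨δ₃, hδ₃, hu₃⟩ := Metric.uniformContinuous_iff.1
    (hDs.uniformContinuous_of_continuous hDc) ε hε
  -- The mollification radius keeps the support inside Ω and lies below the moduli of uniform
  -- continuity of φ and of its derivative. The derivative of the convolution is taken on φ, so both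
  -- approximations are of the same kind.
  set δ := min δ₁ (min δ₂ δ₃) with hδ
  have hδ0 : 0 < δ := lt_min hδ₁ (lt_min hδ₂ hδ₃)
  let b : ContDiffBump (0 : Plane) := ⟨δ / 2, δ, by linarith, by linarith⟩
  let ψ : Plane → ℂ := convolution (b.normed volume) φ (ContinuousLinearMap.lsmul ℝ ℝ) volume
  have hbc : HasCompactSupport (b.normed volume) := b.hasCompactSupport_normed
  have hloc : LocallyIntegrable (b.normed volume) volume := b.continuous_normed.locallyIntegrable
  have hfd : ∀ x, fderiv ℝ ψ x = convolution (b.normed volume) (fderiv ℝ φ)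
      (ContinuousLinearMap.lsmul ℝ ℝ) volume x := fun x =>
    (hφc.hasFDerivAt_convolution_right (ContinuousLinearMap.lsmul ℝ ℝ) hloc hφ x).fderiv
  refine ⟨ψ, ⟨?_, ?_, ?_⟩, fun x => ?_, fun x j => ?_⟩
  · exact hbc.contDiff_convolution_left _ b.contDiff_normed hφ.continuous.locallyIntegrable
  · exact hbc.convolution _ hφc
  · refine (closure_minimal ?_ Metric.isClosed_cthickening).trans hsub
    intro x hx
    obtain ⟨y, hy, z, hz, rfl⟩ := mem_add.1 (support_convolution_subset _ hx)
    have hy' : ‖y‖ < δ := by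
      have := b.support_normed_eq (μ := volume) ▸ hy
      rwa [mem_ball_zero_iff] at this
    refine Metric.mem_cthickening_of_dist_le _ z _ _ (subset_tsupport _ hz) ?_
    rw [dist_eq_norm, add_sub_cancel_right]
    exact hy'.le.trans (min_le_left _ _)
  · rw [← dist_eq_norm]
    refine b.dist_normed_convolution_le hφ.continuous.aestronglyMeasurable fun y hy => ?_
    exact (hu₂ (lt_of_lt_of_le hy ((min_le_right _ _).trans (min_le_left _ _)))).le
  · rw [← _root_.sub_apply]
    refine (ContinuousLinearMap.le_opNorm _ _).trans ?_
    have h1 : ‖basisVec j‖ = 1 := by simp [basisVec]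
    rw [h1, mul_one, hfd, ← dist_eq_norm]
    refine b.dist_normed_convolution_le hDc.aestronglyMeasurable fun y hy => ?_
    exact (hu₃ (lt_of_lt_of_le hy ((min_le_right _ _).trans (min_le_right _ _)))).le

lemma dist_L2_le [IsFiniteMeasure (volume.restrict Ω)] {u v : L2 Ω} {ε : ℝ} (hε : 0 ≤ ε)
    (h : ∀ᵐ x ∂(volume.restrict Ω), ‖u x - v x‖ ≤ ε) :
    dist u v ≤ (measureUnivNNReal (volume.restrict Ω) : ℝ) ^ (2 : ℝ)⁻¹ * ε := by
  rw [dist_eq_norm]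
  have := Lp.norm_le_of_ae_bound (p := 2) (f := u - v) hε (by
    filter_upwards [h, Lp.coeFn_sub u v] with x hx e
    rw [e]; exact hx)
  simpa using this

/-- Compactly supported `C¹` functions belong to `H¹₀`. -/
lemma mem_sobolevGraph_of_contDiff_one (hΩ : IsOpen Ω) [IsFiniteMeasure (volume.restrict Ω)]
    {φ : Plane → ℂ} (hφ : ContDiff ℝ 1 φ) (hφc : HasCompactSupport φ) (hφΩ : tsupport φ ⊆ Ω)
    {u : L2 Ω} {g : Fin 2 → L2 Ω} (hu : (u : Plane → ℂ) =ᵐ[volume.restrict Ω] φ)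
    (hg : ∀ j, (g j : Plane → ℂ) =ᵐ[volume.restrict Ω] fun x => fderiv ℝ φ x (basisVec j)) :
    (u, g) ∈ sobolevGraph Ω := by
  refine Metric.mem_closure_iff.2 fun ε hε => ?_
  set K : ℝ := (measureUnivNNReal (volume.restrict Ω) : ℝ) ^ (2 : ℝ)⁻¹ with hK
  have hK0 : 0 ≤ K := by positivity
  obtain ⟨ψ, hψ, h1, h2⟩ := exists_isTestFunction_near hΩ hφ hφc hφΩ
    (ε := ε / (2 * (K + 1))) (by positivity)
  have hlt : K * (ε / (2 * (K + 1))) < ε := by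
    rw [mul_div_assoc', div_lt_iff₀ (by positivity)]
    nlinarith
  have hDc : Continuous (fderiv ℝ ψ) := hψ.1.continuous_fderiv (by simp)
  have hm : MemLp ψ 2 (volume.restrict Ω) :=
    MemLp.of_continuous_hasCompactSupport hψ.1.continuous hψ.2.1
  have hmg : ∀ j, MemLp (fun x => fderiv ℝ ψ x (basisVec j)) 2 (volume.restrict Ω) := fun j =>
    MemLp.of_continuous_hasCompactSupport (hDc.clm_apply continuous_const)
      (hψ.2.1.fderiv_apply ℝ _)
  refine ⟨(hm.toLp, fun j => (hmg j).toLp),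
    ⟨ψ, hψ, hm.coeFn_toLp, fun j => (hmg j).coeFn_toLp⟩, ?_⟩
  rw [Prod.dist_eq, max_lt_iff]
  constructor
  · refine lt_of_le_of_lt (dist_L2_le (by positivity) ?_) hlt
    filter_upwards [hu, hm.coeFn_toLp] with x e1 e2
    rw [e1, e2, norm_sub_rev]
    exact h1 x
  · rw [dist_pi_lt_iff hε]
    intro j
    refine lt_of_le_of_lt (dist_L2_le (by positivity) ?_) hlt
    filter_upwards [hg j, (hmg j).coeFn_toLp] with x e1 e2
    rw [e1, e2, norm_sub_rev]
    exact h2 x j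

/-- A bounded `C¹` function with bounded derivatives on `Ω`. -/
structure BoundedC1 (Ω : Set Plane) (η : Plane → ℂ) : Prop where
  contDiffOn : ContDiffOn ℝ 1 η Ω
  memLp : MemLp η ∞ (volume.restrict Ω)
  memLp_fderiv : ∀ j, MemLp (fun x => fderiv ℝ η x (basisVec j)) ∞ (volume.restrict Ω)

/-- Multiplication by a `C¹` function on pairs `(u, ∇u)`. -/
def mulGraph {η : Plane → ℂ} (hη : BoundedC1 Ω η) :
    (L2 Ω × (Fin 2 → L2 Ω)) →L[ℂ] (L2 Ω × (Fin 2 → L2 Ω)) :=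
  (mulL2 hη.memLp ∘L ContinuousLinearMap.fst ℂ _ _).prod (ContinuousLinearMap.pi fun j =>
    mulL2 hη.memLp ∘L (ContinuousLinearMap.proj (R := ℂ) (φ := fun _ : Fin 2 => L2 Ω) j) ∘L
      (ContinuousLinearMap.snd ℂ (L2 Ω) (Fin 2 → L2 Ω)) +
      (mulL2 (hη.memLp_fderiv j)) ∘L (ContinuousLinearMap.fst ℂ (L2 Ω) (Fin 2 → L2 Ω)))

/-- By closedness only test functions φ matter. The multiplier η is C¹ only on Ω, but ηφ vanishes
near every point outside the support of φ. It is therefore a compactly supported C¹ function on the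
plane, which belongs to H¹₀ by mollification. -/
lemma mulGraph_mem_sobolevGraph (hΩ : IsOpen Ω) [IsFiniteMeasure (volume.restrict Ω)]
    {η : Plane → ℂ} (hη : BoundedC1 Ω η) {p : L2 Ω × (Fin 2 → L2 Ω)} (hp : p ∈ sobolevGraph Ω) :
    mulGraph hη p ∈ sobolevGraph Ω := by
  have hclosed : IsClosed {p | mulGraph hη p ∈ sobolevGraph Ω} :=
    (Submodule.isClosed_topologicalClosure _).preimage (mulGraph hη).continuous
  refine mem_of_mem_sobolevGraph hclosed (fun p hp => ?_) hp
  obtain ⟨φ, hφ, hu, hg⟩ := mem_testGradientGraph_iff.1 hp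
  have hφ1 : ContDiff ℝ 1 φ := hφ.1.of_le (by simp)
  have hsupp : tsupport (fun x => η x * φ x) ⊆ tsupport φ := tsupport_mul_subset_right
  have hprod : ContDiff ℝ 1 fun x => η x * φ x := by
    rw [contDiff_iff_contDiffAt]
    intro x
    by_cases hx : x ∈ tsupport φ
    · exact (hη.contDiffOn.contDiffAt (hΩ.mem_nhds (hφ.2.2 hx))).mul hφ1.contDiffAt
    · have h0 : (fun x => η x * φ x) =ᶠ[𝓝 x] fun _ => 0 := by
        filter_upwards [notMem_tsupport_iff_eventuallyEq.1 hx] with y hy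
        rw [hy]; simp
      exact contDiffAt_const.congr_of_eventuallyEq h0
  have hmem := mem_sobolevGraph_of_contDiff_one hΩ hprod (hφ.2.1.mul_left) (hsupp.trans hφ.2.2)
    (u := (mulGraph hη p).1) (g := (mulGraph hη p).2) ?_ ?_
  · exact hmem
  · filter_upwards [coeFn_mulL2 hη.memLp p.1, hu] with x e1 e2
    rw [← e2]
    exact e1
  · intro j
    filter_upwards [coeFn_mulL2 hη.memLp (p.2 j), coeFn_mulL2 (hη.memLp_fderiv j) p.1,
      Lp.coeFn_add (mulL2 hη.memLp (p.2 j)) (mulL2 (hη.memLp_fderiv j) p.1), hu, hg j,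
      ae_restrict_mem hΩ.measurableSet] with x e1 e2 e3 e4 e5 e6
    have d1 : DifferentiableAt ℝ η x :=
      (hη.contDiffOn.contDiffAt (hΩ.mem_nhds e6)).differentiableAt one_ne_zero
    have d2 : DifferentiableAt ℝ φ x := hφ1.differentiable one_ne_zero x
    change (mulL2 hη.memLp (p.2 j) + mulL2 (hη.memLp_fderiv j) p.1 : L2 Ω) x = _
    rw [e3, Pi.add_apply, e1, e2, e4, e5, fderiv_fun_mul d1 d2]
    simp only [_root_.add_apply, _root_.smul_apply, smul_eq_mul]
    ring

/-- Integration by parts against real test functions. -/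
lemma integral_mul_eq_neg_of_mem_sobolevGraph {ψ : Plane → ℝ}
    (hψ : ContDiff ℝ ∞ ψ) (hψc : HasCompactSupport ψ) {u : L2 Ω} {g : Fin 2 → L2 Ω}
    (h : (u, g) ∈ sobolevGraph Ω) (j : Fin 2) :
    ∫ x in Ω, (ψ x : ℂ) * g j x = -∫ x in Ω, (fderiv ℝ ψ x (basisVec j) : ℂ) * u x := by
  have hDc : Continuous (fderiv ℝ ψ) := hψ.continuous_fderiv (by simp)
  have hdc : HasCompactSupport fun x => fderiv ℝ ψ x (basisVec j) := hψc.fderiv_apply ℝ _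
  have hm : MemLp (fun x => (ψ x : ℂ)) 2 (volume.restrict Ω) :=
    MemLp.of_continuous_hasCompactSupport (Complex.continuous_ofReal.comp hψ.continuous)
      (hψc.comp_left Complex.ofReal_zero)
  have hmd : MemLp (fun x => (fderiv ℝ ψ x (basisVec j) : ℂ)) 2 (volume.restrict Ω) :=
    MemLp.of_continuous_hasCompactSupport
      (Complex.continuous_ofReal.comp (hDc.clm_apply continuous_const))
      (hdc.comp_left Complex.ofReal_zero)
  have hin : ∀ {f : Plane → ℝ} (hf : MemLp (fun x => (f x : ℂ)) 2 (volume.restrict Ω)) (v : L2 Ω),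
      ⟪hf.toLp, v⟫_ℂ = ∫ x in Ω, (f x : ℂ) * v x := by
    intro f hf v
    rw [L2.inner_def]
    refine integral_congr_ae ?_
    filter_upwards [hf.coeFn_toLp] with x hx
    rw [hx, RCLike.inner_apply, Complex.conj_ofReal, mul_comm]
  -- ψ need not vanish at the boundary of Ω. The identity is closed in (u, g), and for test
  -- functions φ it is φ that is supported in Ω.
  have hclosed : IsClosed {p : L2 Ω × (Fin 2 → L2 Ω) |
      ⟪hm.toLp, p.2 j⟫_ℂ = -⟪hmd.toLp, p.1⟫_ℂ} := isClosed_eq (by fun_prop) (by fun_prop)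
  have key := mem_of_mem_sobolevGraph hclosed (fun p hp => ?_) h
  · rw [mem_ofPred_eq, hin, hin] at key
    exact key
  obtain ⟨φ, hφ, hu, hg⟩ := mem_testGradientGraph_iff.1 hp
  rw [mem_ofPred_eq, hin, hin]
  have hφD : Continuous (fderiv ℝ φ) := hφ.1.continuous_fderiv (by simp)
  have e1 : ∫ x in Ω, (ψ x : ℂ) * p.2 j x = ∫ x, (ψ x : ℂ) * fderiv ℝ φ x (basisVec j) := by
    rw [← setIntegral_eq_integral_of_forall_compl_eq_zero (s := Ω)
      (f := fun x => (ψ x : ℂ) * fderiv ℝ φ x (basisVec j))]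
    · refine integral_congr_ae ?_
      filter_upwards [hg j] with x hx
      rw [hx]
    · intro x hx
      rw [hφ.fderiv_eq_zero_of_notMem hx]; simp
  have e2 : ∫ x in Ω, (fderiv ℝ ψ x (basisVec j) : ℂ) * p.1 x =
      ∫ x, (fderiv ℝ ψ x (basisVec j) : ℂ) * φ x := by
    rw [← setIntegral_eq_integral_of_forall_compl_eq_zero (s := Ω)
      (f := fun x => (fderiv ℝ ψ x (basisVec j) : ℂ) * φ x)]
    · refine integral_congr_ae ?_
      filter_upwards [hu] with x hx
      rw [hx]
    · intro x hx
      rw [hφ.eq_zero_of_notMem hx]; simp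
  have e3 : ∀ x, fderiv ℝ (fun x => (ψ x : ℂ)) x (basisVec j) = (fderiv ℝ ψ x (basisVec j) : ℂ) := by
    intro x
    have d : HasFDerivAt ψ (fderiv ℝ ψ x) x := (hψ.differentiable (by simp) x).hasFDerivAt
    have := (Complex.ofRealCLM.hasFDerivAt (x := ψ x)).comp x d
    exact congrArg (fun L => L (basisVec j)) this.fderiv
  rw [e1, e2]
  simp_rw [← e3]
  have hψC : ContDiff ℝ ∞ fun x => (ψ x : ℂ) := Complex.ofRealCLM.contDiff.comp hψ
  have hψCc : HasCompactSupport fun x => (ψ x : ℂ) := hψc.comp_left Complex.ofReal_zero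
  have hψD : Continuous (fderiv ℝ fun x => (ψ x : ℂ)) := hψC.continuous_fderiv (by simp)
  refine integral_mul_fderiv_eq_neg_fderiv_mul_of_integrable ?_ ?_ ?_
    (fun x _ => hψC.differentiable (by simp) x) (fun x _ => hφ.1.differentiable (by simp) x)
  · exact ((hψD.clm_apply continuous_const).mul hφ.1.continuous).integrable_of_hasCompactSupport
      hφ.2.1.mul_left
  · exact (hψC.continuous.mul (hφD.clm_apply continuous_const)).integrable_of_hasCompactSupport
      hψCc.mul_right
  · exact (hψC.continuous.mul hφ.1.continuous).integrable_of_hasCompactSupport hψCc.mul_right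

end Sobolev

/-! ### Rotations and the angular momentum decomposition of L² of the disc. -/

section Rotation

/-- The rotation of the plane by the angle `θ`, as a linear isometry. -/
def rotationₗᵢ (θ : ℝ) : Plane →ₗᵢ[ℝ] Plane where
  toFun x := !₂[Real.cos θ * x 0 - Real.sin θ * x 1, Real.sin θ * x 0 + Real.cos θ * x 1]
  map_add' x y := by
    ext i; fin_cases i <;> simp <;> ring
  map_smul' c x := by
    ext i; fin_cases i <;> simp <;> ring
  norm_map' x := by
    refine (sq_eq_sq₀ (norm_nonneg _) (norm_nonneg _)).1 ?_
    rw [EuclideanSpace.norm_sq_eq, EuclideanSpace.norm_sq_eq, Fin.sum_univ_two, Fin.sum_univ_two]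
    simp only [Real.norm_eq_abs, sq_abs]
    change (Real.cos θ * x 0 - Real.sin θ * x 1) ^ 2 + (Real.sin θ * x 0 + Real.cos θ * x 1) ^ 2 = _
    linear_combination (x 0 ^ 2 + x 1 ^ 2) * Real.cos_sq_add_sin_sq θ

/-- The rotation of the plane by the angle `θ`. -/
def rotation (θ : ℝ) : Plane ≃ₗᵢ[ℝ] Plane := (rotationₗᵢ θ).toLinearIsometryEquiv rfl

lemma rotation_apply_zero (θ : ℝ) (x : Plane) :
    rotation θ x 0 = Real.cos θ * x 0 - Real.sin θ * x 1 := rfl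

lemma rotation_apply_one (θ : ℝ) (x : Plane) :
    rotation θ x 1 = Real.sin θ * x 0 + Real.cos θ * x 1 := rfl

lemma rotation_neg_rotation (θ : ℝ) (x : Plane) : rotation (-θ) (rotation θ x) = x := by
  ext i
  fin_cases i
  · change rotation (-θ) (rotation θ x) 0 = x 0
    rw [rotation_apply_zero, rotation_apply_zero, rotation_apply_one, Real.cos_neg, Real.sin_neg]
    linear_combination x 0 * Real.cos_sq_add_sin_sq θ
  · change rotation (-θ) (rotation θ x) 1 = x 1
    rw [rotation_apply_one, rotation_apply_zero, rotation_apply_one, Real.cos_neg, Real.sin_neg]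
    linear_combination x 1 * Real.cos_sq_add_sin_sq θ

lemma rotation_rotation_neg (θ : ℝ) (x : Plane) : rotation θ (rotation (-θ) x) = x := by
  simpa using rotation_neg_rotation (-θ) x

lemma rotation_basisVec_zero (θ : ℝ) :
    rotation θ (basisVec 0) = Real.cos θ • basisVec 0 + Real.sin θ • basisVec 1 := by
  ext i
  fin_cases i
  · change rotation θ (basisVec 0) 0 = _
    rw [rotation_apply_zero]; simp [basisVec]
  · change rotation θ (basisVec 0) 1 = _
    rw [rotation_apply_one]; simp [basisVec]

lemma rotation_basisVec_one (θ : ℝ) :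
    rotation θ (basisVec 1) = -Real.sin θ • basisVec 0 + Real.cos θ • basisVec 1 := by
  ext i
  fin_cases i
  · change rotation θ (basisVec 1) 0 = _
    rw [rotation_apply_zero]; simp [basisVec]
  · change rotation θ (basisVec 1) 1 = _
    rw [rotation_apply_one]; simp [basisVec]

variable {r : ℝ}

lemma rotation_mem_ball {θ : ℝ} {x : Plane} :
    rotation θ x ∈ Metric.ball (0 : Plane) r ↔ x ∈ Metric.ball (0 : Plane) r := by
  rw [mem_ball_zero_iff, mem_ball_zero_iff, LinearIsometryEquiv.norm_map]

lemma measurePreserving_rotation (r θ : ℝ) :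
    MeasurePreserving (rotation θ) (volume.restrict (Metric.ball (0 : Plane) r))
      (volume.restrict (Metric.ball (0 : Plane) r)) := by
  have h := (rotation θ).measurePreserving.restrict_preimage
    (s := Metric.ball (0 : Plane) r) Metric.isOpen_ball.measurableSet
  have h2 : rotation θ ⁻¹' Metric.ball (0 : Plane) r = Metric.ball (0 : Plane) r := by
    ext x; exact rotation_mem_ball
  rwa [h2] at h

/-- Rotation of functions on the disc. -/
def rotL2 (r θ : ℝ) : L2 (Metric.ball (0 : Plane) r) →ₗᵢ[ℂ] L2 (Metric.ball (0 : Plane) r) :=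
  Lp.compMeasurePreservingₗᵢ ℂ (rotation θ) (measurePreserving_rotation r θ)

lemma coeFn_rotL2 (θ : ℝ) (u : L2 (Metric.ball (0 : Plane) r)) :
    rotL2 r θ u =ᵐ[volume.restrict (Metric.ball (0 : Plane) r)] fun x => u (rotation θ x) :=
  Lp.coeFn_compMeasurePreserving u (measurePreserving_rotation r θ)

lemma rotL2_eq_of_ae {θ : ℝ} {u : L2 (Metric.ball (0 : Plane) r)} {f : Plane → ℂ}
    (h : (u : Plane → ℂ) =ᵐ[volume.restrict (Metric.ball (0 : Plane) r)] f) :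
    rotL2 r θ u =ᵐ[volume.restrict (Metric.ball (0 : Plane) r)] fun x => f (rotation θ x) :=
  (coeFn_rotL2 θ u).trans ((measurePreserving_rotation r θ).quasiMeasurePreserving.ae_eq_comp h)

lemma rotL2_neg_rotL2 (θ : ℝ) (u : L2 (Metric.ball (0 : Plane) r)) :
    rotL2 r (-θ) (rotL2 r θ u) = u := by
  refine Lp.ext ((rotL2_eq_of_ae (coeFn_rotL2 θ u)).trans (ae_of_all _ fun x => ?_))
  simp only [rotation_rotation_neg]

lemma inner_rotL2_right (θ : ℝ) (u v : L2 (Metric.ball (0 : Plane) r)) :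
    ⟪u, rotL2 r θ v⟫_ℂ = ⟪rotL2 r (-θ) u, v⟫_ℂ := by
  rw [← (rotL2 r (-θ)).inner_map_map, rotL2_neg_rotL2]

/-- The functions of angular momentum `m` on the disc. -/
def angularMode (r : ℝ) (m : ℤ) : Submodule ℂ (L2 (Metric.ball (0 : Plane) r)) where
  carrier := {u | ∀ θ : ℝ, rotL2 r θ u = Complex.exp (m * θ * Complex.I) • u}
  zero_mem' θ := by simp
  add_mem' hu hv θ := by rw [map_add, hu θ, hv θ, smul_add]
  smul_mem' c u hu θ := by rw [map_smul, hu θ, smul_comm]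

lemma mem_angularMode {m : ℤ} {u : L2 (Metric.ball (0 : Plane) r)} : u ∈ angularMode r m ↔
    ∀ θ : ℝ, rotL2 r θ u = Complex.exp (m * θ * Complex.I) • u := Iff.rfl

lemma isClosed_angularMode (r : ℝ) (m : ℤ) :
    IsClosed (angularMode r m : Set (L2 (Metric.ball (0 : Plane) r))) := by
  have : (angularMode r m : Set (L2 (Metric.ball (0 : Plane) r))) =
      ⋂ θ : ℝ, {u | rotL2 r θ u = Complex.exp (m * θ * Complex.I) • u} := by
    ext u; simp [mem_angularMode]
  rw [this]
  exact isClosed_iInter fun θ => isClosed_eq (rotL2 r θ).continuous (by fun_prop)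

instance (r : ℝ) (m : ℤ) : CompleteSpace (angularMode r m) :=
  (isClosed_angularMode r m).completeSpace_coe

/-- Rotation by θ is unitary and multiplies the inner product by e^{i(n-m)θ}. The angle π/(n - m)
makes this factor -1. -/
lemma inner_eq_zero_of_mem_angularMode (m n : ℤ) (hmn : m ≠ n)
    (u : L2 (Metric.ball (0 : Plane) r)) (hu : u ∈ angularMode r m)
    (v : L2 (Metric.ball (0 : Plane) r)) (hv : v ∈ angularMode r n) : ⟪u, v⟫_ℂ = 0 := by
  have hne : ((n : ℂ) - m) ≠ 0 := by
    rw [sub_ne_zero]; exact_mod_cast hmn.symm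
  have h := (rotL2 r (Real.pi / (n - m))).inner_map_map u v
  rw [hu, hv, inner_smul_left, inner_smul_right, ← Complex.exp_conj, ← mul_assoc,
    ← Complex.exp_add] at h
  have h2 : (starRingEnd ℂ) (m * ((Real.pi / (n - m) : ℝ) : ℂ) * Complex.I) +
      n * ((Real.pi / (n - m) : ℝ) : ℂ) * Complex.I = Real.pi * Complex.I := by
    simp only [map_mul, Complex.conj_I, Complex.conj_ofReal, map_intCast]
    push_cast
    field_simp
    ring
  rw [h2, Complex.exp_pi_mul_I] at h
  linear_combination (-1 / 2 : ℂ) * h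

/-- The coordinate `x₀ + i x₁`. -/
def zCoord (x : Plane) : ℂ := ⟨x 0, x 1⟩

lemma zCoord_eq (x : Plane) : zCoord x = x 0 + x 1 * Complex.I := by
  rw [zCoord, Complex.mk_eq_add_mul_I]

lemma continuous_zCoord : Continuous zCoord := by
  have : zCoord = fun x : Plane => (x 0 : ℂ) + x 1 * Complex.I := funext zCoord_eq
  rw [this]
  fun_prop

lemma zCoord_injective : Function.Injective zCoord := fun x y h => by
  ext i
  fin_cases i
  · exact congrArg Complex.re h
  · exact congrArg Complex.im h

lemma zCoord_rotation (θ : ℝ) (x : Plane) :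
    zCoord (rotation θ x) = Complex.exp (θ * Complex.I) * zCoord x := by
  rw [zCoord_eq, zCoord_eq, rotation_apply_zero, rotation_apply_one, Complex.exp_mul_I]
  push_cast
  linear_combination (-(Complex.sin θ * x 1)) * Complex.I_sq

/-- The angular momentum spaces are total in `L²` of the disc. -/
lemma eq_zero_of_forall_inner_angularMode (x : L2 (Metric.ball (0 : Plane) r))
    (hx : ∀ m, ∀ y ∈ angularMode r m, ⟪y, x⟫_ℂ = 0) : x = 0 := by
  set μ := volume.restrict (Metric.ball (0 : Plane) r) with hμ
  have : IsFiniteMeasure μ := isFiniteMeasure_restrict.2 measure_ball_lt_top.ne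
  have hxi : Integrable x μ := (Lp.memLp x).integrable one_le_two
  have hbd : ∀ f : Plane → ℂ, Continuous f → MemLp f ∞ μ := fun f hf => by
    obtain ⟨C, hC⟩ := (isCompact_closedBall (0 : Plane) r).exists_bound_of_continuousOn
      hf.continuousOn
    refine memLp_top_of_bound hf.aestronglyMeasurable C ?_
    filter_upwards [ae_restrict_mem Metric.isOpen_ball.measurableSet] with y hy
    exact hC y (Metric.ball_subset_closedBall hy)
  -- The conjugate of z^a z̄^b has angular momentum b - a, so the integral is an inner product with
  -- an element of an angular mode.
  have hmono : ∀ a b : ℕ, ∫ y, (zCoord y ^ a * (starRingEnd ℂ) (zCoord y) ^ b) * x y ∂μ = 0 := by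
    intro a b
    have hc : Continuous fun y => zCoord y ^ b * (starRingEnd ℂ) (zCoord y) ^ a :=
      (continuous_zCoord.pow b).mul ((Complex.continuous_conj.comp continuous_zCoord).pow a)
    have hm : MemLp (fun y => zCoord y ^ b * (starRingEnd ℂ) (zCoord y) ^ a) 2 μ :=
      (hbd _ hc).mono_exponent le_top
    have hmem : hm.toLp ∈ angularMode r ((b : ℤ) - a) := by
      intro θ
      refine Lp.ext ((rotL2_eq_of_ae hm.coeFn_toLp).trans ?_)
      filter_upwards [hm.coeFn_toLp, Lp.coeFn_smul (Complex.exp ((((b : ℤ) - a : ℤ) : ℂ) * θ *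
        Complex.I)) hm.toLp] with y e1 e2
      rw [e2, Pi.smul_apply, e1, zCoord_rotation, map_mul, ← Complex.exp_conj, smul_eq_mul]
      have e3 : Complex.exp ((((b : ℤ) - a : ℤ) : ℂ) * θ * Complex.I) =
          Complex.exp (θ * Complex.I) ^ b * Complex.exp ((starRingEnd ℂ) (θ * Complex.I)) ^ a := by
        rw [← Complex.exp_nat_mul, ← Complex.exp_nat_mul, ← Complex.exp_add]
        congr 1
        simp only [map_mul, Complex.conj_I, Complex.conj_ofReal]
        push_cast
        ring
      rw [e3]
      ring
    have h := hx _ _ hmem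
    rw [L2.inner_def] at h
    rw [← h]
    refine integral_congr_ae ?_
    filter_upwards [hm.coeFn_toLp] with y e1
    rw [e1, RCLike.inner_apply]
    simp only [map_mul, map_pow, Complex.conj_conj]
    ring
  set K := Metric.closedBall (0 : Plane) r with hK
  have : CompactSpace K := isCompact_iff_compactSpace.1 (isCompact_closedBall _ _)
  let z : C(K, ℂ) := ⟨fun y => zCoord y, continuous_zCoord.comp continuous_subtype_val⟩
  let S : StarSubalgebra ℂ C(K, ℂ) := StarAlgebra.adjoin ℂ {z}
  -- Stone-Weierstrass: polynomials in z and z̄ are uniformly dense on the closed disc, since z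
  -- separates points. Hence `x` integrates to zero against every continuous function.
  have hS : S.topologicalClosure = ⊤ := by
    refine ContinuousMap.starSubalgebra_topologicalClosure_eq_top_of_separatesPoints _ ?_
    intro y y' hne
    refine ⟨z, ⟨z, StarAlgebra.self_mem_adjoin_singleton ℂ z, rfl⟩, fun h => hne ?_⟩
    exact Subtype.ext (zCoord_injective h)
  have hpoly : ∀ p ∈ S, ∃ P : Plane → ℂ, Continuous P ∧ (∀ y : K, P y = p y) ∧
      ∫ y, P y * x y ∂μ = 0 := by
    intro p hp
    have hp' : p ∈ Submodule.span ℂ (Submonoid.closure ({z} ∪ star {z}) : Set C(K, ℂ)) := by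
      rw [← Algebra.adjoin_eq_span]
      exact hp
    clear hp
    induction hp' using Submodule.span_induction with
    | mem f hf =>
      have : ∃ a b : ℕ, f = z ^ a * star z ^ b := by
        induction hf using Submonoid.closure_induction with
        | mem g hg =>
          rcases hg with hg | hg
          · exact ⟨1, 0, by simpa using hg⟩
          · refine ⟨0, 1, ?_⟩
            rw [Set.mem_star, mem_singleton_iff] at hg
            rw [← hg]; simp
        | one => exact ⟨0, 0, by simp⟩
        | mul f g _ _ h1 h2 =>
          obtain ⟨a, b, rfl⟩ := h1
          obtain ⟨c, d, rfl⟩ := h2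
          exact ⟨a + c, b + d, by ring⟩
      obtain ⟨a, b, rfl⟩ := this
      exact ⟨fun y => zCoord y ^ a * (starRingEnd ℂ) (zCoord y) ^ b,
        (continuous_zCoord.pow a).mul ((Complex.continuous_conj.comp continuous_zCoord).pow b),
        fun y => rfl, hmono a b⟩
    | zero => exact ⟨0, continuous_const, fun y => rfl, by simp⟩
    | add f g _ _ h1 h2 =>
      obtain ⟨P, hP, hPf, hP0⟩ := h1
      obtain ⟨Q, hQ, hQg, hQ0⟩ := h2
      have hPi : Integrable (fun y => P y * x y) μ := hxi.mul_of_top_right (hbd P hP)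
      have hQi : Integrable (fun y => Q y * x y) μ := hxi.mul_of_top_right (hbd Q hQ)
      refine ⟨fun y => P y + Q y, hP.add hQ, fun y => ?_, ?_⟩
      · simp only [hPf, hQg, ContinuousMap.add_apply]
      · simp only [add_mul]
        rw [integral_add hPi hQi, hP0, hQ0, add_zero]
    | smul c f _ h1 =>
      obtain ⟨P, hP, hPf, hP0⟩ := h1
      refine ⟨fun y => c * P y, continuous_const.mul hP, fun y => ?_, ?_⟩
      · simp only [hPf, ContinuousMap.smul_apply, smul_eq_mul]
      · simp only [mul_assoc]
        rw [integral_const_mul, hP0, mul_zero]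
  have hcont : ∀ ψ : Plane → ℂ, Continuous ψ → ∫ y, ψ y * x y ∂μ = 0 := by
    intro ψ hψ
    rw [← norm_le_zero_iff]
    refine le_of_forall_pos_le_add fun ε hε => ?_
    rw [zero_add]
    let ψK : C(K, ℂ) := ⟨fun y => ψ y, hψ.comp continuous_subtype_val⟩
    have hψS : ψK ∈ S.topologicalClosure := hS ▸ StarSubalgebra.mem_top
    set I := ∫ y, ‖x y‖ ∂μ with hI
    have hI0 : 0 ≤ I := integral_nonneg fun _ => norm_nonneg _
    obtain ⟨p, hp, hd⟩ := Metric.mem_closure_iff.1 hψS (ε / (I + 1)) (by positivity)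
    obtain ⟨P, hPc, hPp, hP0⟩ := hpoly p hp
    have hψi : Integrable (fun y => ψ y * x y) μ := hxi.mul_of_top_right (hbd ψ hψ)
    have hPi : Integrable (fun y => P y * x y) μ := hxi.mul_of_top_right (hbd P hPc)
    have e1 : ∫ y, ψ y * x y ∂μ = ∫ y, (ψ y * x y - P y * x y) ∂μ := by
      rw [integral_sub hψi hPi, hP0, sub_zero]
    rw [e1]
    calc ‖∫ y, (ψ y * x y - P y * x y) ∂μ‖ ≤ ∫ y, ε / (I + 1) * ‖x y‖ ∂μ := by
          refine norm_integral_le_of_norm_le (hxi.norm.const_mul _) ?_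
          filter_upwards [ae_restrict_mem Metric.isOpen_ball.measurableSet] with y hy
          rw [← sub_mul, norm_mul]
          refine mul_le_mul_of_nonneg_right ?_ (norm_nonneg _)
          have hy' : y ∈ K := Metric.ball_subset_closedBall hy
          have := (ContinuousMap.dist_apply_le_dist (f := ψK) (g := p) ⟨y, hy'⟩).trans hd.le
          rw [dist_eq_norm, ← hPp] at this
          exact this
      _ = ε / (I + 1) * I := by rw [integral_const_mul]
      _ ≤ ε := by
          rw [div_mul_eq_mul_div, div_le_iff₀ (by positivity)]
          nlinarith
  refine Lp.ext ?_
  have h0 : ∀ᵐ y ∂μ, x y = 0 := by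
    refine ae_eq_zero_of_integral_contDiff_smul_eq_zero hxi.locallyIntegrable fun g hg _ => ?_
    have := hcont (fun y => (g y : ℂ)) (Complex.continuous_ofReal.comp hg.continuous)
    simpa [Complex.real_smul] using this
  filter_upwards [h0, Lp.coeFn_zero ℂ 2 μ] with y e1 e2
  rw [e1, e2]; rfl

end Rotation

/-! ### Rotationally symmetric forms are reduced by the angular modes. -/

section RotationForm

variable {r : ℝ}

/-- Rotation of vector fields on the disc. -/
def rotField (r θ : ℝ) (w : Fin 2 → L2 (Metric.ball (0 : Plane) r)) :
    Fin 2 → L2 (Metric.ball (0 : Plane) r) :=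
  ![(Real.cos θ : ℂ) • rotL2 r θ (w 0) + (Real.sin θ : ℂ) • rotL2 r θ (w 1),
    (-Real.sin θ : ℂ) • rotL2 r θ (w 0) + (Real.cos θ : ℂ) • rotL2 r θ (w 1)]

lemma continuous_rotField (θ : ℝ) : Continuous (rotField r θ) := by
  have h0 : Continuous fun w : Fin 2 → L2 (Metric.ball (0 : Plane) r) => rotL2 r θ (w 0) :=
    (rotL2 r θ).continuous.comp (continuous_apply 0)
  have h1 : Continuous fun w : Fin 2 → L2 (Metric.ball (0 : Plane) r) => rotL2 r θ (w 1) :=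
    (rotL2 r θ).continuous.comp (continuous_apply 1)
  refine continuous_pi fun j => ?_
  fin_cases j
  · exact (h0.const_smul (Real.cos θ : ℂ)).add (h1.const_smul (Real.sin θ : ℂ))
  · exact (h0.const_smul (-Real.sin θ : ℂ)).add (h1.const_smul (Real.cos θ : ℂ))

lemma sum_inner_rotField (θ : ℝ) (w w' : Fin 2 → L2 (Metric.ball (0 : Plane) r)) :
    ∑ j, ⟪w j, rotField r θ w' j⟫_ℂ = ∑ j, ⟪rotField r (-θ) w j, w' j⟫_ℂ := by
  simp only [Fin.sum_univ_two, rotField, Matrix.cons_val_zero, Matrix.cons_val_one,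
    inner_add_right, inner_add_left, inner_smul_right, inner_smul_left, inner_rotL2_right,
    Real.cos_neg, Real.sin_neg, map_neg, Complex.conj_ofReal, Complex.ofReal_neg]
  ring

/-- `rotField` is the chain rule: the derivative of φ ∘ R along e_j is that of φ at R x along R e_j.
-/
lemma rotField_mem_sobolevGraph (θ : ℝ) {u : L2 (Metric.ball (0 : Plane) r)}
    {g : Fin 2 → L2 (Metric.ball (0 : Plane) r)}
    (h : (u, g) ∈ sobolevGraph (Metric.ball (0 : Plane) r)) :
    (rotL2 r θ u, rotField r θ g) ∈ sobolevGraph (Metric.ball (0 : Plane) r) := by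
  have hcont : Continuous fun p : L2 (Metric.ball (0 : Plane) r) ×
      (Fin 2 → L2 (Metric.ball (0 : Plane) r)) => (rotL2 r θ p.1, rotField r θ p.2) :=
    ((rotL2 r θ).continuous.comp continuous_fst).prodMk
      ((continuous_rotField θ).comp continuous_snd)
  have hclosed : IsClosed {p : L2 (Metric.ball (0 : Plane) r) ×
      (Fin 2 → L2 (Metric.ball (0 : Plane) r)) |
      (rotL2 r θ p.1, rotField r θ p.2) ∈ sobolevGraph (Metric.ball (0 : Plane) r)} :=
    (Submodule.isClosed_topologicalClosure _).preimage hcont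
  have key := mem_of_mem_sobolevGraph hclosed (fun p hp => ?_) h
  · rwa [mem_ofPred_eq] at key
  obtain ⟨φ, hφ, hu, hg⟩ := mem_testGradientGraph_iff.1 hp
  refine Submodule.le_topologicalClosure _ (mem_testGradientGraph_iff.2
    ⟨fun x => φ (rotation θ x), ⟨hφ.1.comp (rotation θ).contDiff, ?_, ?_⟩, rotL2_eq_of_ae hu, ?_⟩)
  · exact hφ.2.1.comp_homeomorph (rotation θ).toHomeomorph
  · have : tsupport (fun x => φ (rotation θ x)) = rotation θ ⁻¹' tsupport φ :=
      tsupport_comp_eq_preimage φ (rotation θ).toHomeomorph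
    rw [this]
    intro x hx
    exact rotation_mem_ball.1 (hφ.2.2 hx)
  · have hd : ∀ x v, fderiv ℝ (fun x => φ (rotation θ x)) x v =
        fderiv ℝ φ (rotation θ x) (rotation θ v) := by
      intro x v
      have h1 : HasFDerivAt φ (fderiv ℝ φ (rotation θ x)) (rotation θ x) :=
        (hφ.1.differentiable (by simp) _).hasFDerivAt
      have h2 := h1.comp x (rotation θ).toContinuousLinearEquiv.hasFDerivAt
      exact congrArg (fun L => L v) h2.fderiv
    have h0 := rotL2_eq_of_ae (θ := θ) (hg 0)
    have h1 := rotL2_eq_of_ae (θ := θ) (hg 1)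
    have hs : ∀ a b : ℂ, (⇑(a • rotL2 r θ (p.2 0) + b • rotL2 r θ (p.2 1)) : Plane → ℂ) =ᵐ[
        volume.restrict (Metric.ball (0 : Plane) r)]
        fun x => a * fderiv ℝ φ (rotation θ x) (basisVec 0) +
          b * fderiv ℝ φ (rotation θ x) (basisVec 1) := by
      intro a b
      filter_upwards [h0, h1, Lp.coeFn_add (a • rotL2 r θ (p.2 0)) (b • rotL2 r θ (p.2 1)),
        Lp.coeFn_smul a (rotL2 r θ (p.2 0)), Lp.coeFn_smul b (rotL2 r θ (p.2 1))]
        with x e0 e1 e2 e3 e4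
      rw [e2, Pi.add_apply, e3, e4, Pi.smul_apply, Pi.smul_apply, e0, e1, smul_eq_mul, smul_eq_mul]
    intro j
    fin_cases j
    · refine (hs _ _).trans (ae_of_all _ fun x => ?_)
      simp only [hd, Fin.zero_eta, rotation_basisVec_zero, map_add, map_smul, Complex.real_smul]
    · refine (hs _ _).trans (ae_of_all _ fun x => ?_)
      simp only [hd, Fin.mk_one, rotation_basisVec_one, map_add, map_smul, Complex.real_smul,
        Complex.ofReal_neg]

variable {A : Plane → Plane} {v : Plane → ℂ}

lemma rotL2_mulL2 {f f' : Plane → ℂ}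
    (hf : MemLp f ∞ (volume.restrict (Metric.ball (0 : Plane) r)))
    (θ : ℝ) (hff' : ∀ x ∈ Metric.ball (0 : Plane) r, f (rotation θ x) = f' x)
    (u : L2 (Metric.ball (0 : Plane) r)) :
    rotL2 r θ (mulL2 hf u) =ᵐ[volume.restrict (Metric.ball (0 : Plane) r)]
      fun x => f' x * rotL2 r θ u x := by
  filter_upwards [rotL2_eq_of_ae (θ := θ) (coeFn_mulL2 hf u), coeFn_rotL2 θ u,
    ae_restrict_mem Metric.isOpen_ball.measurableSet] with x e1 e2 e3
  rw [e1, e2, hff' x e3]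

/-- By equivariance A(R x) = R A(x), and the matrix in `rotField` is the inverse rotation, so the
rotated field A u is again A times the rotated u. -/
lemma rotField_mem_magneticGraph (hA : BoundedField (Metric.ball (0 : Plane) r) A)
    (hrot : ∀ θ, ∀ x ∈ Metric.ball (0 : Plane) r, A (rotation θ x) = rotation θ (A x)) (θ : ℝ)
    {u : L2 (Metric.ball (0 : Plane) r)} {w : Fin 2 → L2 (Metric.ball (0 : Plane) r)}
    (h : (u, w) ∈ magneticGraph (Metric.ball (0 : Plane) r) A) :
    (rotL2 r θ u, rotField r θ w) ∈ magneticGraph (Metric.ball (0 : Plane) r) A := by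
  obtain ⟨g, hg, hw⟩ := (mem_magneticGraph_iff hA).1 h
  refine ⟨rotField r θ g, rotField_mem_sobolevGraph θ hg, ?_⟩
  have hs : ∀ a b : ℂ, (⇑(a • rotL2 r θ (w 0) + b • rotL2 r θ (w 1)) : Plane → ℂ) =ᵐ[
      volume.restrict (Metric.ball (0 : Plane) r)]
      fun x => Complex.I * (a • rotL2 r θ (g 0) + b • rotL2 r θ (g 1) :
        L2 (Metric.ball (0 : Plane) r)) x + (a * (rotation θ (A x) 0 : ℝ) +
          b * (rotation θ (A x) 1 : ℝ)) * rotL2 r θ u x := by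
    intro a b
    have hwj : ∀ j, (⇑(rotL2 r θ (w j)) : Plane → ℂ) =ᵐ[
        volume.restrict (Metric.ball (0 : Plane) r)] fun x =>
          Complex.I * rotL2 r θ (g j) x + (rotation θ (A x) j : ℝ) * rotL2 r θ u x := by
      intro j
      rw [hw j, map_add, map_smul]
      filter_upwards [Lp.coeFn_add (Complex.I • rotL2 r θ (g j)) (rotL2 r θ (mulL2 (hA j) u)),
        Lp.coeFn_smul Complex.I (rotL2 r θ (g j)), rotL2_mulL2 (hA j) θ
          (f' := fun x => (rotation θ (A x) j : ℝ)) (fun x hx => by rw [hrot θ x hx]) u]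
        with x e1 e2 e3
      rw [e1, Pi.add_apply, e2, e3, Pi.smul_apply, smul_eq_mul]
    filter_upwards [hwj 0, hwj 1, Lp.coeFn_add (a • rotL2 r θ (w 0)) (b • rotL2 r θ (w 1)),
      Lp.coeFn_smul a (rotL2 r θ (w 0)), Lp.coeFn_smul b (rotL2 r θ (w 1)),
      Lp.coeFn_add (a • rotL2 r θ (g 0)) (b • rotL2 r θ (g 1)),
      Lp.coeFn_smul a (rotL2 r θ (g 0)), Lp.coeFn_smul b (rotL2 r θ (g 1))]
      with x e0 e1 e2 e3 e4 e5 e6 e7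
    rw [e2, e5, Pi.add_apply, Pi.add_apply, e3, e4, e6, e7]
    simp only [Pi.smul_apply, smul_eq_mul, e0, e1]
    ring
  intro j
  fin_cases j
  · refine (hs _ _).trans (ae_of_all _ fun x => ?_)
    simp only [Fin.zero_eta, rotField, Matrix.cons_val_zero, rotation_apply_zero,
      rotation_apply_one]
    push_cast
    linear_combination (A x 0 * rotL2 r θ u x : ℂ) * Complex.cos_sq_add_sin_sq θ
  · refine (hs _ _).trans (ae_of_all _ fun x => ?_)
    simp only [Fin.mk_one, rotField, Matrix.cons_val_one, rotation_apply_zero,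
      rotation_apply_one]
    push_cast
    linear_combination (A x 1 * rotL2 r θ u x : ℂ) * Complex.cos_sq_add_sin_sq θ

/-- Rotation of elements of a rotationally symmetric form domain. -/
def rotForm (hA : BoundedField (Metric.ball (0 : Plane) r) A)
    (hv : MemLp v ∞ (volume.restrict (Metric.ball (0 : Plane) r)))
    (hrot : ∀ θ, ∀ x ∈ Metric.ball (0 : Plane) r, A (rotation θ x) = rotation θ (A x)) (θ : ℝ)
    (q : formSpace hA hv) : formSpace hA hv :=
  formElement hA hv (rotField_mem_magneticGraph hA hrot θ ((mem_formSpace_iff hA hv).1 q.2).1)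

lemma inner_rotForm (hA : BoundedField (Metric.ball (0 : Plane) r) A)
    (hv : MemLp v ∞ (volume.restrict (Metric.ball (0 : Plane) r)))
    (hrot : ∀ θ, ∀ x ∈ Metric.ball (0 : Plane) r, A (rotation θ x) = rotation θ (A x))
    (hvrot : ∀ θ, ∀ x ∈ Metric.ball (0 : Plane) r, v (rotation θ x) = v x) (θ : ℝ)
    (p q : formSpace hA hv) :
    ⟪p, rotForm hA hv hrot θ q⟫_ℂ = ⟪rotForm hA hv hrot (-θ) p, q⟫_ℂ := by
  have hcomm : ∀ u, mulL2 hv (rotL2 r θ u) = rotL2 r θ (mulL2 hv u) := fun u =>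
    ((eq_mulL2_iff hv _ _).2 (rotL2_mulL2 hv θ (hvrot θ) u)).symm
  have h1 := (mem_formSpace_iff hA hv).1 p.2
  have h2 := (mem_formSpace_iff hA hv).1 q.2
  have hcomm' : ∀ u, mulL2 hv (rotL2 r (-θ) u) = rotL2 r (-θ) (mulL2 hv u) := fun u =>
    ((eq_mulL2_iff hv _ _).2 (rotL2_mulL2 hv (-θ) (hvrot (-θ)) u)).symm
  rw [rotForm, rotForm, ← inner_conj_symm p, inner_formElement, inner_formElement, map_add,
    map_add, map_sum, hcomm, hcomm']
  simp only [inner_conj_symm]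
  rw [inner_rotL2_right, inner_rotL2_right, sum_inner_rotField]

lemma formEmbedding_rotForm (hA : BoundedField (Metric.ball (0 : Plane) r) A)
    (hv : MemLp v ∞ (volume.restrict (Metric.ball (0 : Plane) r)))
    (hrot : ∀ θ, ∀ x ∈ Metric.ball (0 : Plane) r, A (rotation θ x) = rotation θ (A x)) (θ : ℝ)
    (q : formSpace hA hv) :
    formEmbedding hA hv (rotForm hA hv hrot θ q) = rotL2 r θ (formEmbedding hA hv q) := rfl

/-- Rotations are unitary on the form domain and on L², and the embedding intertwines them. So does
its adjoint, whence J J† commutes with rotations. -/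
lemma rotForm_adjoint (hA : BoundedField (Metric.ball (0 : Plane) r) A)
    (hv : MemLp v ∞ (volume.restrict (Metric.ball (0 : Plane) r)))
    (hrot : ∀ θ, ∀ x ∈ Metric.ball (0 : Plane) r, A (rotation θ x) = rotation θ (A x))
    (hvrot : ∀ θ, ∀ x ∈ Metric.ball (0 : Plane) r, v (rotation θ x) = v x) (θ : ℝ)
    (x : L2 (Metric.ball (0 : Plane) r)) :
    rotForm hA hv hrot θ ((formEmbedding hA hv).adjoint x) =
      (formEmbedding hA hv).adjoint (rotL2 r θ x) := by
  refine ext_inner_left ℂ fun p => ?_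
  rw [inner_rotForm hA hv hrot hvrot, adjoint_inner_right, adjoint_inner_right,
    formEmbedding_rotForm, inner_rotL2_right]

lemma map_mem_angularMode
    {R : L2 (Metric.ball (0 : Plane) r) →L[ℂ] L2 (Metric.ball (0 : Plane) r)}
    (hR : ∀ θ x, R (rotL2 r θ x) = rotL2 r θ (R x)) {m : ℤ} {x : L2 (Metric.ball (0 : Plane) r)}
    (hx : x ∈ angularMode r m) : R x ∈ angularMode r m := fun θ => by
  rw [← hR, mem_angularMode.1 hx θ, R.map_smul]

/-- The forms with rotationally symmetric coefficients are reduced by the angular modes. -/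
theorem reduces_angularMode (hA : BoundedField (Metric.ball (0 : Plane) r) A)
    (hv : MemLp v ∞ (volume.restrict (Metric.ball (0 : Plane) r)))
    (hrot : ∀ θ, ∀ x ∈ Metric.ball (0 : Plane) r, A (rotation θ x) = rotation θ (A x))
    (hvrot : ∀ θ, ∀ x ∈ Metric.ball (0 : Plane) r, v (rotation θ x) = v x) (m : ℤ) :
    Reduces (angularMode r m) (formEmbedding hA hv ∘L (formEmbedding hA hv).adjoint) := by
  have h : ∀ x ∈ angularMode r m,
      (formEmbedding hA hv ∘L (formEmbedding hA hv).adjoint) x ∈ angularMode r m := fun x hx =>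
    map_mem_angularMode (fun θ x => by
      rw [comp_apply, comp_apply, ← formEmbedding_rotForm hA hv hrot,
        rotForm_adjoint hA hv hrot hvrot]) hx
  exact reduces_of_mapsTo h

end RotationForm

/-! ### The angular derivative on a mode of given angular momentum. -/

section AngularDerivative

/-- The rotation by a right angle. -/
def perp (x : Plane) : Plane := rotation (Real.pi / 2) x

@[simp] lemma perp_apply_zero (x : Plane) : perp x 0 = -x 1 := by
  simp [perp, rotation_apply_zero]

@[simp] lemma perp_apply_one (x : Plane) : perp x 1 = x 0 := by
  simp [perp, rotation_apply_one]

lemma continuous_perp : Continuous perp := (rotation (Real.pi / 2)).continuous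

lemma norm_perp (x : Plane) : ‖perp x‖ = ‖x‖ := (rotation (Real.pi / 2)).norm_map x

lemma eq_smul_basisVec_add (x : Plane) : x = x 0 • basisVec 0 + x 1 • basisVec 1 := by
  ext i
  fin_cases i <;> simp [basisVec]

lemma rotation_eq (θ : ℝ) (x : Plane) : rotation θ x = Real.cos θ • x + Real.sin θ • perp x := by
  ext i
  fin_cases i
  · change rotation θ x 0 = Real.cos θ * x 0 + Real.sin θ * perp x 0
    rw [rotation_apply_zero, perp_apply_zero]; ring
  · change rotation θ x 1 = Real.cos θ * x 1 + Real.sin θ * perp x 1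
    rw [rotation_apply_one, perp_apply_one]; ring

lemma perp_rotation (θ : ℝ) (x : Plane) : perp (rotation θ x) = rotation θ (perp x) := by
  ext i
  fin_cases i
  · change perp (rotation θ x) 0 = rotation θ (perp x) 0
    simp only [rotation_apply_zero, rotation_apply_one, perp_apply_zero, perp_apply_one]; ring
  · change perp (rotation θ x) 1 = rotation θ (perp x) 1
    simp only [rotation_apply_zero, rotation_apply_one, perp_apply_zero, perp_apply_one]; ring

lemma hasDerivAt_rotation (x : Plane) (θ : ℝ) :
    HasDerivAt (fun t => rotation t x) (perp (rotation θ x)) θ := by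
  have h : HasDerivAt (fun t => Real.cos t • x + Real.sin t • perp x)
      (-Real.sin θ • x + Real.cos θ • perp x) θ :=
    ((Real.hasDerivAt_cos θ).smul_const x).add ((Real.hasDerivAt_sin θ).smul_const (perp x))
  have h2 : perp (rotation θ x) = -Real.sin θ • x + Real.cos θ • perp x := by
    ext i
    fin_cases i
    · change perp (rotation θ x) 0 = -Real.sin θ * x 0 + Real.cos θ * perp x 0
      simp only [rotation_apply_one, perp_apply_zero]; ring
    · change perp (rotation θ x) 1 = -Real.sin θ * x 1 + Real.cos θ * perp x 1
      simp only [rotation_apply_zero, perp_apply_one]; ring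
  rw [h2]
  simpa only [← rotation_eq] using h

variable {r : ℝ}

lemma MemLp.ofReal_of_continuous {Ω : Set Plane} {ψ : Plane → ℝ} (hψ : Continuous ψ)
    (hψc : HasCompactSupport ψ) : MemLp (fun x => (ψ x : ℂ)) 2 (volume.restrict Ω) :=
  MemLp.of_continuous_hasCompactSupport (Complex.continuous_ofReal.comp hψ)
    (hψc.comp_left Complex.ofReal_zero)

lemma integral_rotation_mul {m : ℤ} {u : L2 (Metric.ball (0 : Plane) r)} (hu : u ∈ angularMode r m)
    {ψ : Plane → ℝ} (hψ : Continuous ψ) (hψc : HasCompactSupport ψ) (θ : ℝ) :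
    ∫ x in Metric.ball (0 : Plane) r, (ψ (rotation θ x) : ℂ) * u x =
      Complex.exp (-(m * θ * Complex.I)) * ∫ x in Metric.ball (0 : Plane) r, (ψ x : ℂ) * u x := by
  have hm : MemLp (fun x => (ψ x : ℂ)) 2 (volume.restrict (Metric.ball (0 : Plane) r)) :=
    MemLp.ofReal_of_continuous hψ hψc
  have h1 : ⟪rotL2 r θ hm.toLp, u⟫_ℂ =
      ∫ x in Metric.ball (0 : Plane) r, (ψ (rotation θ x) : ℂ) * u x := by
    rw [L2.inner_def]
    refine integral_congr_ae ?_
    filter_upwards [rotL2_eq_of_ae (θ := θ) hm.coeFn_toLp] with x hx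
    rw [hx, RCLike.inner_apply, Complex.conj_ofReal, mul_comm]
  have h2 : ⟪hm.toLp, u⟫_ℂ = ∫ x in Metric.ball (0 : Plane) r, (ψ x : ℂ) * u x := by
    rw [L2.inner_def]
    refine integral_congr_ae ?_
    filter_upwards [hm.coeFn_toLp] with x hx
    rw [hx, RCLike.inner_apply, Complex.conj_ofReal, mul_comm]
  have h3 := inner_rotL2_right (r := r) (-θ) hm.toLp u
  rw [neg_neg, hu (-θ), inner_smul_right, h1, h2] at h3
  rw [← h3]
  congr 2
  push_cast
  ring

/-- This is the θ-derivative at 0 of ∫ ψ(R_θ x) u = e^{-imθ} ∫ ψ u. The derivative falls on ψ, so no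
regularity of `u` is needed. -/
lemma integral_fderiv_perp_mul {m : ℤ} {u : L2 (Metric.ball (0 : Plane) r)}
    (hu : u ∈ angularMode r m) {ψ : Plane → ℝ} (hψ : ContDiff ℝ ∞ ψ) (hψc : HasCompactSupport ψ) :
    ∫ x in Metric.ball (0 : Plane) r, (fderiv ℝ ψ x (perp x) : ℂ) * u x =
      -(m * Complex.I) * ∫ x in Metric.ball (0 : Plane) r, (ψ x : ℂ) * u x := by
  set μ := volume.restrict (Metric.ball (0 : Plane) r) with hμ
  have : IsFiniteMeasure μ := isFiniteMeasure_restrict.2 measure_ball_lt_top.ne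
  have hui : Integrable u μ := (Lp.memLp u).integrable one_le_two
  have hDc : Continuous (fderiv ℝ ψ) := hψ.continuous_fderiv (by simp)
  have hqc : Continuous fun x => fderiv ℝ ψ x (perp x) := hDc.clm_apply continuous_perp
  have hqs : HasCompactSupport fun x => fderiv ℝ ψ x (perp x) := by
    refine (hψc.fderiv ℝ).mono' fun x hx => subset_closure ?_
    rw [Function.mem_support] at hx ⊢
    exact fun h => hx (by rw [h]; rfl)
  obtain ⟨C, hC⟩ := hqc.bounded_above_of_compact_support hqs
  have hd := hasDerivAt_integral_of_dominated_loc_of_deriv_le (μ := μ) (𝕜 := ℝ) (x₀ := (0 : ℝ))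
    (s := univ) (F := fun θ x => (ψ (rotation θ x) : ℂ) * u x)
    (F' := fun θ x => (fderiv ℝ ψ (rotation θ x) (perp (rotation θ x)) : ℂ) * u x)
    (bound := fun x => C * ‖u x‖) univ_mem ?_ ?_ ?_ ?_ (hui.norm.const_mul C) ?_
  · have hd1 := hd.2
    have hd2 : HasDerivAt (fun θ : ℝ => Complex.exp (-(m * θ * Complex.I)) *
        ∫ x, (ψ x : ℂ) * u x ∂μ) (-(m * Complex.I) * ∫ x, (ψ x : ℂ) * u x ∂μ) 0 := by
      have e1 : HasDerivAt (fun θ : ℝ => -((m : ℂ) * (θ : ℂ) * Complex.I)) (-(m * Complex.I)) 0 := by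
        have := ((Complex.ofRealCLM.hasDerivAt (x := (0 : ℝ))).const_mul (m : ℂ)).mul_const Complex.I
        refine (this.neg.congr_deriv ?_).congr_of_eventuallyEq (Eventually.of_forall fun θ => rfl)
        simp
      have e2 := e1.cexp.mul_const (∫ x, (ψ x : ℂ) * u x ∂μ)
      simpa using e2
    have heq : (fun θ : ℝ => ∫ x, (ψ (rotation θ x) : ℂ) * u x ∂μ) =
        fun θ : ℝ => Complex.exp (-(m * θ * Complex.I)) * ∫ x, (ψ x : ℂ) * u x ∂μ :=
      funext fun θ => integral_rotation_mul hu hψ.continuous hψc θ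
    rw [heq] at hd1
    have h0 : ∀ x : Plane, rotation 0 x = x := fun x => by rw [rotation_eq]; simp
    have := hd1.unique hd2
    simpa only [h0] using this
  · exact Eventually.of_forall fun θ => ((Complex.continuous_ofReal.comp (hψ.continuous.comp
      (rotation θ).continuous)).aestronglyMeasurable).mul hui.aestronglyMeasurable
  · refine hui.mul_of_top_right ?_
    obtain ⟨C', hC'⟩ := hψ.continuous.bounded_above_of_compact_support hψc
    refine memLp_top_of_bound (Complex.continuous_ofReal.comp (hψ.continuous.comp
      (rotation 0).continuous)).aestronglyMeasurable C' (ae_of_all _ fun x => ?_)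
    simpa using hC' (rotation 0 x)
  · exact ((Complex.continuous_ofReal.comp (hqc.comp
      (rotation 0).continuous)).aestronglyMeasurable).mul hui.aestronglyMeasurable
  · refine ae_of_all _ fun x θ _ => ?_
    rw [norm_mul, Complex.norm_real]
    exact mul_le_mul_of_nonneg_right (hC _) (norm_nonneg _)
  · refine ae_of_all _ fun x θ _ => ?_
    have h1 : HasFDerivAt ψ (fderiv ℝ ψ (rotation θ x)) (rotation θ x) :=
      (hψ.differentiable (by simp) _).hasFDerivAt
    exact ((h1.comp_hasDerivAt θ (hasDerivAt_rotation x θ)).ofReal_comp).mul_const _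

lemma hasFDerivAt_coord (j : Fin 2) (x : Plane) :
    HasFDerivAt (fun y : Plane => y j) (EuclideanSpace.proj j : Plane →L[ℝ] ℝ) x :=
  (EuclideanSpace.proj j : Plane →L[ℝ] ℝ).hasFDerivAt

lemma contDiff_coord (n : WithTop ℕ∞) (j : Fin 2) : ContDiff ℝ n fun y : Plane => y j :=
  (EuclideanSpace.proj j : Plane →L[ℝ] ℝ).contDiff

/-- The angular derivative of a function of angular momentum `m`. -/
theorem angular_derivative_eq {m : ℤ} {u : L2 (Metric.ball (0 : Plane) r)}
    (hu : u ∈ angularMode r m) {g : Fin 2 → L2 (Metric.ball (0 : Plane) r)}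
    (h : (u, g) ∈ sobolevGraph (Metric.ball (0 : Plane) r)) :
    ∀ᵐ x ∂volume.restrict (Metric.ball (0 : Plane) r),
      (x 0 : ℂ) * g 1 x - x 1 * g 0 x = m * Complex.I * u x := by
  set μ := volume.restrict (Metric.ball (0 : Plane) r) with hμ
  have : IsFiniteMeasure μ := isFiniteMeasure_restrict.2 measure_ball_lt_top.ne
  have hLi : ∀ f : L2 (Metric.ball (0 : Plane) r), Integrable f μ := fun f =>
    (Lp.memLp f).integrable one_le_two
  have hbdd : ∀ j : Fin 2, MemLp (fun x : Plane => (x j : ℂ)) ∞ μ := by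
    intro j
    refine memLp_top_of_bound (Complex.continuous_ofReal.comp
      (contDiff_coord 0 j).continuous).aestronglyMeasurable r ?_
    filter_upwards [ae_restrict_mem Metric.isOpen_ball.measurableSet] with x hx
    rw [Complex.norm_real]
    exact (PiLp.norm_apply_le x j).trans (mem_ball_zero_iff.1 hx).le
  have hmul : ∀ {f : Plane → ℂ}, MemLp f ∞ μ → ∀ v : L2 (Metric.ball (0 : Plane) r),
      Integrable (fun x => f x * v x) μ := fun hf v => (hLi v).mul_of_top_right hf
  have hi0 : Integrable (fun x => (x 1 : ℂ) * g 0 x) μ := (hLi _).mul_of_top_right (hbdd 1)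
  have hi1 : Integrable (fun x => (x 0 : ℂ) * g 1 x) μ := (hLi _).mul_of_top_right (hbdd 0)
  have hi2 : Integrable (fun x => (m * Complex.I) * u x) μ := (hLi u).const_mul _
  have hfin : ∀ᵐ x ∂μ, (x 0 : ℂ) * g 1 x - x 1 * g 0 x - m * Complex.I * u x = 0 := by
    refine ae_eq_zero_of_integral_contDiff_smul_eq_zero ((hi1.sub hi0).sub hi2).locallyIntegrable
      fun ψ hψ hψc => ?_
    have hψb : MemLp (fun x => (ψ x : ℂ)) ∞ μ := by
      obtain ⟨C', hC'⟩ := hψ.continuous.bounded_above_of_compact_support hψc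
      refine memLp_top_of_bound (Complex.continuous_ofReal.comp
        hψ.continuous).aestronglyMeasurable C' (ae_of_all _ fun x => ?_)
      simpa using hC' x
    have hx : ∀ j : Fin 2, ContDiff ℝ ∞ fun x : Plane => x j * ψ x := fun j =>
      (contDiff_coord _ j).mul hψ
    have hxd : ∀ (j k : Fin 2) (x : Plane), fderiv ℝ (fun x : Plane => x j * ψ x) x (basisVec k) =
        x j * fderiv ℝ ψ x (basisVec k) + ψ x * basisVec k j := by
      intro j k x
      have := (hasFDerivAt_coord j x).mul (hψ.differentiable (by simp) x).hasFDerivAt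
      exact congrArg (fun L => L (basisVec k)) this.fderiv
    have hψd : ∀ x : Plane, fderiv ℝ ψ x (perp x) =
        x 0 * fderiv ℝ ψ x (basisVec 1) - x 1 * fderiv ℝ ψ x (basisVec 0) := by
      intro x
      rw [eq_smul_basisVec_add (perp x), map_add, map_smul, map_smul]
      simp only [perp_apply_zero, perp_apply_one, smul_eq_mul]
      ring
    have k0 := integral_mul_eq_neg_of_mem_sobolevGraph (hx 1) hψc.mul_left h 0
    have k1 := integral_mul_eq_neg_of_mem_sobolevGraph (hx 0) hψc.mul_left h 1
    have k2 := integral_fderiv_perp_mul hu hψ hψc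
    have hDb : ∀ k j : Fin 2, MemLp (fun x => (fderiv ℝ (fun x : Plane => x j * ψ x) x
        (basisVec k) : ℂ)) ∞ μ := by
      intro k j
      have hc : Continuous fun x => fderiv ℝ (fun x : Plane => x j * ψ x) x (basisVec k) :=
        ((hx j).continuous_fderiv (by simp)).clm_apply continuous_const
      have hs : HasCompactSupport fun x : Plane => x j * ψ x := hψc.mul_left
      obtain ⟨C', hC'⟩ := hc.bounded_above_of_compact_support (hs.fderiv_apply ℝ _)
      refine memLp_top_of_bound (Complex.continuous_ofReal.comp hc).aestronglyMeasurable C'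
        (ae_of_all _ fun x => ?_)
      simpa using hC' x
    -- Moving the coordinates inside the derivatives costs nothing: ∂₁(x₀ψ) and ∂₀(x₁ψ) produce no
    -- zero-order terms.
    have k3 : ∫ x, (fderiv ℝ ψ x (perp x) : ℂ) * u x ∂μ =
        ∫ x, (fderiv ℝ (fun x : Plane => x 0 * ψ x) x (basisVec 1) : ℂ) * u x ∂μ -
        ∫ x, (fderiv ℝ (fun x : Plane => x 1 * ψ x) x (basisVec 0) : ℂ) * u x ∂μ := by
      rw [← integral_sub (hmul (hDb 1 0) u) (hmul (hDb 0 1) u)]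
      refine integral_congr_ae (ae_of_all _ fun x => ?_)
      simp only [hxd, hψd]
      simp [basisVec]
      ring
    have e : (fun x => ψ x • ((x 0 : ℂ) * g 1 x - x 1 * g 0 x - m * Complex.I * u x)) =
        fun x => ((x 0 * ψ x : ℝ) : ℂ) * g 1 x - ((x 1 * ψ x : ℝ) : ℂ) * g 0 x -
          (m * Complex.I) * ((ψ x : ℂ) * u x) := by
      funext x
      rw [Complex.real_smul]
      push_cast
      ring
    have hj1 : Integrable (fun x => ((x 0 * ψ x : ℝ) : ℂ) * g 1 x) μ := by
      refine (hi1.mul_of_top_right hψb).congr (ae_of_all _ fun x => ?_)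
      simp only [Pi.mul_apply]
      push_cast
      ring
    have hj0 : Integrable (fun x => ((x 1 * ψ x : ℝ) : ℂ) * g 0 x) μ := by
      refine (hi0.mul_of_top_right hψb).congr (ae_of_all _ fun x => ?_)
      simp only [Pi.mul_apply]
      push_cast
      ring
    have hj : Integrable (fun x => ((x 0 * ψ x : ℝ) : ℂ) * g 1 x -
      ((x 1 * ψ x : ℝ) : ℂ) * g 0 x) μ := hj1.sub hj0
    rw [e, integral_sub hj ((hmul hψb u).const_mul _),
      integral_sub hj1 hj0, integral_const_mul, k0, k1]
    linear_combination (-1 : ℂ) * k2 + k3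
  filter_upwards [hfin] with x hx
  linear_combination hx

end AngularDerivative

/-! ### The phases e^{±iNθ} and their regularisation at the origin. -/

section Phase

/-- Dominated convergence in `L²`. -/
lemma tendsto_L2_of_dominated {Ω : Set Plane} {F : ℕ → L2 Ω} {f : L2 Ω} {G : Plane → ℝ}
    (hG : MemLp G 2 (volume.restrict Ω))
    (hF : ∀ n, ∀ᵐ x ∂volume.restrict Ω, ‖F n x‖ ≤ G x) (hf : ∀ᵐ x ∂volume.restrict Ω, ‖f x‖ ≤ G x)
    (hlim : ∀ᵐ x ∂volume.restrict Ω, Tendsto (fun n => F n x) atTop (𝓝 (f x))) :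
    Tendsto F atTop (𝓝 f) := by
  rw [tendsto_iff_norm_sub_tendsto_zero]
  have hm : ∀ u : L2 Ω, AEMeasurable (fun x => u x) (volume.restrict Ω) := fun u =>
    (Lp.aestronglyMeasurable u).aemeasurable
  have hfin : ∫⁻ x in Ω, (2 * ‖G x‖ₑ) ^ 2 ≠ ⊤ := by
    have h2 := hG.eLpNorm_lt_top
    rw [eLpNorm_lt_top_iff_lintegral_rpow_enorm_lt_top two_ne_zero ENNReal.ofNat_ne_top] at h2
    simp only [ENNReal.toReal_ofNat, ENNReal.rpow_ofNat] at h2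
    simp_rw [mul_pow]
    rw [lintegral_const_mul' _ _ (by simp)]
    exact ENNReal.mul_ne_top (by simp) h2.ne
  have h := tendsto_lintegral_of_dominated_convergence' (μ := volume.restrict Ω)
    (F := fun n x => ‖F n x - f x‖ₑ ^ 2) (f := fun _ => 0) (fun x => (2 * ‖G x‖ₑ) ^ 2)
    (fun n => (((hm _).sub (hm _)).enorm).pow_const 2) (fun n => ?_) hfin ?_
  · rw [lintegral_zero] at h
    have h3 : Tendsto (fun n => ‖F n - f‖ₑ ^ 2) atTop (𝓝 0) := by
      refine h.congr fun n => ?_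
      rw [enorm_sq_eq_lintegral]
      refine lintegral_congr_ae ?_
      filter_upwards [Lp.coeFn_sub (F n) f] with x hx
      rw [hx, Pi.sub_apply]
    have h4 : Tendsto (fun n => ‖F n - f‖ ^ 2) atTop (𝓝 0) := by
      have := (ENNReal.tendsto_toReal ENNReal.zero_ne_top).comp h3
      simpa [Function.comp_def] using this
    have h5 := (Real.continuous_sqrt.tendsto 0).comp h4
    simpa [Function.comp_def] using h5
  · filter_upwards [hF n, hf] with x h1 h2
    refine pow_le_pow_left' ((enorm_sub_le).trans ?_) 2
    rw [two_mul]
    refine add_le_add ?_ ?_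
    · exact enorm_le_iff_norm_le.2 (h1.trans (le_abs_self _))
    · exact enorm_le_iff_norm_le.2 (h2.trans (le_abs_self _))
  · filter_upwards [hlim] with x hx
    have h1 : Tendsto (fun n => F n x - f x) atTop (𝓝 0) := by
      simpa using hx.sub_const (f x)
    have h1' := h1.enorm
    rw [enorm_zero] at h1'
    have h2 := ((ENNReal.continuous_pow 2).tendsto 0).comp h1'
    simpa [Function.comp_def] using h2

/-- The coordinate `x₀ + i σ x₁`. -/
def signedCoord (σ : ℝ) (x : Plane) : ℂ := x 0 + σ * x 1 * Complex.I

lemma contDiff_signedCoord (σ : ℝ) (n : WithTop ℕ∞) : ContDiff ℝ n (signedCoord σ) :=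
  (Complex.ofRealCLM.contDiff.comp (contDiff_coord n 0)).add
    ((contDiff_const.mul (Complex.ofRealCLM.contDiff.comp (contDiff_coord n 1))).mul contDiff_const)

lemma norm_sq_plane (x : Plane) : ‖x‖ ^ 2 = x 0 ^ 2 + x 1 ^ 2 := by
  rw [EuclideanSpace.norm_sq_eq, Fin.sum_univ_two]
  simp only [Real.norm_eq_abs, sq_abs]

variable {σ : ℝ}

lemma norm_signedCoord (hσ : σ ^ 2 = 1) (x : Plane) : ‖signedCoord σ x‖ = ‖x‖ := by
  refine (sq_eq_sq₀ (norm_nonneg _) (norm_nonneg _)).1 ?_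
  have : signedCoord σ x = ⟨x 0, σ * x 1⟩ := by
    rw [signedCoord, Complex.mk_eq_add_mul_I]; push_cast; ring
  rw [norm_sq_plane, ← Complex.normSq_eq_norm_sq, this, Complex.normSq_apply]
  linear_combination x 1 ^ 2 * hσ

lemma signedCoord_rotation (hσ : σ ^ 2 = 1) (θ : ℝ) (x : Plane) :
    signedCoord σ (rotation θ x) = Complex.exp (σ * θ * Complex.I) * signedCoord σ x := by
  have hs : Real.sin (σ * θ) = σ * Real.sin θ ∧ Real.cos (σ * θ) = Real.cos θ := by
    rcases mul_self_eq_one_iff.1 (show σ * σ = 1 by rw [← sq, hσ]) with h | h <;> simp [h]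
  have hσC : (σ : ℂ) ^ 2 = 1 := by exact_mod_cast hσ
  have he : Complex.exp (σ * θ * Complex.I) = Real.cos θ + σ * Real.sin θ * Complex.I := by
    rw [← Complex.ofReal_mul, Complex.exp_mul_I, ← Complex.ofReal_cos, ← Complex.ofReal_sin, hs.1,
      hs.2]
    push_cast
    ring
  rw [he, signedCoord, signedCoord, rotation_apply_zero, rotation_apply_one]
  push_cast
  linear_combination (-(Complex.sin θ * x 1)) * ((σ : ℂ) ^ 2 * Complex.I_sq - hσC)

/-- The regularised phase `((x₀ + i σ x₁) / √(|x|² + ε²)) ^ N`. -/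
def phase (σ : ℝ) (N : ℕ) (ε : ℝ) (x : Plane) : ℂ :=
  (signedCoord σ x / (Real.sqrt (‖x‖ ^ 2 + ε ^ 2) : ℝ)) ^ N

/-- The partial derivatives of the regularised phase. -/
def phaseDeriv (σ : ℝ) (N : ℕ) (ε : ℝ) (j : Fin 2) (x : Plane) : ℂ :=
  N * (signedCoord σ x / (Real.sqrt (‖x‖ ^ 2 + ε ^ 2) : ℝ)) ^ (N - 1) *
    (signedCoord σ (basisVec j) / (Real.sqrt (‖x‖ ^ 2 + ε ^ 2) : ℝ) -
      signedCoord σ x * x j / (Real.sqrt (‖x‖ ^ 2 + ε ^ 2) : ℝ) ^ 3)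

lemma contDiff_phase (σ : ℝ) (N : ℕ) {ε : ℝ} (hε : ε ≠ 0) : ContDiff ℝ 1 (phase σ N ε) := by
  have hpos : ∀ x : Plane, 0 < ‖x‖ ^ 2 + ε ^ 2 := fun x => by positivity
  have h1 : ContDiff ℝ 1 fun x : Plane => Real.sqrt (‖x‖ ^ 2 + ε ^ 2) :=
    ((contDiff_norm_sq ℝ).add contDiff_const).sqrt fun x => (hpos x).ne'
  have h2 : ContDiff ℝ 1 fun x : Plane =>
      signedCoord σ x * ((Real.sqrt (‖x‖ ^ 2 + ε ^ 2) : ℝ) : ℂ)⁻¹ :=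
    (contDiff_signedCoord σ 1).mul ((Complex.ofRealCLM.contDiff.comp h1).inv fun x => ?_)
  · simp only [← div_eq_mul_inv] at h2
    exact h2.pow N
  simpa using (Real.sqrt_pos.2 (hpos x)).ne'

lemma fderiv_phase (σ : ℝ) (N : ℕ) {ε : ℝ} (hε : ε ≠ 0) (j : Fin 2) (x : Plane) :
    fderiv ℝ (phase σ N ε) x (basisVec j) = phaseDeriv σ N ε j x := by
  have hpos : 0 < ‖x‖ ^ 2 + ε ^ 2 := by positivity
  have hsq := (Real.sqrt_pos.2 hpos).ne'
  have h1 : HasFDerivAt (phase σ N ε) (fderiv ℝ (phase σ N ε) x) x :=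
    ((contDiff_phase σ N hε).differentiable one_ne_zero x).hasFDerivAt
  have hl : HasDerivAt (fun t : ℝ => x + t • basisVec j) (basisVec j) 0 := by
    simpa using ((hasDerivAt_id (0 : ℝ)).smul_const (basisVec j)).const_add x
  have h1' : HasFDerivAt (phase σ N ε) (fderiv ℝ (phase σ N ε) x) (x + (0 : ℝ) • basisVec j) := by
    simpa using h1
  have h2 := h1'.comp_hasDerivAt (0 : ℝ) hl
  refine h2.unique ?_
  have hw : HasDerivAt (fun t : ℝ => signedCoord σ (x + t • basisVec j))
      (signedCoord σ (basisVec j)) 0 := by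
    have e : (fun t : ℝ => signedCoord σ (x + t • basisVec j)) =
        fun t : ℝ => signedCoord σ x + (t : ℂ) * signedCoord σ (basisVec j) := by
      funext t
      simp only [signedCoord, PiLp.add_apply, PiLp.smul_apply, smul_eq_mul]
      push_cast
      ring
    rw [e]
    simpa using ((Complex.ofRealCLM.hasDerivAt (x := (0 : ℝ))).mul_const
      (signedCoord σ (basisVec j))).const_add (signedCoord σ x)
  have hn : HasDerivAt (fun t : ℝ => ‖x + t • basisVec j‖ ^ 2 + ε ^ 2) (2 * x j) 0 := by
    have h3 := hl.norm_sq
    have h4 : ⟪x + (0 : ℝ) • basisVec j, basisVec j⟫_ℝ = x j := by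
      simp [basisVec, EuclideanSpace.inner_single_right]
    rw [h4] at h3
    exact h3.add_const _
  have hs : HasDerivAt (fun t : ℝ => Real.sqrt (‖x + t • basisVec j‖ ^ 2 + ε ^ 2))
      (x j / Real.sqrt (‖x‖ ^ 2 + ε ^ 2)) 0 := by
    have h5 := hn.sqrt (by simpa using hpos.ne')
    convert h5 using 1
    simp only [zero_smul, add_zero]
    field_simp
  have hq := ((hw.div hs.ofReal_comp (by simpa using hsq)).pow N)
  refine hq.congr_deriv ?_
  have hsqC : ((Real.sqrt (‖x‖ ^ 2 + ε ^ 2) : ℝ) : ℂ) ≠ 0 := by exact_mod_cast hsq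
  simp only [zero_smul, add_zero, phaseDeriv, Pi.div_apply]
  congr 1
  push_cast
  field_simp

lemma BoundedC1.of_contDiff {η : Plane → ℂ} (hη : ContDiff ℝ 1 η) (r : ℝ) :
    BoundedC1 (Metric.ball (0 : Plane) r) η := by
  have hbd : ∀ f : Plane → ℂ, Continuous f →
      MemLp f ∞ (volume.restrict (Metric.ball (0 : Plane) r)) := fun f hf => by
    obtain ⟨C, hC⟩ := (isCompact_closedBall (0 : Plane) r).exists_bound_of_continuousOn
      hf.continuousOn
    refine memLp_top_of_bound hf.aestronglyMeasurable C ?_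
    filter_upwards [ae_restrict_mem Metric.isOpen_ball.measurableSet] with y hy
    exact hC y (Metric.ball_subset_closedBall hy)
  exact ⟨hη.contDiffOn, hbd _ hη.continuous,
    fun j => hbd _ ((hη.continuous_fderiv one_ne_zero).clm_apply continuous_const)⟩

lemma norm_le_sqrt (x : Plane) (ε : ℝ) : ‖x‖ ≤ Real.sqrt (‖x‖ ^ 2 + ε ^ 2) :=
  Real.le_sqrt_of_sq_le (by nlinarith [sq_nonneg ε])

lemma norm_div_sqrt_le (hσ : σ ^ 2 = 1) (ε : ℝ) (x : Plane) :
    ‖signedCoord σ x / (Real.sqrt (‖x‖ ^ 2 + ε ^ 2) : ℝ)‖ ≤ 1 := by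
  rw [norm_div, norm_signedCoord hσ, Complex.norm_real, Real.norm_of_nonneg (Real.sqrt_nonneg _)]
  exact div_le_one_of_le₀ (norm_le_sqrt x ε) (Real.sqrt_nonneg _)

lemma norm_phase_le (hσ : σ ^ 2 = 1) (N : ℕ) (ε : ℝ) (x : Plane) : ‖phase σ N ε x‖ ≤ 1 := by
  rw [phase, norm_pow]
  exact pow_le_one₀ (norm_nonneg _) (norm_div_sqrt_le hσ ε x)

lemma norm_phase_zero (hσ : σ ^ 2 = 1) (N : ℕ) {x : Plane} (hx : x ≠ 0) :
    ‖phase σ N 0 x‖ = 1 := by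
  have : ‖x‖ ≠ 0 := norm_ne_zero_iff.2 hx
  rw [phase, norm_pow, norm_div, norm_signedCoord hσ, Complex.norm_real]
  simp [this]

/-- The bound is uniform in ε and so serves as a majorant as ε → 0. Both terms in the derivative of
z/ρ, with ρ = √(|x|² + ε²) ≥ |x|, are at most 1/ρ. -/
lemma norm_phaseDeriv_mul_le (hσ : σ ^ 2 = 1) (N : ℕ) (ε : ℝ) (j : Fin 2) {x : Plane} :
    ‖phaseDeriv σ N ε j x‖ * ‖x‖ ≤ 2 * N := by
  set ρ := Real.sqrt (‖x‖ ^ 2 + ε ^ 2) with hρ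
  have hxρ : ‖x‖ ≤ ρ := norm_le_sqrt x ε
  have hρ0 : 0 ≤ ρ := Real.sqrt_nonneg _
  have hb : ‖signedCoord σ (basisVec j)‖ = 1 := by
    rw [norm_signedCoord hσ, basisVec]; simp
  have hj : |x j| ≤ ‖x‖ := PiLp.norm_apply_le x j
  rcases hρ0.eq_or_lt with h0 | h0
  · have : ‖x‖ = 0 := le_antisymm (h0 ▸ hxρ) (norm_nonneg _)
    rw [this, mul_zero]; positivity
  have h1 : ‖signedCoord σ (basisVec j) / (ρ : ℝ) - signedCoord σ x * x j / (ρ : ℝ) ^ 3‖ ≤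
      2 / ρ := by
    refine (norm_sub_le _ _).trans ?_
    rw [norm_div, norm_div, norm_mul, hb, norm_pow, norm_signedCoord hσ, Complex.norm_real,
      Complex.norm_real, Real.norm_of_nonneg hρ0, Real.norm_eq_abs]
    have h2 : ‖x‖ * |x j| / ρ ^ 3 ≤ 1 / ρ := by
      rw [div_le_div_iff₀ (by positivity) h0]
      have : ‖x‖ * |x j| ≤ ρ * ρ := mul_le_mul hxρ (hj.trans hxρ) (abs_nonneg _) hρ0
      nlinarith
    calc 1 / ρ + ‖x‖ * |x j| / ρ ^ 3 ≤ 1 / ρ + 1 / ρ := by linarith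
      _ = 2 / ρ := by ring
  rw [phaseDeriv, ← hρ, norm_mul, norm_mul, norm_pow, Complex.norm_natCast]
  have h3 := pow_le_one₀ (n := N - 1) (norm_nonneg _) (norm_div_sqrt_le hσ ε x)
  rw [← hρ] at h3
  calc _ ≤ (N : ℝ) * 1 * (2 / ρ) * ρ := by gcongr
    _ = 2 * N := by field_simp

/-- At ε = 0 the phase is e^{iσNθ}, whose logarithmic gradient is iσN ∇θ with ∇θ = x^⊥/|x|². -/
lemma phaseDeriv_zero (hσ : σ ^ 2 = 1) (N : ℕ) (j : Fin 2) {x : Plane} (hx : x ≠ 0) :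
    phaseDeriv σ N 0 j x = phase σ N 0 x * (Complex.I * (σ * N) * perp x j / ‖x‖ ^ 2) := by
  have hx0 : ‖x‖ ≠ 0 := norm_ne_zero_iff.2 hx
  have hxC : (‖x‖ : ℂ) ≠ 0 := by exact_mod_cast hx0
  have hn : (‖x‖ : ℂ) ^ 2 = (x 0 : ℂ) ^ 2 + (x 1 : ℂ) ^ 2 := by exact_mod_cast norm_sq_plane x
  have hσC : (σ : ℂ) ^ 2 = 1 := by exact_mod_cast hσ
  have key : signedCoord σ (basisVec j) * (‖x‖ : ℂ) ^ 2 - signedCoord σ x * x j =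
      Complex.I * σ * perp x j * signedCoord σ x := by
    rw [hn]
    fin_cases j
    · simp [signedCoord, basisVec]
      linear_combination (x 1 : ℂ) ^ 2 * ((σ : ℂ) ^ 2 * Complex.I_sq - hσC)
    · simp [signedCoord, basisVec]
      linear_combination (-(x 0 : ℂ) * x 1) * ((σ : ℂ) ^ 2 * Complex.I_sq - hσC)
  rcases N with _ | N
  · simp [phaseDeriv]
  · simp only [phaseDeriv, phase, ne_eq, OfNat.ofNat_ne_zero, not_false_eq_true, zero_pow, add_zero,
      Real.sqrt_sq (norm_nonneg x), Nat.add_sub_cancel, pow_succ _ N]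
    have e : signedCoord σ (basisVec j) / (‖x‖ : ℂ) - signedCoord σ x * x j / (‖x‖ : ℂ) ^ 3 =
        (Complex.I * σ * perp x j * signedCoord σ x) / (‖x‖ : ℂ) ^ 3 := by
      rw [← key]; field_simp
    rw [e]
    field_simp

lemma tendsto_phase (σ : ℝ) (N : ℕ) {x : Plane} (hx : x ≠ 0) :
    Tendsto (fun ε => phase σ N ε x) (𝓝 0) (𝓝 (phase σ N 0 x)) := by
  have hs : ((Real.sqrt (‖x‖ ^ 2 + (0 : ℝ) ^ 2) : ℝ) : ℂ) ≠ 0 := by simp [hx]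
  have h1 : ContinuousAt (fun ε : ℝ => ((Real.sqrt (‖x‖ ^ 2 + ε ^ 2) : ℝ) : ℂ)) 0 := by fun_prop
  exact (continuousAt_const.div h1 hs).pow N

lemma tendsto_phaseDeriv (σ : ℝ) (N : ℕ) (j : Fin 2) {x : Plane} (hx : x ≠ 0) :
    Tendsto (fun ε => phaseDeriv σ N ε j x) (𝓝 0) (𝓝 (phaseDeriv σ N 0 j x)) := by
  have hs : ((Real.sqrt (‖x‖ ^ 2 + (0 : ℝ) ^ 2) : ℝ) : ℂ) ≠ 0 := by simp [hx]
  have h1 : ContinuousAt (fun ε : ℝ => ((Real.sqrt (‖x‖ ^ 2 + ε ^ 2) : ℝ) : ℂ)) 0 := by fun_prop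
  exact (continuousAt_const.mul ((continuousAt_const.div h1 hs).pow (N - 1))).mul
    ((continuousAt_const.div h1 hs).sub (continuousAt_const.div (h1.pow 3) (pow_ne_zero 3 hs)))

lemma phase_rotation (hσ : σ ^ 2 = 1) (N : ℕ) (ε θ : ℝ) (x : Plane) :
    phase σ N ε (rotation θ x) = Complex.exp (σ * N * θ * Complex.I) * phase σ N ε x := by
  rw [phase, phase, signedCoord_rotation hσ, LinearIsometryEquiv.norm_map, mul_div_assoc, mul_pow,
    ← Complex.exp_nat_mul]
  congr 2
  ring

end Phase

/-! ### Changing the angular momentum by a phase. -/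

section Intertwiner

variable {r σ : ℝ}

lemma ae_restrict_ne_zero (Ω : Set Plane) : ∀ᵐ x ∂volume.restrict Ω, x ≠ 0 := by
  refine ae_restrict_of_ae ?_
  rw [ae_iff]
  simp only [ne_eq, not_not, ofPred_eq_eq_singleton]
  exact measure_singleton 0

lemma memLp_phase_zero (hσ : σ ^ 2 = 1) (N : ℕ) (Ω : Set Plane) :
    MemLp (phase σ N 0) ∞ (volume.restrict Ω) := by
  refine memLp_top_of_bound ?_ 1 (ae_of_all _ fun x => norm_phase_le hσ N 0 x)
  have h1 : Measurable (signedCoord σ) := (contDiff_signedCoord σ 0).continuous.measurable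
  have h2 : Measurable (phase σ N 0) := by
    unfold phase
    fun_prop
  exact h2.aestronglyMeasurable

lemma norm_mulL2_of_norm_eq_one {Ω : Set Plane} {f : Plane → ℂ}
    (hf : MemLp f ∞ (volume.restrict Ω)) (h1 : ∀ᵐ x ∂volume.restrict Ω, ‖f x‖ = 1) (u : L2 Ω) :
    ‖mulL2 hf u‖ = ‖u‖ := by
  rw [Lp.norm_def, Lp.norm_def]
  congr 1
  refine eLpNorm_congr_norm_ae ?_
  filter_upwards [coeFn_mulL2 hf u, h1] with x e1 e2
  rw [e1, norm_mul, e2, one_mul]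

lemma mulL2_phase_mem_angularMode (hσ : σ ^ 2 = 1) (N : ℕ) {m k : ℤ} (hk : (k : ℝ) = m + σ * N)
    {u : L2 (Metric.ball (0 : Plane) r)} (hu : u ∈ angularMode r m) :
    mulL2 (memLp_phase_zero hσ N (Metric.ball (0 : Plane) r)) u ∈ angularMode r k := by
  intro θ
  refine Lp.ext ?_
  set η := memLp_phase_zero hσ N (Metric.ball (0 : Plane) r)
  have hu' := hu θ
  filter_upwards [rotL2_mulL2 η θ (fun x _ => phase_rotation hσ N 0 θ x) u, coeFn_mulL2 η u,
    Lp.coeFn_smul (Complex.exp (m * θ * Complex.I)) u,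
    Lp.coeFn_smul (Complex.exp (k * θ * Complex.I)) (mulL2 η u)] with x e1 e2 e3 e4
  rw [e1, hu', e3, e4, Pi.smul_apply, Pi.smul_apply, e2, smul_eq_mul, smul_eq_mul]
  have hkC : (k : ℂ) = m + σ * N := by exact_mod_cast congrArg (fun t : ℝ => (t : ℂ)) hk
  have he : Complex.exp (k * θ * Complex.I) =
      Complex.exp (σ * N * θ * Complex.I) * Complex.exp (m * θ * Complex.I) := by
    rw [← Complex.exp_add, hkC]
    congr 1
    ring
  rw [he]
  ring

/-- Functions of non-zero angular momentum satisfy Hardy's inequality pointwise. -/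
lemma norm_le_mul_of_mem_angularMode {m : ℤ} (hm : m ≠ 0) {u : L2 (Metric.ball (0 : Plane) r)}
    (hu : u ∈ angularMode r m) {g : Fin 2 → L2 (Metric.ball (0 : Plane) r)}
    (h : (u, g) ∈ sobolevGraph (Metric.ball (0 : Plane) r)) :
    ∀ᵐ x ∂volume.restrict (Metric.ball (0 : Plane) r), ‖u x‖ ≤ ‖x‖ * (‖g 0 x‖ + ‖g 1 x‖) := by
  filter_upwards [angular_derivative_eq hu h] with x hx
  have h1 : ‖(m : ℂ) * Complex.I * u x‖ = |(m : ℝ)| * ‖u x‖ := by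
    rw [norm_mul, norm_mul, Complex.norm_I, mul_one, Complex.norm_intCast]
  have h2 : (1 : ℝ) ≤ |(m : ℝ)| := by exact_mod_cast Int.one_le_abs hm
  have h3 : |x 0| ≤ ‖x‖ := PiLp.norm_apply_le x 0
  have h4 : |x 1| ≤ ‖x‖ := PiLp.norm_apply_le x 1
  calc ‖u x‖ ≤ |(m : ℝ)| * ‖u x‖ := le_mul_of_one_le_left (norm_nonneg _) h2
    _ = ‖(x 0 : ℂ) * g 1 x - x 1 * g 0 x‖ := by rw [hx, h1]
    _ ≤ |x 0| * ‖g 1 x‖ + |x 1| * ‖g 0 x‖ := by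
        refine (norm_sub_le _ _).trans ?_
        rw [norm_mul, norm_mul, Complex.norm_real, Complex.norm_real, Real.norm_eq_abs,
          Real.norm_eq_abs]
    _ ≤ ‖x‖ * ‖g 1 x‖ + ‖x‖ * ‖g 0 x‖ := by gcongr
    _ = ‖x‖ * (‖g 0 x‖ + ‖g 1 x‖) := by ring

lemma norm_phaseDeriv_mul_le_of_norm_le (hσ : σ ^ 2 = 1) (N : ℕ) (ε : ℝ) (j : Fin 2) {x : Plane}
    {a : ℂ} {b : ℝ} (hb : 0 ≤ b) (h : N = 0 ∨ ‖a‖ ≤ ‖x‖ * b) :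
    ‖phaseDeriv σ N ε j x * a‖ ≤ 2 * N * b := by
  rcases h with rfl | h
  · simp [phaseDeriv]
  · rw [norm_mul]
    calc ‖phaseDeriv σ N ε j x‖ * ‖a‖ ≤ ‖phaseDeriv σ N ε j x‖ * (‖x‖ * b) := by gcongr
      _ = ‖phaseDeriv σ N ε j x‖ * ‖x‖ * b := by ring
      _ ≤ 2 * N * b := mul_le_mul_of_nonneg_right (norm_phaseDeriv_mul_le hσ N ε j) hb

/-- Multiplication by a phase that maps angular modes to angular modes preserves `H¹₀`. -/
theorem exists_phase_mem_sobolevGraph (hσ : σ ^ 2 = 1) (N : ℕ) {m : ℤ} (hm : N = 0 ∨ m ≠ 0)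
    {u : L2 (Metric.ball (0 : Plane) r)} (hu : u ∈ angularMode r m)
    {g : Fin 2 → L2 (Metric.ball (0 : Plane) r)}
    (h : (u, g) ∈ sobolevGraph (Metric.ball (0 : Plane) r)) :
    ∃ g' : Fin 2 → L2 (Metric.ball (0 : Plane) r),
      (mulL2 (memLp_phase_zero hσ N (Metric.ball (0 : Plane) r)) u, g') ∈
        sobolevGraph (Metric.ball (0 : Plane) r) ∧
      ∀ j, g' j =ᵐ[volume.restrict (Metric.ball (0 : Plane) r)]
        fun x => phase σ N 0 x * g j x + phaseDeriv σ N 0 j x * u x := by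
  set μ := volume.restrict (Metric.ball (0 : Plane) r) with hμ
  have : IsFiniteMeasure μ := isFiniteMeasure_restrict.2 measure_ball_lt_top.ne
  -- The Hardy bound compensates the 1/|x| in the gradient of the phase. It fails for radial
  -- functions, but for N = 0 the phase is constant and nothing has to be compensated.
  have hard : ∀ᵐ x ∂μ, N = 0 ∨ ‖u x‖ ≤ ‖x‖ * (‖g 0 x‖ + ‖g 1 x‖) := by
    rcases hm with h0 | h0
    · exact ae_of_all _ fun x => Or.inl h0
    · filter_upwards [norm_le_mul_of_mem_angularMode h0 hu h] with x hx using Or.inr hx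
  let G : Fin 2 → Plane → ℝ := fun j x => ‖g j x‖ + 2 * N * (‖g 0 x‖ + ‖g 1 x‖)
  have hG : ∀ j, MemLp (G j) 2 μ := fun j => (Lp.memLp (g j)).norm.add
    (((Lp.memLp (g 0)).norm.add (Lp.memLp (g 1)).norm).const_mul (2 * N : ℝ))
  have hbound : ∀ (ε : ℝ) j, ∀ᵐ x ∂μ,
      ‖phase σ N ε x * g j x + phaseDeriv σ N ε j x * u x‖ ≤ G j x := by
    intro ε j
    filter_upwards [hard] with x hx
    refine (norm_add_le _ _).trans (add_le_add ?_ ?_)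
    · rw [norm_mul]
      exact mul_le_of_le_one_left (norm_nonneg _) (norm_phase_le hσ N ε x)
    · exact norm_phaseDeriv_mul_le_of_norm_le hσ N ε j (by positivity) hx
  have hmeas : ∀ j, Measurable (phaseDeriv σ N 0 j) := by
    intro j
    have h1 : Measurable (signedCoord σ) := (contDiff_signedCoord σ 0).continuous.measurable
    have h2 : Measurable fun x : Plane => x j := (contDiff_coord 0 j).continuous.measurable
    unfold phaseDeriv
    fun_prop
  have hLp : ∀ j, MemLp (fun x => phase σ N 0 x * g j x + phaseDeriv σ N 0 j x * u x) 2 μ := by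
    intro j
    refine (hG j).mono' ?_ (hbound 0 j)
    exact ((memLp_phase_zero hσ N _).1.mul (Lp.memLp (g j)).1).add
      ((hmeas j).aestronglyMeasurable.mul (Lp.memLp u).1)
  refine ⟨fun j => (hLp j).toLp, ?_, fun j => (hLp j).coeFn_toLp⟩
  -- For ε = 1/(n + 1) the phase is a C¹ multiplier and preserves H¹₀. The limit follows by
  -- dominated convergence and closedness of the Sobolev graph.
  have hε : ∀ n : ℕ, (1 / ((n : ℝ) + 1)) ≠ 0 := fun n => by positivity
  let η : ∀ n : ℕ, BoundedC1 (Metric.ball (0 : Plane) r) (phase σ N (1 / ((n : ℝ) + 1))) :=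
    fun n => .of_contDiff (contDiff_phase σ N (hε n)) r
  have hmem : ∀ n, mulGraph (η n) (u, g) ∈ sobolevGraph (Metric.ball (0 : Plane) r) := fun n =>
    mulGraph_mem_sobolevGraph Metric.isOpen_ball (η n) h
  have hto : Tendsto (fun n : ℕ => 1 / ((n : ℝ) + 1)) atTop (𝓝 0) :=
    tendsto_one_div_add_atTop_nhds_zero_nat
  have hclosed : IsClosed (sobolevGraph (Metric.ball (0 : Plane) r) :
    Set (L2 (Metric.ball (0 : Plane) r) × (Fin 2 → L2 (Metric.ball (0 : Plane) r)))) :=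
    Submodule.isClosed_topologicalClosure _
  refine hclosed.mem_of_tendsto (f := fun n => mulGraph (η n) (u, g)) (b := atTop) ?_
    (Eventually.of_forall hmem)
  refine Tendsto.prodMk_nhds ?_ (tendsto_pi_nhds.2 fun j => ?_)
  · have e : ∀ n, (mulL2 (η n).memLp u : Plane → ℂ) =ᵐ[μ]
        fun x => phase σ N (1 / ((n : ℝ) + 1)) x * u x := fun n => coeFn_mulL2 (η n).memLp u
    refine tendsto_L2_of_dominated (Lp.memLp u).norm (fun n => ?_) ?_ ?_
    · filter_upwards [e n] with x hx
      refine (congrArg norm hx).trans_le ?_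
      rw [norm_mul]
      exact mul_le_of_le_one_left (norm_nonneg _) (norm_phase_le hσ N _ x)
    · filter_upwards [coeFn_mulL2 (memLp_phase_zero hσ N (Metric.ball (0 : Plane) r)) u] with x hx
      rw [hx, norm_mul]
      exact mul_le_of_le_one_left (norm_nonneg _) (norm_phase_le hσ N _ x)
    · filter_upwards [coeFn_mulL2 (memLp_phase_zero hσ N (Metric.ball (0 : Plane) r)) u,
        ae_all_iff.2 e, ae_restrict_ne_zero _] with x h1 h2 h3
      rw [h1]
      exact (((tendsto_phase σ N h3).comp hto).mul_const (u x)).congr fun n => (h2 n).symm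
  · have e : ∀ n, ((mulL2 (η n).memLp (g j) + mulL2 ((η n).memLp_fderiv j) u :
        L2 (Metric.ball (0 : Plane) r)) : Plane → ℂ) =ᵐ[μ] fun x =>
        phase σ N (1 / ((n : ℝ) + 1)) x * g j x + phaseDeriv σ N (1 / ((n : ℝ) + 1)) j x * u x := by
      intro n
      filter_upwards [coeFn_mulL2 (η n).memLp (g j), coeFn_mulL2 ((η n).memLp_fderiv j) u,
        Lp.coeFn_add (mulL2 (η n).memLp (g j)) (mulL2 ((η n).memLp_fderiv j) u)] with x h1 h2 h3
      rw [h3, Pi.add_apply, h1, h2, fderiv_phase σ N (hε n)]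
    refine tendsto_L2_of_dominated (hG j) (fun n => ?_) ?_ ?_
    · filter_upwards [e n, hbound (1 / ((n : ℝ) + 1)) j] with x hx hb
      exact (congrArg norm hx).trans_le hb
    · filter_upwards [(hLp j).coeFn_toLp, hbound 0 j] with x hx hb
      rwa [hx]
    · filter_upwards [(hLp j).coeFn_toLp, ae_all_iff.2 e, ae_restrict_ne_zero _] with x h1 h2 h3
      rw [h1]
      exact ((((tendsto_phase σ N h3).comp hto).mul_const (g j x)).add
        (((tendsto_phaseDeriv σ N j h3).comp hto).mul_const (u x))).congr fun n => (h2 n).symm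

lemma norm_sq_eq_integral {Ω : Set Plane} (f : L2 Ω) : ‖f‖ ^ 2 = ∫ x in Ω, ‖f x‖ ^ 2 := by
  have h1 : ((‖f‖ ^ 2 : ℝ) : ℂ) = ⟪f, f⟫_ℂ := by
    rw [inner_self_eq_norm_sq_to_K]; norm_cast
  have h2 : ⟪f, f⟫_ℂ = ((∫ x in Ω, ‖f x‖ ^ 2 : ℝ) : ℂ) := by
    rw [L2.inner_def, ← integral_complex_ofReal]
    refine integral_congr_ae (ae_of_all _ fun x => ?_)
    simp only [inner_self_eq_norm_sq_to_K]
    norm_cast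
  exact_mod_cast h1.trans h2

lemma integrable_norm_sq {Ω : Set Plane} (f : L2 Ω) :
    Integrable (fun x => ‖f x‖ ^ 2) (volume.restrict Ω) :=
  (memLp_two_iff_integrable_sq_norm (Lp.memLp f).1).1 (Lp.memLp f)

lemma sum_norm_sq_le {Ω : Set Plane} {ι : Type*} [Fintype ι] {f g : ι → L2 Ω}
    (h : ∀ᵐ x ∂volume.restrict Ω, ∑ i, ‖f i x‖ ^ 2 ≤ ∑ i, ‖g i x‖ ^ 2) :
    ∑ i, ‖f i‖ ^ 2 ≤ ∑ i, ‖g i‖ ^ 2 := by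
  simp_rw [norm_sq_eq_integral]
  rw [← integral_finsetSum _ fun i _ => integrable_norm_sq _,
    ← integral_finsetSum _ fun i _ => integrable_norm_sq _]
  exact integral_mono_ae (integrable_finsetSum _ fun i _ => integrable_norm_sq _)
    (integrable_finsetSum _ fun i _ => integrable_norm_sq _) h

/-- The splitting of a vector into its radial and angular components, both scaled by |x|. -/
lemma norm_sq_add_norm_sq (x₀ x₁ : ℝ) (a b : ℂ) : (x₀ ^ 2 + x₁ ^ 2) * (‖a‖ ^ 2 + ‖b‖ ^ 2) =
    ‖x₀ * a + x₁ * b‖ ^ 2 + ‖x₀ * b - x₁ * a‖ ^ 2 := by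
  simp only [← Complex.normSq_eq_norm_sq, Complex.normSq_apply, Complex.add_re, Complex.add_im,
    Complex.sub_re, Complex.sub_im, Complex.re_ofReal_mul, Complex.im_ofReal_mul]
  ring

/-- The pointwise comparison of energy densities after the change of angular momentum. -/
lemma energy_le {x : Plane} (hx : x ≠ 0) {u a b p v₁ v₂ : ℂ} (hp : ‖p‖ = 1) {m k n α : ℝ}
    (hk : k = m + n) (hang : (x 0 : ℂ) * b - x 1 * a = m * Complex.I * u)
    (hle : k ^ 2 + ‖v₂‖ ^ 2 * ‖x‖ ^ 2 ≤ (m - α * ‖x‖ ^ 2) ^ 2 + ‖v₁‖ ^ 2 * ‖x‖ ^ 2) :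
    ‖p * a + p * (Complex.I * n * perp x 0 / ‖x‖ ^ 2) * u‖ ^ 2 +
      ‖p * b + p * (Complex.I * n * perp x 1 / ‖x‖ ^ 2) * u‖ ^ 2 + ‖v₂ * (p * u)‖ ^ 2 ≤
    ‖Complex.I * a + (α * perp x 0 : ℝ) * u‖ ^ 2 + ‖Complex.I * b + (α * perp x 1 : ℝ) * u‖ ^ 2 +
      ‖v₁ * u‖ ^ 2 := by
  have hR : 0 < ‖x‖ ^ 2 := by have := norm_pos_iff.2 hx; positivity
  have hRC : (‖x‖ : ℂ) ≠ 0 := by exact_mod_cast (norm_ne_zero_iff.2 hx)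
  have hn : (‖x‖ : ℂ) ^ 2 = (x 0 : ℂ) ^ 2 + (x 1 : ℂ) ^ 2 := by exact_mod_cast norm_sq_plane x
  rw [mul_assoc p, mul_assoc p, ← mul_add, ← mul_add, mul_left_comm v₂ p]
  simp only [norm_mul p, hp, one_mul]
  refine le_of_mul_le_mul_left ?_ hR
  have hsplit : ∀ c d : ℂ, ‖x‖ ^ 2 * (‖c‖ ^ 2 + ‖d‖ ^ 2) =
      ‖x 0 * c + x 1 * d‖ ^ 2 + ‖x 0 * d - x 1 * c‖ ^ 2 := fun c d => by
    rw [norm_sq_plane x]; exact norm_sq_add_norm_sq _ _ _ _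
  rw [mul_add, mul_add _ (_ + _), hsplit, hsplit]
  -- The phase gradient and the potential are purely angular, so the radial components agree up to
  -- the factor i. The angular components become k and α|x|² - m times u up to unimodular factors,
  -- and `hle` compares their squares.
  have e1 : (x 0 : ℂ) * (a + Complex.I * n * perp x 0 / ‖x‖ ^ 2 * u) +
      x 1 * (b + Complex.I * n * perp x 1 / ‖x‖ ^ 2 * u) = x 0 * a + x 1 * b := by
    rw [perp_apply_zero, perp_apply_one]; push_cast; ring
  have e2 : (x 0 : ℂ) * (b + Complex.I * n * perp x 1 / ‖x‖ ^ 2 * u) -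
      x 1 * (a + Complex.I * n * perp x 0 / ‖x‖ ^ 2 * u) = (k : ℂ) * (Complex.I * u) := by
    have : (x 0 : ℂ) * (Complex.I * n * perp x 1 / ‖x‖ ^ 2 * u) -
        x 1 * (Complex.I * n * perp x 0 / ‖x‖ ^ 2 * u) = n * Complex.I * u := by
      rw [perp_apply_zero, perp_apply_one]
      field_simp
      rw [hn]; push_cast; ring
    rw [hk]; push_cast
    linear_combination hang + this
  have e3 : (x 0 : ℂ) * (Complex.I * a + (α * perp x 0 : ℝ) * u) +
      x 1 * (Complex.I * b + (α * perp x 1 : ℝ) * u) = Complex.I * (x 0 * a + x 1 * b) := by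
    rw [perp_apply_zero, perp_apply_one]; push_cast; ring
  have e4 : (x 0 : ℂ) * (Complex.I * b + (α * perp x 1 : ℝ) * u) -
      x 1 * (Complex.I * a + (α * perp x 0 : ℝ) * u) = ((α * ‖x‖ ^ 2 - m : ℝ) : ℂ) * u := by
    rw [perp_apply_zero, perp_apply_one]
    push_cast
    rw [hn]
    linear_combination Complex.I * hang + (m : ℂ) * u * Complex.I_sq
  rw [e1, e2, e3, e4]
  simp only [norm_mul, Complex.norm_I, one_mul, Complex.norm_real, mul_pow, Real.norm_eq_abs,
    sq_abs]
  nlinarith [mul_le_mul_of_nonneg_right hle (sq_nonneg ‖u‖)]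

end Intertwiner

/-! ### Comparison of modes and gauge invariance of the counts. -/

section Comparison

variable {Ω : Set Plane} {A A' : Plane → Plane} {v v' : Plane → ℂ}

/-- Pointwise domination of energy densities implies domination of form norms. -/
lemma norm_formElement_le (hA : BoundedField Ω A) (hv : MemLp v ∞ (volume.restrict Ω))
    (hA' : BoundedField Ω A') (hv' : MemLp v' ∞ (volume.restrict Ω))
    {u u' : L2 Ω} {w w' : Fin 2 → L2 Ω} (h : (u, w) ∈ magneticGraph Ω A)
    (h' : (u', w') ∈ magneticGraph Ω A') (hu : ‖u'‖ = ‖u‖)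
    (hae : ∀ᵐ x ∂volume.restrict Ω, ‖w' 0 x‖ ^ 2 + ‖w' 1 x‖ ^ 2 + ‖v' x * u' x‖ ^ 2 ≤
      ‖w 0 x‖ ^ 2 + ‖w 1 x‖ ^ 2 + ‖v x * u x‖ ^ 2) :
    ‖formElement hA' hv' h'‖ ≤ ‖formElement hA hv h‖ := by
  refine le_of_sq_le_sq ?_ (norm_nonneg _)
  rw [norm_sq_formElement, norm_sq_formElement, hu, Fin.sum_univ_two, Fin.sum_univ_two]
  have h1 := sum_norm_sq_le (f := ![w' 0, w' 1, mulL2 hv' u']) (g := ![w 0, w 1, mulL2 hv u]) (by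
    filter_upwards [hae, coeFn_mulL2 hv' u', coeFn_mulL2 hv u] with x e1 e2 e3
    simpa [Fin.sum_univ_three, e2, e3] using e1)
  simp [Fin.sum_univ_three] at h1
  linarith

/-- Comparison of the restrictions of two radially symmetric forms to angular modes. -/
theorem formCount_angularMode_le {r : ℝ} {a : Plane → ℝ}
    (hA : BoundedField (Metric.ball (0 : Plane) r) A)
    (hv : MemLp v ∞ (volume.restrict (Metric.ball (0 : Plane) r)))
    (hv' : MemLp v' ∞ (volume.restrict (Metric.ball (0 : Plane) r)))
    (hAa : ∀ x ∈ Metric.ball (0 : Plane) r, A x = a x • perp x)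
    (hvrot : ∀ θ, ∀ x ∈ Metric.ball (0 : Plane) r, v' (rotation θ x) = v' x)
    (hd : DiscreteForm (formEmbedding boundedField_zero hv')) {m k : ℤ} (hmk : m ≠ 0 ∨ k = m)
    (hle : ∀ x ∈ Metric.ball (0 : Plane) r, x ≠ 0 → (k : ℝ) ^ 2 + ‖v' x‖ ^ 2 * ‖x‖ ^ 2 ≤
      (m - a x * ‖x‖ ^ 2) ^ 2 + ‖v x‖ ^ 2 * ‖x‖ ^ 2) (Λ : ℝ) :
    formCount (formEmbedding hA hv) (angularMode r m) Λ ≤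
      formCount (formEmbedding boundedField_zero hv') (angularMode r k) Λ := by
  -- The shift k - m is encoded by its sign σ and its size N, since a negative shift needs a power
  -- of the conjugate coordinate.
  obtain ⟨σ, N, hσ, hkm⟩ : ∃ σ : ℝ, ∃ N : ℕ, σ ^ 2 = 1 ∧ (k : ℝ) = m + σ * N := by
    rcases le_total m k with h | h
    · obtain ⟨N, hN⟩ := Int.le.dest h
      refine ⟨1, N, by norm_num, ?_⟩
      rw [← hN]; push_cast; ring
    · obtain ⟨N, hN⟩ := Int.le.dest h
      refine ⟨-1, N, by norm_num, ?_⟩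
      rw [← hN]; push_cast; ring
  have hNm : N = 0 ∨ m ≠ 0 := by
    rcases hmk with h | h
    · exact Or.inr h
    · left
      rw [h] at hkm
      have h1 : σ * (N : ℝ) = 0 := by linarith
      have hσ0 : σ ≠ 0 := by rintro rfl; norm_num at hσ
      exact_mod_cast (mul_eq_zero.1 h1).resolve_left hσ0
  set η := memLp_phase_zero hσ N (Metric.ball (0 : Plane) r)
  have hη1 : ∀ᵐ x ∂volume.restrict (Metric.ball (0 : Plane) r), ‖phase σ N 0 x‖ = 1 := by
    filter_upwards [ae_restrict_ne_zero _] with x hx using norm_phase_zero hσ N hx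
  have hred := reduces_angularMode boundedField_zero hv' (fun θ x _ => by simp) hvrot k
  refine formCount_le_formCount hd hred (mulL2 η) (norm_mulL2_of_norm_eq_one η hη1)
    (fun q hq => ?_) Λ
  obtain ⟨hw, -⟩ := (mem_formSpace_iff hA hv).1 q.2
  obtain ⟨g, hg, hgw⟩ := (mem_magneticGraph_iff hA).1 hw
  rw [formEmbedding_apply] at hq ⊢
  obtain ⟨g', hg', hgg'⟩ := exists_phase_mem_sobolevGraph hσ N hNm hq hg
  have hw' : (mulL2 η ((q : FormAmbient _) 0), fun j => Complex.I • g' j +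
      mulL2 (boundedField_zero j) (mulL2 η ((q : FormAmbient _) 0))) ∈
      magneticGraph (Metric.ball (0 : Plane) r) 0 :=
    (mem_magneticGraph_iff boundedField_zero).2 ⟨g', hg', fun j => rfl⟩
  refine ⟨formElement boundedField_zero hv' hw', rfl, mulL2_phase_mem_angularMode hσ N hkm hq, ?_⟩
  conv_rhs => rw [eq_formElement hA hv q]
  refine norm_formElement_le hA hv boundedField_zero hv' hw hw'
    (norm_mulL2_of_norm_eq_one η hη1 _) ?_
  set u := (q : FormAmbient (Metric.ball (0 : Plane) r)) 0
  have e1 : ∀ j, ∀ᵐ x ∂volume.restrict (Metric.ball (0 : Plane) r), ‖(Complex.I • g' j +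
      mulL2 (boundedField_zero j) (mulL2 η u) : L2 (Metric.ball (0 : Plane) r)) x‖ =
      ‖g' j x‖ := by
    intro j
    filter_upwards [Lp.coeFn_add (Complex.I • g' j) (mulL2 (boundedField_zero j) (mulL2 η u)),
      Lp.coeFn_smul Complex.I (g' j), coeFn_mulL2 (boundedField_zero j) (mulL2 η u)] with x k1 k2 k3
    rw [k1, Pi.add_apply, k2, k3, Pi.smul_apply]
    simp
  have e2 : ∀ j, ∀ᵐ x ∂volume.restrict (Metric.ball (0 : Plane) r),
      (q : FormAmbient (Metric.ball (0 : Plane) r)) (![1, 2] j) x =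
        Complex.I * g j x + (a x * perp x j : ℝ) * u x := by
    intro j
    have k0 := hgw j
    simp only at k0
    rw [k0]
    filter_upwards [Lp.coeFn_add (Complex.I • g j) (mulL2 (hA j) u),
      Lp.coeFn_smul Complex.I (g j), coeFn_mulL2 (hA j) u,
      ae_restrict_mem Metric.isOpen_ball.measurableSet] with x k1 k2 k3 k4
    rw [k1, Pi.add_apply, k2, k3, Pi.smul_apply, hAa x k4]
    rfl
  filter_upwards [e1 0, e1 1, e2 0, e2 1, hgg' 0, hgg' 1, coeFn_mulL2 η u,
    ae_restrict_mem Metric.isOpen_ball.measurableSet, ae_restrict_ne_zero _,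
    angular_derivative_eq hq hg] with x k1 k2 k3 k4 k5 k6 k7 k8 k9 k10
  rw [k1, k2, k3, k4, k5, k6, k7, phaseDeriv_zero hσ N 0 k9, phaseDeriv_zero hσ N 1 k9]
  have := energy_le k9 (p := phase σ N 0 x) (norm_phase_zero hσ N k9) hkm
    (by exact_mod_cast k10) (hle x k8 k9)
  exact_mod_cast this

lemma fderiv_gauge {χ : Plane → ℝ} {F : Plane → Plane} {x : Plane}
    (hχ : HasFDerivAt χ (innerSL ℝ (F x)) x) (j : Fin 2) :
    fderiv ℝ (fun y => Complex.exp (-(χ y * Complex.I))) x (basisVec j) =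
      -(Complex.I * F x j) * Complex.exp (-(χ x * Complex.I)) := by
  have h1 := ((Complex.ofRealCLM.hasFDerivAt (x := χ x)).comp x hχ)
  have h2 := (h1.mul_const Complex.I).neg.cexp
  have h3 := congrArg (fun L => L (basisVec j)) h2.fderiv
  refine Eq.trans ?_ (h3.trans ?_)
  · rfl
  · have : ⟪F x, basisVec j⟫_ℝ = F x j := by
      simp [basisVec, EuclideanSpace.inner_single_right]
    simp [this]
    ring

lemma mulGraph_apply {f : Plane → ℂ} (hη : BoundedC1 Ω f) (u : L2 Ω) (g : Fin 2 → L2 Ω) :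
    mulGraph hη (u, g) =
      (mulL2 hη.memLp u, fun j => mulL2 hη.memLp (g j) + mulL2 (hη.memLp_fderiv j) u) := rfl

/-- With f = e^{-iχ} and ∇χ = A - A', one has (i∇ + A')(f u) = f (i∇ + A) u. -/
lemma gauge_mem_magneticGraph (hΩ : IsOpen Ω) [IsFiniteMeasure (volume.restrict Ω)]
    (hA : BoundedField Ω A) {f : Plane → ℂ} (hη : BoundedC1 Ω f)
    (hfd : ∀ j, ∀ x ∈ Ω, fderiv ℝ f x (basisVec j) = -(Complex.I * (A x j - A' x j : ℝ)) * f x)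
    {u : L2 Ω} {w : Fin 2 → L2 Ω} (hw : (u, w) ∈ magneticGraph Ω A) :
    (mulL2 hη.memLp u, fun j => mulL2 hη.memLp (w j)) ∈ magneticGraph Ω A' := by
  obtain ⟨g, hg, hgw⟩ := (mem_magneticGraph_iff hA).1 hw
  have hg' := mulGraph_mem_sobolevGraph hΩ hη hg
  rw [mulGraph_apply] at hg'
  refine ⟨_, hg', fun j => ?_⟩
  filter_upwards [coeFn_mulL2 hη.memLp (w j), coeFn_mulL2 hη.memLp u,
    coeFn_mulL2 hη.memLp (g j), coeFn_mulL2 (hη.memLp_fderiv j) u,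
    Lp.coeFn_add (mulL2 hη.memLp (g j)) (mulL2 (hη.memLp_fderiv j) u),
    Lp.coeFn_add (Complex.I • g j) (mulL2 (hA j) u), Lp.coeFn_smul Complex.I (g j),
    coeFn_mulL2 (hA j) u, ae_restrict_mem hΩ.measurableSet] with x k1 k2 k3 k4 k5 k6 k7 k8 k9
  rw [k1, k2, k5, Pi.add_apply, k3, k4, hfd j x k9, hgw j, k6, Pi.add_apply, k7, k8, Pi.smul_apply,
    smul_eq_mul]
  push_cast
  linear_combination (f x * u x * ((A x j : ℂ) - A' x j)) * Complex.I_sq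

/-- Gauge transformations do not change the eigenvalue counts. -/
theorem formCount_le_of_gauge (hΩ : IsOpen Ω) [IsFiniteMeasure (volume.restrict Ω)]
    (hA : BoundedField Ω A) (hA' : BoundedField Ω A') (hv : MemLp v ∞ (volume.restrict Ω))
    (hd : DiscreteForm (formEmbedding hA' hv)) {χ : Plane → ℝ}
    (hχ : ∀ x ∈ Ω, HasFDerivAt χ (innerSL ℝ (A x - A' x)) x)
    (hcont : ContinuousOn (fun x => A x - A' x) Ω) (Λ : ℝ) :
    formCount (formEmbedding hA hv) ⊤ Λ ≤ formCount (formEmbedding hA' hv) ⊤ Λ := by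
  set f : Plane → ℂ := fun y => Complex.exp (-(χ y * Complex.I)) with hf
  have hf1 : ∀ x, ‖f x‖ = 1 := fun x => by
    rw [hf]
    simp only [Complex.norm_exp]
    simp
  have hχ1 : ContDiffOn ℝ 1 χ Ω := by
    refine (contDiffOn_succ_iff_fderiv_of_isOpen (n := 0) hΩ).2
      ⟨fun x hx => (hχ x hx).differentiableAt.differentiableWithinAt, by simp, ?_⟩
    rw [contDiffOn_zero]
    exact ((innerSL ℝ).continuous.comp_continuousOn hcont).congr fun x hx => (hχ x hx).fderiv
  have hf2 : ContDiffOn ℝ 1 f Ω :=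
    (((Complex.ofRealCLM.contDiff.comp_contDiffOn hχ1).mul contDiffOn_const).neg).cexp
  have hfm : MemLp f ∞ (volume.restrict Ω) :=
    memLp_top_of_bound (hf2.continuousOn.aestronglyMeasurable hΩ.measurableSet) 1
      (ae_of_all _ fun x => (hf1 x).le)
  have hfd : ∀ j, ∀ x ∈ Ω, fderiv ℝ f x (basisVec j) = -(Complex.I * (A x j - A' x j : ℝ)) * f x :=
    fun j x hx => fderiv_gauge (F := fun x => A x - A' x) (hχ x hx) j
  have hη : BoundedC1 Ω f := by
    refine ⟨hf2, hfm, fun j => ?_⟩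
    have h1 : MemLp (fun x => (A x j : ℂ) - A' x j) ∞ (volume.restrict Ω) := (hA j).sub (hA' j)
    refine h1.of_le ?_ ?_
    · exact ((hf2.continuousOn_fderiv_of_isOpen hΩ le_rfl).clm_apply
        continuousOn_const).aestronglyMeasurable hΩ.measurableSet
    · filter_upwards [ae_restrict_mem hΩ.measurableSet] with x hx
      rw [hfd j x hx, norm_mul, hf1, mul_one, norm_neg, norm_mul, Complex.norm_I, one_mul]
      push_cast
      exact le_rfl
  have hred : Reduces (⊤ : Submodule ℂ (L2 Ω)) (formEmbedding hA' hv ∘L (formEmbedding hA' hv).adjoint) :=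
    reduces_of_mapsTo fun _ _ => Submodule.mem_top
  have hU := norm_mulL2_of_norm_eq_one hη.memLp (ae_of_all _ hf1)
  refine formCount_le_formCount hd hred (mulL2 hη.memLp) hU (fun q _ => ?_) Λ
  obtain ⟨hw, -⟩ := (mem_formSpace_iff hA hv).1 q.2
  obtain ⟨g, hg, hgw⟩ := (mem_magneticGraph_iff hA).1 hw
  rw [formEmbedding_apply]
  set u := (q : FormAmbient Ω) 0 with hu
  set w : Fin 2 → L2 Ω := fun j => (q : FormAmbient Ω) (![1, 2] j) with hwdef
  have hw' := gauge_mem_magneticGraph hΩ hA hη hfd hw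
  refine ⟨formElement hA' hv hw', rfl, Submodule.mem_top, ?_⟩
  conv_rhs => rw [eq_formElement hA hv q]
  refine norm_formElement_le hA hv hA' hv hw hw' (hU u) ?_
  filter_upwards [coeFn_mulL2 hη.memLp (w 0), coeFn_mulL2 hη.memLp (w 1),
    coeFn_mulL2 hη.memLp u] with x k0 k1 k2
  rw [k0, k1, k2, norm_mul, norm_mul, norm_mul, norm_mul, hf1, one_mul, one_mul, one_mul, norm_mul]

end Comparison

/-! ### The radial vector potential and the gauge function. -/

section RadialField

/-- The rotationally symmetric vector potential of a radial magnetic field. -/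
def radialField (B : ℝ → ℝ) (x : Plane) : Plane := (radialFlux B ‖x‖ / ‖x‖ ^ 2) • perp x

variable {B : ℝ → ℝ} {r₀ : ℝ}

lemma radialField_rotation (θ : ℝ) (x : Plane) :
    radialField B (rotation θ x) = rotation θ (radialField B x) := by
  rw [radialField, radialField, perp_rotation, LinearIsometryEquiv.norm_map, map_smul]

lemma norm_radialField (x : Plane) : ‖radialField B x‖ = |radialFlux B ‖x‖| / ‖x‖ := by
  rw [radialField, norm_smul, norm_perp, Real.norm_eq_abs, abs_div, abs_of_nonneg (sq_nonneg ‖x‖)]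
  rcases eq_or_ne ‖x‖ 0 with h | h
  · simp [h]
  · field_simp

lemma norm_radialField_eq_sqrt (x : Plane) :
    ‖radialField B x‖ = Real.sqrt (radialPotential B x) := by
  rw [norm_radialField, radialPotential, ← norm_sq_plane, Real.sqrt_sq (norm_nonneg x),
    ← Real.sqrt_sq (div_nonneg (abs_nonneg (radialFlux B ‖x‖)) (norm_nonneg x)), div_pow, sq_abs]
  congr 1
  ring

lemma intervalIntegrable_mul (hB : ContinuousOn B (Ico 0 r₀)) {r : ℝ} (hr : 0 ≤ r) (hr' : r < r₀) :
    IntervalIntegrable (fun s => s * B s) volume 0 r := by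
  refine ContinuousOn.intervalIntegrable (continuousOn_id.mul (hB.mono ?_))
  rw [uIcc_of_le hr]
  exact fun s hs => ⟨hs.1, hs.2.trans_lt hr'⟩

lemma hasDerivAt_radialFlux (hB : ContinuousOn B (Ico 0 r₀)) {r : ℝ} (hr : 0 < r) (hr' : r < r₀) :
    HasDerivAt (radialFlux B) (r * B r) r := by
  have hc : ContinuousOn (fun s => s * B s) (Ioo 0 r₀) :=
    continuousOn_id.mul (hB.mono Ioo_subset_Ico_self)
  exact intervalIntegral.integral_hasDerivAt_right (intervalIntegrable_mul hB hr.le hr')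
    (hc.stronglyMeasurableAtFilter isOpen_Ioo r ⟨hr, hr'⟩)
    (hc.continuousAt (Ioo_mem_nhds hr hr'))

/-- The comparison is with the flux b r²/2 of a constant field. It is used with b = 0 for a
quadratic bound and with b = B(0) for the derivative of the potential at the origin. -/
lemma abs_radialFlux_sub_le (hB : ContinuousOn B (Ico 0 r₀)) {r : ℝ} (hr : 0 ≤ r) (hr' : r < r₀)
    {b ε : ℝ} (hε : ∀ s ∈ Icc 0 r, |B s - b| ≤ ε) : |radialFlux B r - b * r ^ 2 / 2| ≤ ε * r ^ 2 := by
  have h1 : radialFlux B r - b * r ^ 2 / 2 = ∫ s in (0 : ℝ)..r, (s * B s - b * s) := by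
    rw [intervalIntegral.integral_sub (intervalIntegrable_mul hB hr hr')
      (Continuous.intervalIntegrable (u := fun s => b * s) (by fun_prop) _ _),
      intervalIntegral.integral_const_mul, integral_id, radialFlux]
    ring
  rw [h1, ← Real.norm_eq_abs]
  refine (intervalIntegral.norm_integral_le_of_norm_le_const (C := ε * r) fun s hs => ?_).trans ?_
  · rw [uIoc_of_le hr] at hs
    have h2 := hε s ⟨hs.1.le, hs.2⟩
    rw [show s * B s - b * s = (B s - b) * s by ring, Real.norm_eq_abs, abs_mul,
      abs_of_nonneg hs.1.le]
    exact mul_le_mul h2 hs.2 hs.1.le ((abs_nonneg _).trans h2)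
  · rw [sub_zero, abs_of_nonneg hr]
    exact le_of_eq (by ring)

/-- Continuity of B gives the bound on the inner half. On the outer half the assumed bound by α
replaces any control of B up to the boundary. -/
lemma exists_abs_radialFlux_le (hr₀ : 0 < r₀) (hB : ContinuousOn B (Ico 0 r₀)) {α : ℝ}
    (hα : ∀ r ∈ Icc 0 r₀, 0 ≤ radialFlux B r ∧ radialFlux B r ≤ α) :
    ∃ K, ∀ r ∈ Ico 0 r₀, |radialFlux B r| ≤ K * r ^ 2 := by
  have hsub : Icc 0 (r₀ / 2) ⊆ Ico 0 r₀ := fun s hs => ⟨hs.1, by linarith [hs.2]⟩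
  obtain ⟨M, hM⟩ := isCompact_Icc.exists_bound_of_continuousOn (hB.mono hsub)
  refine ⟨max M (α / (r₀ / 2) ^ 2), fun r hr => ?_⟩
  rcases le_total r (r₀ / 2) with h | h
  · have h1 := abs_radialFlux_sub_le hB hr.1 hr.2 (b := 0) (ε := M) fun s hs => by
      simpa using hM s ⟨hs.1, hs.2.trans h⟩
    have h2 : |radialFlux B r| ≤ M * r ^ 2 := by simpa using h1
    exact h2.trans (mul_le_mul_of_nonneg_right (le_max_left _ _) (sq_nonneg r))
  · obtain ⟨h1, h2⟩ := hα r ⟨hr.1, hr.2.le⟩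
    rw [abs_of_nonneg h1]
    have h3 : α ≤ α / (r₀ / 2) ^ 2 * r ^ 2 := by
      rw [div_mul_eq_mul_div, le_div_iff₀ (by positivity)]
      exact mul_le_mul_of_nonneg_left (pow_le_pow_left₀ (by positivity) h 2) (h1.trans h2)
    exact h2.trans (h3.trans (mul_le_mul_of_nonneg_right (le_max_right _ _) (sq_nonneg r)))

/-- The rotation by a right angle as a continuous linear map. -/
def perpL : Plane →L[ℝ] Plane := (rotation (Real.pi / 2) : Plane →L[ℝ] Plane)

lemma perpL_apply (x : Plane) : perpL x = perp x := rfl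

/-- Φ(r) = B(0) r²/2 + o(r²), so the apparent singularity at the origin is removable and the
potential is differentiable there. The Poincaré lemma on the full disc needs this. -/
lemma hasFDerivAt_radialField_zero (hr₀ : 0 < r₀) (hB : ContinuousOn B (Ico 0 r₀)) :
    HasFDerivAt (radialField B) ((B 0 / 2) • perpL) 0 := by
  rw [hasFDerivAt_iff_isLittleO_nhds_zero, Asymptotics.isLittleO_iff]
  intro ε hε
  have hc := (hB 0 ⟨le_rfl, hr₀⟩)
  obtain ⟨δ, hδ, h⟩ := Metric.continuousWithinAt_iff.1 hc ε hε
  filter_upwards [Metric.ball_mem_nhds (0 : Plane) (lt_min hδ hr₀)] with x hx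
  rw [mem_ball_zero_iff, lt_min_iff] at hx
  have h1 := abs_radialFlux_sub_le hB (norm_nonneg x) hx.2 (b := B 0) (ε := ε) fun s hs => by
    refine (h ⟨hs.1, hs.2.trans_lt hx.2⟩ ?_).le
    rw [Real.dist_eq, sub_zero, abs_of_nonneg hs.1]
    exact hs.2.trans_lt hx.1
  have h0 : radialField B 0 = 0 := by simp [radialField]
  rw [zero_add, h0, sub_zero]
  change ‖radialField B x - (B 0 / 2) • perp x‖ ≤ ε * ‖x‖
  rw [radialField, ← sub_smul, norm_smul, norm_perp, Real.norm_eq_abs]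
  rcases eq_or_ne ‖x‖ 0 with hx0 | hx0
  · rw [hx0, mul_zero, mul_zero]
  · refine mul_le_mul_of_nonneg_right ?_ (norm_nonneg x)
    have h2 : radialFlux B ‖x‖ / ‖x‖ ^ 2 - B 0 / 2 =
        (radialFlux B ‖x‖ - B 0 * ‖x‖ ^ 2 / 2) / ‖x‖ ^ 2 := by field_simp
    rw [h2, abs_div, abs_of_nonneg (sq_nonneg ‖x‖), div_le_iff₀ (by positivity)]
    exact h1

lemma exists_hasFDerivAt_radialField (hr₀ : 0 < r₀) (hB : ContinuousOn B (Ico 0 r₀)) {x : Plane}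
    (hx : x ∈ Metric.ball (0 : Plane) r₀) : ∃ L : Plane →L[ℝ] Plane,
      HasFDerivAt (radialField B) L x ∧ L (basisVec 0) 1 - L (basisVec 1) 0 = B ‖x‖ := by
  rw [mem_ball_zero_iff] at hx
  rcases eq_or_ne x 0 with rfl | hx0
  · refine ⟨_, hasFDerivAt_radialField_zero hr₀ hB, ?_⟩
    change B 0 / 2 * perp (basisVec 0) 1 - B 0 / 2 * perp (basisVec 1) 0 = _
    rw [perp_apply_one, perp_apply_zero, norm_zero]
    simp [basisVec]
  · have hn : 0 < ‖x‖ := norm_pos_iff.2 hx0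
    have hs : Real.sqrt (‖x‖ ^ 2) = ‖x‖ := Real.sqrt_sq hn.le
    -- The radial coefficient is written as a function of s = |x|², which is smooth in x.
    have h1 : HasDerivAt (fun s => radialFlux B (Real.sqrt s) / s)
        ((B ‖x‖ / 2 * ‖x‖ ^ 2 - radialFlux B ‖x‖) / (‖x‖ ^ 2) ^ 2) (‖x‖ ^ 2) := by
      have h2 : HasDerivAt (radialFlux B) (‖x‖ * B ‖x‖) (Real.sqrt (‖x‖ ^ 2)) := by
        rw [hs]; exact hasDerivAt_radialFlux hB hn hx
      have h3 := (h2.comp _ (Real.hasDerivAt_sqrt (by positivity : ‖x‖ ^ 2 ≠ 0))).div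
        (hasDerivAt_id (‖x‖ ^ 2)) (by positivity : ‖x‖ ^ 2 ≠ 0)
      refine h3.congr_deriv ?_
      simp only [Function.comp_apply, hs, id_eq, mul_one]
      field_simp
    have h2 := h1.comp_hasFDerivAt x (hasStrictFDerivAt_norm_sq x).hasFDerivAt
    have h3 := h2.smul (perpL.hasFDerivAt (x := x))
    have h4 : (fun y : Plane => ((fun s => radialFlux B (Real.sqrt s) / s) ∘ fun y => ‖y‖ ^ 2) y •
        perpL y) = radialField B := by
      funext y
      simp only [Function.comp_apply, Real.sqrt_sq (norm_nonneg y)]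
      rfl
    refine ⟨_, h3.congr_of_eventuallyEq (Eventually.of_forall fun y => (congrFun h4 y).symm), ?_⟩
    have hin : ∀ j, ⟪x, basisVec j⟫_ℝ = x j := fun j => by
      simp [basisVec, EuclideanSpace.inner_single_right]
    simp [hin, perpL_apply, hs]
    simp [basisVec]
    have hn2 := norm_sq_plane x
    field_simp
    linear_combination (-(‖x‖ ^ 2 * B ‖x‖ - 2 * radialFlux B ‖x‖)) * hn2

variable {A : Plane → Plane}

/-- Two vector potentials on a disc with the same magnetic field differ by a gradient. -/
lemma exists_gauge {r₀ : ℝ} {F : Plane → Plane}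
    (h : ∀ x ∈ Metric.ball (0 : Plane) r₀, ∃ L : Plane →L[ℝ] Plane, HasFDerivAt F L x ∧
      L (basisVec 0) 1 = L (basisVec 1) 0) :
    ∃ χ : Plane → ℝ, ∀ x ∈ Metric.ball (0 : Plane) r₀, HasFDerivAt χ (innerSL ℝ (F x)) x := by
  choose! L hL hs using h
  set P : Fin 2 → Plane →L[ℝ] ℝ := fun j => EuclideanSpace.proj j with hP
  have hω : ∀ x, innerSL ℝ (F x) = F x 0 • P 0 + F x 1 • P 1 := by
    intro x
    ext v
    simp [hP, PiLp.inner_apply, Fin.sum_univ_two]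
    ring
  have hd : ∀ x ∈ Metric.ball (0 : Plane) r₀, HasFDerivAt (fun x => innerSL ℝ (F x))
      (((P 0) ∘L L x).smulRight (P 0) + ((P 1) ∘L L x).smulRight (P 1)) x := by
    intro x hx
    simp only [hω]
    have e : ∀ j, HasFDerivAt (fun x => F x j • P j) (((P j) ∘L L x).smulRight (P j)) x :=
      fun j => (((P j).hasFDerivAt (x := F x)).comp x (hL x hx)).smul_const (P j)
    exact (e 0).add (e 1)
  -- Poincaré lemma on a convex set: the 1-form dual to F has a symmetric derivative, by the
  -- vanishing curl. Differentiability of F suffices.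
  obtain ⟨χ, hχ⟩ := (convex_ball (0 : Plane) r₀).exists_forall_hasFDerivWithinAt_of_hasFDerivWithinAt_symmetric
    (fun x hx => (hd x hx).hasFDerivWithinAt) fun x hx v _ w _ => by
      rw [eq_smul_basisVec_add v, eq_smul_basisVec_add w]
      simp [hP, basisVec] at *
      have := hs x (by simpa using hx)
      linear_combination (v 0 * w 1 - v 1 * w 0) * this
  exact ⟨χ, fun x hx => (hχ x hx).hasFDerivAt (Metric.isOpen_ball.mem_nhds hx)⟩

end RadialField

/-! ### Boundedness, regularity and the inequality between angular momenta on the disc. -/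

section Disc

variable {B : ℝ → ℝ} {r₀ : ℝ} {A : Plane → Plane}

/-- The field inherits continuity from the curl of A, read along a radius. -/
lemma continuousOn_of_curl_eq (hA : ContDiffOn ℝ 1 A (Metric.closedBall 0 r₀))
    (hAB : ∀ x ∈ Metric.ball (0 : Plane) r₀, curl A x = B ‖x‖) : ContinuousOn B (Ico 0 r₀) := by
  have hA1 : ContDiffOn ℝ 1 A (Metric.ball 0 r₀) := hA.mono Metric.ball_subset_closedBall
  have hD : ContinuousOn (fderiv ℝ A) (Metric.ball 0 r₀) :=
    hA1.continuousOn_fderiv_of_isOpen Metric.isOpen_ball le_rfl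
  have hD' : ∀ i j : Fin 2, ContinuousOn (fun x => fderiv ℝ A x (basisVec i) j)
      (Metric.ball 0 r₀) := fun i j =>
    (contDiff_coord 0 j).continuous.comp_continuousOn (hD.clm_apply continuousOn_const)
  have hcurl : ContinuousOn (curl A) (Metric.ball 0 r₀) := (hD' 0 1).sub (hD' 1 0)
  have hn : ∀ s ∈ Ico 0 r₀, ‖s • basisVec 0‖ = s := fun s hs => by
    simp [norm_smul, basisVec, abs_of_nonneg hs.1]
  have hm : MapsTo (fun s : ℝ => s • basisVec 0) (Ico 0 r₀) (Metric.ball 0 r₀) := fun s hs => by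
    rw [mem_ball_zero_iff, hn s hs]; exact hs.2
  refine (hcurl.comp (by fun_prop) hm).congr fun s hs => ?_
  rw [Function.comp_apply, hAB _ (hm hs), hn s hs]

lemma boundedField_of_continuousOn {r C : ℝ}
    (hA : ContinuousOn A (Metric.ball 0 r)) (hC : ∀ x ∈ Metric.ball (0 : Plane) r, ‖A x‖ ≤ C) :
    BoundedField (Metric.ball 0 r) A := fun j => by
  refine memLp_top_of_bound ((Complex.continuous_ofReal.comp_continuousOn
    ((contDiff_coord 0 j).continuous.comp_continuousOn hA)).aestronglyMeasurable
      Metric.isOpen_ball.measurableSet) C ?_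
  filter_upwards [ae_restrict_mem Metric.isOpen_ball.measurableSet] with x hx
  rw [Complex.norm_real]
  exact (PiLp.norm_apply_le (A x) j).trans (hC x hx)

lemma continuousOn_radialField (hr₀ : 0 < r₀) (hB : ContinuousOn B (Ico 0 r₀)) :
    ContinuousOn (radialField B) (Metric.ball 0 r₀) := fun x hx => by
  obtain ⟨L, hL, -⟩ := exists_hasFDerivAt_radialField hr₀ hB hx
  exact hL.continuousAt.continuousWithinAt

lemma exists_norm_radialField_le (hr₀ : 0 < r₀) (hB : ContinuousOn B (Ico 0 r₀)) {α : ℝ}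
    (hα : ∀ r ∈ Icc 0 r₀, 0 ≤ radialFlux B r ∧ radialFlux B r ≤ α) :
    ∃ C, ∀ x ∈ Metric.ball (0 : Plane) r₀, ‖radialField B x‖ ≤ C := by
  obtain ⟨K, hK⟩ := exists_abs_radialFlux_le hr₀ hB hα
  refine ⟨|K| * r₀, fun x hx => ?_⟩
  rw [mem_ball_zero_iff] at hx
  rw [norm_radialField]
  rcases eq_or_ne ‖x‖ 0 with h0 | h0
  · rw [h0, div_zero]; positivity
  · rw [div_le_iff₀ (by positivity)]
    refine (hK ‖x‖ ⟨norm_nonneg x, hx⟩).trans ?_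
    calc K * ‖x‖ ^ 2 ≤ |K| * ‖x‖ ^ 2 := by gcongr; exact le_abs_self K
      _ = |K| * ‖x‖ * ‖x‖ := by ring
      _ ≤ |K| * r₀ * ‖x‖ := by gcongr

lemma exists_gauge_radialField (hr₀ : 0 < r₀) (hA : ContDiffOn ℝ 1 A (Metric.closedBall 0 r₀))
    (hAB : ∀ x ∈ Metric.ball (0 : Plane) r₀, curl A x = B ‖x‖) :
    ∃ χ : Plane → ℝ, ∀ x ∈ Metric.ball (0 : Plane) r₀,
      HasFDerivAt χ (innerSL ℝ (A x - radialField B x)) x := by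
  refine exists_gauge (F := fun x => A x - radialField B x) fun x hx => ?_
  obtain ⟨L, hL, hcurl⟩ := exists_hasFDerivAt_radialField hr₀ (continuousOn_of_curl_eq hA hAB) hx
  have hd : HasFDerivAt A (fderiv ℝ A x) x :=
    ((hA.contDiffAt (Metric.closedBall_mem_nhds_of_mem hx)).differentiableAt
      one_ne_zero).hasFDerivAt
  refine ⟨fderiv ℝ A x - L, hd.sub hL, ?_⟩
  have h1 := hAB x hx
  rw [curl] at h1
  simp only [_root_.sub_apply, PiLp.sub_apply]
  linarith

/-- There are non-zero elements of `H¹₀` of a disc. -/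
lemma exists_ne_zero_mem_sobolevGraph (hr₀ : 0 < r₀) :
    ∃ (u : L2 (Metric.ball (0 : Plane) r₀)) (g : Fin 2 → L2 (Metric.ball (0 : Plane) r₀)),
      (u, g) ∈ sobolevGraph (Metric.ball (0 : Plane) r₀) ∧ u ≠ 0 := by
  let f : ContDiffBump (0 : Plane) := ⟨r₀ / 4, r₀ / 2, by positivity, by linarith⟩
  set φ : Plane → ℂ := fun x => (f x : ℂ) with hφ
  have hφs : ContDiff ℝ ∞ φ := Complex.ofRealCLM.contDiff.comp f.contDiff
  have hφc : HasCompactSupport φ := f.hasCompactSupport.comp_left Complex.ofReal_zero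
  have hφt : IsTestFunction (Metric.ball (0 : Plane) r₀) φ := by
    refine ⟨hφs, hφc, (tsupport_comp_subset Complex.ofReal_zero f).trans ?_⟩
    rw [f.tsupport_eq]
    exact Metric.closedBall_subset_ball (by change r₀ / 2 < r₀; linarith)
  have hm : MemLp φ 2 (volume.restrict (Metric.ball (0 : Plane) r₀)) :=
    MemLp.of_continuous_hasCompactSupport hφs.continuous hφc
  have hmd : ∀ j, MemLp (fun x => fderiv ℝ φ x (basisVec j)) 2
      (volume.restrict (Metric.ball (0 : Plane) r₀)) := fun j =>
    MemLp.of_continuous_hasCompactSupport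
      ((hφs.continuous_fderiv (by simp)).clm_apply continuous_const) (hφc.fderiv_apply ℝ _)
  refine ⟨hm.toLp, fun j => (hmd j).toLp, Submodule.le_topologicalClosure _
    (mem_testGradientGraph_iff.2 ⟨φ, hφt, hm.coeFn_toLp, fun j => (hmd j).coeFn_toLp⟩), ?_⟩
  intro h0
  have h1 : ∀ᵐ x ∂volume.restrict (Metric.ball (0 : Plane) r₀), φ x = 0 := by
    have h2 := hm.coeFn_toLp
    rw [h0] at h2
    filter_upwards [h2, Lp.coeFn_zero ℂ 2 (volume.restrict (Metric.ball (0 : Plane) r₀))]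
      with x e1 e2
    rw [← e1, e2]; rfl
  have h3 : ∀ᵐ x ∂volume.restrict (Metric.ball (0 : Plane) (r₀ / 4)), False := by
    filter_upwards [ae_restrict_of_ae_restrict_of_subset
      (Metric.ball_subset_ball (by linarith : r₀ / 4 ≤ r₀)) h1,
      ae_restrict_mem Metric.isOpen_ball.measurableSet] with x e1 e2
    have e3 : f x = 1 := f.one_of_mem_closedBall (Metric.ball_subset_closedBall e2)
    rw [hφ] at e1
    simp [e3] at e1
  rw [ae_iff] at h3
  simp only [not_false_eq_true, ofPred_true, Measure.restrict_apply_univ] at h3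
  exact (Metric.measure_ball_pos volume (0 : Plane) (by positivity : 0 < r₀ / 4)).ne' h3

/-- The comparison of angular momenta behind the choice of the discretised momentum. -/
lemma sq_add_sq_le_of_flux {α Φ : ℝ} (hα : 2 * α ≤ 1) (h0 : 0 ≤ Φ) (h1 : Φ ≤ α) (m : ℤ) :
    (((if 0 ≤ m then ⌊Real.sqrt (1 - 2 * α) * (m.toNat : ℝ)⌋₊ else m.natAbs : ℕ) : ℤ) : ℝ) ^ 2 +
      Φ ^ 2 ≤ (m - Φ) ^ 2 := by
  split_ifs with h
  · obtain ⟨n, rfl⟩ := Int.eq_ofNat_of_zero_le h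
    have h2 : ((⌊Real.sqrt (1 - 2 * α) * (n : ℝ)⌋₊ : ℕ) : ℝ) ≤ Real.sqrt (1 - 2 * α) * n :=
      Nat.floor_le (by positivity)
    have h3 : ((⌊Real.sqrt (1 - 2 * α) * (n : ℝ)⌋₊ : ℕ) : ℝ) ^ 2 ≤ (1 - 2 * α) * n ^ 2 := by
      refine (pow_le_pow_left₀ (by positivity) h2 2).trans (le_of_eq ?_)
      rw [mul_pow, Real.sq_sqrt (by linarith)]
    have h4 : (n : ℝ) ≤ n ^ 2 := by
      rcases Nat.eq_zero_or_pos n with rfl | hn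
      · simp
      · have : (1 : ℝ) ≤ n := by exact_mod_cast hn
        nlinarith
    have h5 : Φ * n ≤ α * n ^ 2 := mul_le_mul h1 h4 (by positivity) (h0.trans h1)
    simp only [Int.toNat_natCast, Int.cast_natCast]
    nlinarith
  -- For negative momentum the cross term -2mΦ is nonnegative, so no lowering is needed.
  · have h2 : (((m.natAbs : ℕ) : ℤ) : ℝ) ^ 2 = (m : ℝ) ^ 2 := by
      rw [Int.natCast_natAbs, Int.cast_abs, sq_abs]
    have h3 : (m : ℝ) ≤ 0 := by exact_mod_cast (not_le.1 h).le
    rw [h2]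
    nlinarith

end Disc

/-! ### Summation over the angular momenta. -/

section DiscComparison

variable {B : ℝ → ℝ} {r₀ α : ℝ} {A : Plane → Plane} {v : Plane → ℂ}

lemma discreteForm_disc (hA : BoundedField (Metric.ball (0 : Plane) r₀) A)
    (hv : MemLp v ∞ (volume.restrict (Metric.ball (0 : Plane) r₀))) :
    DiscreteForm (formEmbedding hA hv) :=
  discreteForm_formEmbedding hA hv
    (exists_norm_sq_le_of_mem_orthogonal subset_rfl)

/-- Summing the comparison of angular modes. -/
theorem formCount_radialField_le (hα : 2 * α < 1) (hα0 : 0 ≤ α)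
    (hΦ : ∀ r ∈ Icc 0 r₀, 0 ≤ radialFlux B r ∧ radialFlux B r ≤ α)
    (hA : BoundedField (Metric.ball (0 : Plane) r₀) (radialField B))
    (h0 : MemLp (0 : Plane → ℂ) ∞ (volume.restrict (Metric.ball (0 : Plane) r₀)))
    (hv : MemLp (fun x => (‖radialField B x‖ : ℂ)) ∞
      (volume.restrict (Metric.ball (0 : Plane) r₀))) (Λ : ℝ) :
    formCount (formEmbedding hA h0) ⊤ Λ ≤
      ENNReal.ofReal (roundingConstant (Real.sqrt (1 - 2 * α))) *
        formCount (formEmbedding boundedField_zero hv) ⊤ Λ := by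
  have hd := discreteForm_disc boundedField_zero hv
  have hvrot : ∀ θ, ∀ x ∈ Metric.ball (0 : Plane) r₀,
      (‖radialField B (rotation θ x)‖ : ℂ) = ‖radialField B x‖ := fun θ x _ => by
    rw [radialField_rotation, LinearIsometryEquiv.norm_map]
  -- The modes of S are compared with each other by the same phase argument with zero potential: the
  -- counts decrease as |m| grows.
  have hS : ∀ m k : ℤ, (m ≠ 0 ∨ k = m) → (k : ℝ) ^ 2 ≤ (m : ℝ) ^ 2 →
      formCount (formEmbedding boundedField_zero hv) (angularMode r₀ m) Λ ≤
        formCount (formEmbedding boundedField_zero hv) (angularMode r₀ k) Λ := by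
    intro m k hmk hle
    refine formCount_angularMode_le (a := 0) boundedField_zero hv hv (fun x _ => by simp) hvrot hd
      hmk (fun x _ _ => ?_) Λ
    simpa using hle
  set n : ℕ → ℝ≥0∞ := fun k =>
    formCount (formEmbedding boundedField_zero hv) (angularMode r₀ k) Λ with hn
  have hanti : Antitone n := by
    intro j k hjk
    refine hS k j ?_ ?_
    · rcases Nat.eq_zero_or_pos k with rfl | hk
      · right; simpa using hjk
      · left; exact_mod_cast hk.ne'
    · simp only [Int.cast_natCast]
      gcongr
  have hc1 : Real.sqrt (1 - 2 * α) ≤ 1 := Real.sqrt_le_one.2 (by linarith)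
  have hc0 : 0 < Real.sqrt (1 - 2 * α) := Real.sqrt_pos.2 (by linarith)
  have hrad : ∀ m : ℤ, formCount (formEmbedding hA h0) (angularMode r₀ m) Λ ≤
      n (if 0 ≤ m then ⌊Real.sqrt (1 - 2 * α) * (m.toNat : ℝ)⌋₊ else m.natAbs) := by
    intro m
    refine formCount_angularMode_le (a := fun x => radialFlux B ‖x‖ / ‖x‖ ^ 2) hA h0 hv
      (fun x _ => rfl) hvrot hd ?_ (fun x hx hx0 => ?_) Λ
    · rcases eq_or_ne m 0 with rfl | hm
      · right; simp
      · exact Or.inl hm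
    · have hn0 : ‖x‖ ≠ 0 := norm_ne_zero_iff.2 hx0
      obtain ⟨h1, h2⟩ := hΦ ‖x‖ ⟨norm_nonneg x, (mem_ball_zero_iff.1 hx).le⟩
      have h3 : ‖((‖radialField B x‖ : ℝ) : ℂ)‖ ^ 2 * ‖x‖ ^ 2 = radialFlux B ‖x‖ ^ 2 := by
        rw [Complex.norm_real, Real.norm_of_nonneg (norm_nonneg _), norm_radialField, div_pow, sq_abs]
        field_simp
      rw [h3, div_mul_cancel₀ _ (pow_ne_zero 2 hn0)]
      simpa using sq_add_sq_le_of_flux hα.le h1 h2 m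
  calc formCount (formEmbedding hA h0) ⊤ Λ
      ≤ ∑' m : ℤ, formCount (formEmbedding hA h0) (angularMode r₀ m) Λ :=
        formCount_top_le_tsum _ inner_eq_zero_of_mem_angularMode
          eq_zero_of_forall_inner_angularMode
          (reduces_angularMode hA h0 (fun θ x _ => radialField_rotation θ x) fun _ _ _ => rfl) Λ
    _ ≤ ∑' m : ℤ, n (if 0 ≤ m then ⌊Real.sqrt (1 - 2 * α) * (m.toNat : ℝ)⌋₊ else m.natAbs) :=
        ENNReal.tsum_le_tsum hrad
    _ ≤ ENNReal.ofReal (roundingConstant (Real.sqrt (1 - 2 * α))) * ∑' k : ℤ, n k.natAbs :=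
        tsum_int_le hc0 hc1 hanti fun k => (hd.formCount_lt_top _ _).ne
    _ ≤ ENNReal.ofReal (roundingConstant (Real.sqrt (1 - 2 * α))) *
        ∑' k : ℤ, formCount (formEmbedding boundedField_zero hv) (angularMode r₀ k) Λ := by
        -- Modes k and -k of S have equal squared momentum, so the mode |k| can be replaced by the
        -- mode k.
        gcongr with k
        refine hS _ _ ?_ ?_
        · rcases eq_or_ne k 0 with rfl | hk
          · right; rfl
          · left; exact_mod_cast Int.natAbs_ne_zero.2 hk
        · rw [Int.natCast_natAbs, Int.cast_abs, sq_abs]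
    _ ≤ _ := by
        gcongr
        exact tsum_formCount_le _ inner_eq_zero_of_mem_angularMode Λ

end DiscComparison

end MagDisc

end

theorem mainTheorem9 (r₀ : ℝ) (hr₀ : 0 < r₀)
    (B : ℝ → ℝ) (A : MagDisc.Plane → MagDisc.Plane) (Ω : Set MagDisc.Plane)
    (hΩ : Ω = Metric.ball 0 r₀)
    (hA : ContDiffOn ℝ 1 A (Metric.closedBall 0 r₀))
    (hAB : ∀ x ∈ Ω, MagDisc.curl A x = B ‖x‖)
    (α : ℝ) (hα : α = MagDisc.radialFlux B r₀) (hα2 : α < 1 / 2)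
    (hB : ∀ r ∈ Set.Icc 0 r₀, 0 ≤ MagDisc.radialFlux B r ∧ MagDisc.radialFlux B r ≤ α) :
    (∀ Λ σ : ℝ, 0 ≤ Λ → 0 ≤ σ →
      MagDisc.rieszTrace (MagDisc.schrodingerOperator Ω (MagDisc.radialPotential B)) Λ σ < ⊤ ∧
      MagDisc.rieszTrace (MagDisc.magneticLaplacian Ω A) Λ σ ≤
        ENNReal.ofReal (MagDisc.discConstant α) *
          MagDisc.rieszTrace (MagDisc.schrodingerOperator Ω (MagDisc.radialPotential B)) Λ σ) ∧
    IsGLB (MagDisc.realSpectrum (MagDisc.schrodingerOperator Ω (MagDisc.radialPotential B)))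
      (sInf (MagDisc.realSpectrum (MagDisc.schrodingerOperator Ω (MagDisc.radialPotential B)))) ∧
    IsGLB (MagDisc.realSpectrum (MagDisc.magneticLaplacian Ω A))
      (sInf (MagDisc.realSpectrum (MagDisc.magneticLaplacian Ω A))) ∧
    sInf (MagDisc.realSpectrum (MagDisc.schrodingerOperator Ω (MagDisc.radialPotential B))) ≤
      sInf (MagDisc.realSpectrum (MagDisc.magneticLaplacian Ω A)) := by
  subst hΩ
  have hBc := MagDisc.continuousOn_of_curl_eq hA hAB
  -- The flux bounds at r = 0 already force α ≥ 0.
  have hα0 : 0 ≤ α := (hB 0 ⟨le_rfl, hr₀.le⟩).1.trans (hB 0 ⟨le_rfl, hr₀.le⟩).2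
  obtain ⟨C, hC⟩ := (isCompact_closedBall (0 : MagDisc.Plane) r₀).exists_bound_of_continuousOn
    hA.continuousOn
  have hAb : MagDisc.BoundedField (Metric.ball 0 r₀) A := MagDisc.boundedField_of_continuousOn
    (hA.continuousOn.mono Metric.ball_subset_closedBall)
    fun x hx => hC x (Metric.ball_subset_closedBall hx)
  have hrc := MagDisc.continuousOn_radialField hr₀ hBc
  obtain ⟨K, hK⟩ := MagDisc.exists_norm_radialField_le hr₀ hBc hB
  have hrb : MagDisc.BoundedField (Metric.ball 0 r₀) (MagDisc.radialField B) :=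
    MagDisc.boundedField_of_continuousOn hrc hK
  have hfin : IsFiniteMeasure (volume.restrict (Metric.ball (0 : MagDisc.Plane) r₀)) :=
    isFiniteMeasure_restrict.2 measure_ball_lt_top.ne
  have h0 : MemLp (0 : MagDisc.Plane → ℂ) ∞
    (volume.restrict (Metric.ball (0 : MagDisc.Plane) r₀)) := MemLp.zero
  have hv : MemLp (fun x => (‖MagDisc.radialField B x‖ : ℂ)) ∞
      (volume.restrict (Metric.ball (0 : MagDisc.Plane) r₀)) := by
    refine memLp_top_of_bound ((Complex.continuous_ofReal.comp_continuousOn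
      hrc.norm).aestronglyMeasurable Metric.isOpen_ball.measurableSet) K ?_
    filter_upwards [ae_restrict_mem Metric.isOpen_ball.measurableSet] with x hx
    rw [Complex.norm_real, norm_norm]
    exact hK x hx
  obtain ⟨χ, hχ⟩ := MagDisc.exists_gauge_radialField hr₀ hA hAB
  obtain ⟨u, g, hug, hu⟩ := MagDisc.exists_ne_zero_mem_sobolevGraph hr₀
  -- The square root of the potential of S is the length of the radial vector potential, so S has
  -- the form data A = 0, v = |`radialField`|.
  have hS := MagDisc.isFormGraph_dirichletOperator MagDisc.boundedField_zero hv
    (V := MagDisc.radialPotential B)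
    (fun x _ => congrArg Complex.ofReal (MagDisc.norm_radialField_eq_sqrt x))
    Metric.isOpen_ball.measurableSet fun x _ => by unfold MagDisc.radialPotential; positivity
  have hH := MagDisc.isFormGraph_dirichletOperator hAb h0 (V := 0) (fun x _ => by simp)
    Metric.isOpen_ball.measurableSet fun x _ => le_rfl
  refine MagDisc.rieszTrace_le_of_formCount_le hS hH (MagDisc.discreteForm_disc _ _)
    (MagDisc.discreteForm_disc _ _) (MagDisc.norm_formEmbedding_le _ _)
    (MagDisc.norm_formEmbedding_le _ _) (MagDisc.formEmbedding_ne_zero _ _ hug hu)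
    (MagDisc.formEmbedding_ne_zero _ _ hug hu) fun Λ => ?_
  -- The gauge step goes from A to the radial potential, and the mode comparison from there to S.
  -- The constant `discConstant α` unfolds to `roundingConstant` at √(1 - 2α).
  exact (MagDisc.formCount_le_of_gauge Metric.isOpen_ball hAb hrb h0
    (MagDisc.discreteForm_disc _ _) hχ
    ((hA.continuousOn.mono Metric.ball_subset_closedBall).sub hrc) Λ).trans
    (MagDisc.formCount_radialField_le (by linarith) hα0 hB hrb h0 hv Λ)
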